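/- Let $n\ge 3$ be an integer, let $0<\bar r\le\infty$, and let $h:[0,\bar r)\to(0,\infty)$ be a smooth function (up to and including $r=0$, with one-sided derivatives there) such that - (H1) $h'(0)=0$ and $h''(0)>0$; - (H2) $h'(r)>0$ for all $r\in(0,\bar r)$; - (H3) the function $2\,\frac{h''(r)}{h(r)}-(n-2)\,\frac{1-h'(r)^2}{h(r)^2}$ is non-decreasing on $(0,\bar r)$; - (H4) $\frac{h''(r)}{h(r)}+\frac{1-h'(r)^2}{h(r)^2}>0$ for all $r\in(0,\bar r)$. Let $M=S^{n-1}\times[0,\bar r)$ with the Riemannian metric $\bar g=\langle\cdot,\cdot\rangle=dr\otimes dr+h(r)^2\,g_{S^{n-1}}$ and Levi-Civita connection $\bar D$, and put $f=h'(r)$ and $X=h(r)\,\frac{\partial}{\partial r}$. Let $\Sigma$ be a closed (compact, without boundary) smoothly embedded hypersurface in $M$. Suppose that $\Sigma$ is star-shaped, i.e. it has a smooth unit normal field $\nu$ with $\langle\frac{\partial}{\partial r},\nu\rangle\ge 0$ on $\Sigma$, and fix such a $\nu$; suppose also that $\Sigma$ is convex, i.e. for some choice of a smooth unit normal field all its principal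 curvatures are non-negative. For a local orthonormal frame $e_1,\dots,e_{n-1}$ on $\Sigma$ let $h_{ij}=\langle\bar D_{e_i}\nu,e_j\rangle$ be the second fundamental form with respect to $\nu$, let $\sigma_p$ be the $p$-th elementary symmetric polynomial in its eigenvalues (with $\sigma_0=1$), extended to all matrices by $\det(I+t\,(h_{ij}))=\sum_p t^p\sigma_p$, let $T^{(p)}_{ij}=\frac{\partial\sigma_p}{\partial h_{ij}}$, viewed as a symmetric two-tensor on $\Sigma$, and let $D$ be the Levi-Civita connection of the induced metric on $\Sigma$. Then for every integer $p$ with $1\le p\le n-1$: 1. At every point of $\Sigma$, and for every smooth local orthonormal frame $e_1,\dots,e_{n-1}$ on $\Sigma$ near that point, $$\sum_{i,j=1}^{n-1}\langle X,e_i\rangle\,(D_{e_j}T^{(p)})(e_i,e_j)\ \ge\ 0 .$$ 2. With respect to the Riemannian measure of the induced metric on $\Sigma$, $$p\int_\Sigma\langle X,\nu\rangle\,\sigma_p\ \ge\ (n-p)\int_\Sigma f\,\sigma_{p-1}.$$ -/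

import Mathlib

open Set MeasureTheory Polynomial
open scoped Manifold ContDiff

noncomputable section

namespace WarpedProduct

/-! ### The warped product manifold -/

/-- The interval `[0, rbar)`; the right end point `rbar` may be `+∞`. -/
def radialInterval (rbar : EReal) : Set ℝ := {r | 0 ≤ r ∧ (r : EReal) < rbar}

/-- The derivative `h'` on `[0, rbar)` (one-sided at `0`). -/
def warpD (rbar : EReal) (h : ℝ → ℝ) (r : ℝ) : ℝ := derivWithin h (radialInterval rbar) r

/-- The second derivative `h''` on `[0, rbar)` (one-sided at `0`). -/
def warpDD (rbar : EReal) (h : ℝ → ℝ) (r : ℝ) : ℝ :=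
  derivWithin (warpD rbar h) (radialInterval rbar) r

/-- The assumptions on the warping function `h : [0, rbar) → ℝ`: it is smooth up to `r = 0` and
positive (so that `dr ⊗ dr + h(r)² g_{S^{n-1}}` is a smooth Riemannian metric on
`S^{n-1} × [0, rbar)`), and it satisfies (H1)--(H4). -/
structure IsWarpingFunction (n : ℕ) (rbar : EReal) (h : ℝ → ℝ) : Prop where
  rbar_pos : 0 < rbar
  smooth : ContDiffOn ℝ ∞ h (radialInterval rbar)
  pos : ∀ r ∈ radialInterval rbar, 0 < h r
  H1 : warpD rbar h 0 = 0 ∧ 0 < warpDD rbar h 0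
  H2 : ∀ r ∈ radialInterval rbar, 0 < r → 0 < warpD rbar h r
  H3 : MonotoneOn
    (fun r => 2 * (warpDD rbar h r / h r) - ((n : ℝ) - 2) * ((1 - warpD rbar h r ^ 2) / h r ^ 2))
    {r ∈ radialInterval rbar | 0 < r}
  H4 : ∀ r ∈ radialInterval rbar, 0 < r →
    0 < warpDD rbar h r / h r + (1 - warpD rbar h r ^ 2) / h r ^ 2

/-- Pairs `(ω, r)` with `ω ∈ ℝⁿ`, `r ∈ ℝ`. They serve as points of `S^{n-1} × [0, rbar) ⊆ ℝⁿ × ℝ`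
and, since all tangent spaces of the latter are subspaces of `ℝⁿ × ℝ`, as tangent vectors. -/
abbrev Amb (n : ℕ) : Type := EuclideanSpace ℝ (Fin n) × ℝ

/-- The manifold `M = S^{n-1} × [0, rbar)`. -/
def carrier (n : ℕ) (rbar : EReal) : Set (Amb n) :=
  {q | ‖q.1‖ = 1 ∧ q.2 ∈ radialInterval rbar}

/-- The tangent space of `M = S^{n-1} × [0, rbar)` at `q = (ω, r)`, namely `ω^⊥ × ℝ`. -/
def tangent {n : ℕ} (q : Amb n) : Set (Amb n) := {v | inner ℝ q.1 v.1 = 0}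

/-- The metric `dr ⊗ dr + h(r)² g_{S^{n-1}}` at `q`. -/
def metric {n : ℕ} (h : ℝ → ℝ) (q v w : Amb n) : ℝ :=
  v.2 * w.2 + h q.2 ^ 2 * inner ℝ v.1 w.1

/-- The radial vector field `∂/∂r`. -/
def radial (n : ℕ) : Amb n := (0, 1)

/-- The conformal vector field `X = h(r) ∂/∂r` at `q = (ω, r)`. -/
def confField {n : ℕ} (h : ℝ → ℝ) (q : Amb n) : Amb n := h q.2 • radial n

/-- The Levi-Civita connection `D̄` of `(M, dr ⊗ dr + h(r)² g_{S^{n-1}})`, for vector fields along a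
map `F : N → M`: if `W` is such a field (`W x ∈ T_{F x} M`) and `v ∈ T_x N`, this is `D̄_v W`.
With `V = dF(v)` and the product decomposition `V = (V₁, V₂) ∈ ω^⊥ × ℝ` it is
`D̄_v W = (∇_v W₁ + (h'/h) (V₂ W₁ + W₂ V₁), v(W₂) - h h' ⟨V₁, W₁⟩)`,
where `∇_v W₁` (the component of the derivative of `W₁` perpendicular to `ω`) is the Levi-Civita
derivative of the round sphere. -/
def covDeriv {n : ℕ} {E H N : Type*} [NormedAddCommGroup E] [NormedSpace ℝ E] [TopologicalSpace H]
    (I : ModelWithCorners ℝ E H) [TopologicalSpace N] [ChartedSpace H N]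
    (rbar : EReal) (h : ℝ → ℝ) (F W : N → Amb n) (x : N) (v : TangentSpace I x) : Amb n :=
  let V : Amb n := mvfderiv I F x v
  let dW : Amb n := mvfderiv I W x v
  (dW.1 - (inner ℝ (F x).1 dW.1 : ℝ) • (F x).1
      + (warpD rbar h (F x).2 / h (F x).2) • (V.2 • (W x).1 + (W x).2 • V.1),
    dW.2 - h (F x).2 * warpD rbar h (F x).2 * inner ℝ V.1 (W x).1)

/-! The two facts below single out `covDeriv` as the Levi-Civita connection. -/

/-- `D̄` is torsion-free: `D̄_u dF(w) = D̄_w dF(u)` for every `C²` map `F` on a vector space and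
constant vector fields `u`, `w`. -/
theorem covDeriv_symm {n : ℕ} {V : Type*} [NormedAddCommGroup V] [NormedSpace ℝ V]
    (rbar : EReal) (h : ℝ → ℝ) (F : V → Amb n) (hF : ContDiff ℝ 2 F) (x u w : V) :
    covDeriv 𝓘(ℝ, V) rbar h F (fun y => fderiv ℝ F y w) x u
      = covDeriv 𝓘(ℝ, V) rbar h F (fun y => fderiv ℝ F y u) x w := by
  have hd : DifferentiableAt ℝ (fderiv ℝ F) x :=
    ((hF.fderiv_right (m := 1) (by norm_num)).differentiable (by norm_num)) x
  have e1 : ∀ a b : V, fderiv ℝ (fun y => fderiv ℝ F y a) x b = fderiv ℝ (fderiv ℝ F) x b a := by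
    intro a b
    rw [fderiv_clm_apply hd (differentiableAt_const a)]
    simp
  have hs : fderiv ℝ (fderiv ℝ F) x u w = fderiv ℝ (fderiv ℝ F) x w u :=
    (hF.contDiffAt.isSymmSndFDerivAt (by simp)) u w
  have key : ∀ (G : V → Amb n) (a : V), mvfderiv 𝓘(ℝ, V) G x a = fderiv ℝ G x a := by
    intro G a
    simp [mvfderiv, mfderiv_eq_fderiv]
    rfl
  unfold covDeriv
  simp only [key, e1, hs]
  rw [real_inner_comm (fderiv ℝ F x u).1 (fderiv ℝ F x w).1,
    add_comm ((fderiv ℝ F x u).2 • (fderiv ℝ F x w).1)]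

/-- `D̄` is compatible with the metric. -/
theorem covDeriv_metric {n : ℕ} {V : Type*} [NormedAddCommGroup V] [NormedSpace ℝ V]
    (rbar : EReal) (h : ℝ → ℝ) (hh : ContDiffOn ℝ ∞ h (radialInterval rbar))
    (hpos : ∀ r ∈ radialInterval rbar, 0 < h r)
    (F W Z : V → Amb n) (hF : Differentiable ℝ F) (hW : Differentiable ℝ W)
    (hZ : Differentiable ℝ Z) (hFM : ∀ y, F y ∈ carrier n rbar)
    (hWT : ∀ y, W y ∈ tangent (F y)) (hZT : ∀ y, Z y ∈ tangent (F y)) (x v : V) :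
    fderiv ℝ (fun y => metric h (F y) (W y) (Z y)) x v
      = metric h (F x) (covDeriv 𝓘(ℝ, V) rbar h F W x v) (Z x)
        + metric h (F x) (W x) (covDeriv 𝓘(ℝ, V) rbar h F Z x v) := by
  have key : ∀ (G : V → Amb n) (a : V), mvfderiv 𝓘(ℝ, V) G x a = fderiv ℝ G x a := by
    intro G a
    simp [mvfderiv, mfderiv_eq_fderiv]
    rfl
  have hx := hFM x
  have h0 : h (F x).2 ≠ 0 := (hpos _ hx.2).ne'
  have hF2 := ((hF x).hasFDerivAt).snd
  have hh1 : HasDerivWithinAt h (warpD rbar h (F x).2) (radialInterval rbar) (F x).2 :=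
    ((hh.differentiableOn (by simp)) _ hx.2).hasDerivWithinAt
  have hcomp : HasFDerivAt (fun y => h (F y).2)
      (warpD rbar h (F x).2 • (ContinuousLinearMap.snd ℝ (EuclideanSpace ℝ (Fin n)) ℝ).comp
        (fderiv ℝ F x)) x := by
    rw [← hasFDerivWithinAt_univ]
    exact hh1.comp_hasFDerivWithinAt x hF2.hasFDerivWithinAt (fun y _ => (hFM y).2)
  have hW1 := ((hW x).hasFDerivAt).fst
  have hW2 := ((hW x).hasFDerivAt).snd
  have hZ1 := ((hZ x).hasFDerivAt).fst
  have hZ2 := ((hZ x).hasFDerivAt).snd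
  have htot := (hW2.mul hZ2).add ((hcomp.pow 2).mul (hW1.inner ℝ hZ1))
  have hfd : fderiv ℝ (fun y => metric h (F y) (W y) (Z y)) x = _ := htot.fderiv
  rw [hfd]
  have t1 : inner ℝ (F x).1 (W x).1 = (0 : ℝ) := hWT x
  have t2 : inner ℝ (F x).1 (Z x).1 = (0 : ℝ) := hZT x
  have t1' : inner ℝ (W x).1 (F x).1 = (0 : ℝ) := by rw [real_inner_comm]; exact t1
  simp only [metric, covDeriv, key]
  simp [inner_add_left, inner_add_right, inner_sub_left, inner_sub_right, inner_smul_left,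
    inner_smul_right, t1', t2]
  rw [real_inner_comm (fderiv ℝ F x v).1 (W x).1]
  field_simp
  ring

/-! ### Elementary symmetric functions -/

/-- `σ_p(A)`, defined by `det (I + t A) = ∑_p t^p σ_p(A)`. -/
def sigma {m : ℕ} (p : ℕ) (A : Matrix (Fin m) (Fin m) ℝ) : ℝ :=
  (Matrix.det (1 + (X : ℝ[X]) • A.map C)).coeff p

/-- `σ_p(A)` is the `p`-th elementary symmetric polynomial in the eigenvalues of `A`. -/
theorem sigma_eq_esymm {m : ℕ} (p : ℕ) (hp : p ≤ m) (A : Matrix (Fin m) (Fin m) ℝ)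
    (hA : A.charpoly.Splits) : sigma p A = A.charpoly.roots.esymm p := by
  have hm : A.charpoly.natDegree = m := by simp [Matrix.charpoly_natDegree_eq_dim]
  have h1 := Matrix.charpoly_coeff_eq_sum_minors A p (by simpa using hp)
  rw [← Matrix.coeff_det_one_add_X_smul_eq_sum_minors, Fintype.card_fin] at h1
  have h2 := Polynomial.coeff_eq_esymm_roots_of_splits hA (k := m - p) (by omega)
  rw [hm, A.charpoly_monic.leadingCoeff, one_mul, Nat.sub_sub_self hp, h1] at h2
  exact mul_left_cancel₀ (pow_ne_zero p (by norm_num)) h2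

/-! ### Hypersurfaces -/

section Hypersurface

variable {n : ℕ} {S : Type*} [TopologicalSpace S] [ChartedSpace (EuclideanSpace ℝ (Fin (n - 1))) S]

/-- `F : S → M = S^{n-1} × [0, rbar)` is a smooth injective immersion of the `(n-1)`-dimensional
manifold `S`; if `S` is compact, `F` is a smooth embedding and `F(S)` is a closed embedded
hypersurface. -/
structure IsHypersurface (rbar : EReal) (F : S → Amb n) : Prop where
  smooth : ContMDiff (𝓡 (n - 1)) 𝓘(ℝ, Amb n) ∞ F
  mem : ∀ x, F x ∈ carrier n rbar
  injective : Function.Injective F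
  immersion : ∀ x, Function.Injective (mvfderiv (𝓡 (n - 1)) F x)

/-- `ν` is a smooth unit normal vector field along `F`. -/
structure IsUnitNormal (h : ℝ → ℝ) (F ν : S → Amb n) : Prop where
  smooth : ContMDiff (𝓡 (n - 1)) 𝓘(ℝ, Amb n) ∞ ν
  tangent : ∀ x, ν x ∈ tangent (F x)
  unit : ∀ x, metric h (F x) (ν x) (ν x) = 1
  normal : ∀ x (v : TangentSpace (𝓡 (n - 1)) x),
    metric h (F x) (ν x) (mvfderiv (𝓡 (n - 1)) F x v) = 0

/-- The induced metric (first fundamental form). -/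
def firstForm (h : ℝ → ℝ) (F : S → Amb n) (x : S) (v w : TangentSpace (𝓡 (n - 1)) x) : ℝ :=
  metric h (F x) (mvfderiv (𝓡 (n - 1)) F x v) (mvfderiv (𝓡 (n - 1)) F x w)

/-- The second fundamental form `⟨D̄_v ν, w⟩`. -/
def secondForm (rbar : EReal) (h : ℝ → ℝ) (F ν : S → Amb n) (x : S)
    (v w : TangentSpace (𝓡 (n - 1)) x) : ℝ :=
  metric h (F x) (covDeriv (𝓡 (n - 1)) rbar h F ν x v) (mvfderiv (𝓡 (n - 1)) F x w)

/-- `k` is a principal curvature at `x`, that is, an eigenvalue of the second fundamental form with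
respect to the induced metric. -/
def IsPrincipalCurvature (rbar : EReal) (h : ℝ → ℝ) (F ν : S → Amb n) (x : S) (k : ℝ) : Prop :=
  ∃ v : TangentSpace (𝓡 (n - 1)) x, v ≠ 0 ∧
    ∀ w : TangentSpace (𝓡 (n - 1)) x, secondForm rbar h F ν x v w = k * firstForm h F x v w

/-- `⟨∂/∂r, ν⟩ ≥ 0`: the hypersurface is star-shaped, as witnessed by the unit normal `ν`. -/
def IsStarShapedWith (h : ℝ → ℝ) (F ν : S → Amb n) : Prop :=
  ∀ x, 0 ≤ metric h (F x) (radial n) (ν x)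

/-- The hypersurface is convex: for some choice of unit normal all principal curvatures are
non-negative. -/
def IsConvexHypersurface (rbar : EReal) (h : ℝ → ℝ) (F : S → Amb n) : Prop :=
  ∃ ν : S → Amb n, IsUnitNormal h F ν ∧
    ∀ x k, IsPrincipalCurvature rbar h F ν x k → 0 ≤ k

/-- The standard basis of `T_x S` (the coordinate basis of the preferred chart at `x`). -/
def stdVec (x : S) (a : Fin (n - 1)) : TangentSpace (𝓡 (n - 1)) x :=
  (EuclideanSpace.single a (1 : ℝ) : EuclideanSpace ℝ (Fin (n - 1)))

/-- The matrix of the Weingarten map (shape operator) at `x`: the product of the inverse Gram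
matrix with the matrix of the second fundamental form. Its eigenvalues are the principal
curvatures. -/
def weingarten (rbar : EReal) (h : ℝ → ℝ) (F ν : S → Amb n) (x : S) :
    Matrix (Fin (n - 1)) (Fin (n - 1)) ℝ :=
  (Matrix.of fun a b => firstForm h F x (stdVec x a) (stdVec x b))⁻¹ *
    Matrix.of fun a b => secondForm rbar h F ν x (stdVec x a) (stdVec x b)

/-- `σ_p` of the principal curvatures at `x`. -/
def sigmaCurv (rbar : EReal) (h : ℝ → ℝ) (F ν : S → Amb n) (p : ℕ) (x : S) : ℝ :=
  sigma p (weingarten rbar h F ν x)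

/-- The Gram matrix of the induced metric in the chart at `x₀`, at the coordinate point `z`. -/
def chartGram (h : ℝ → ℝ) (F : S → Amb n) (x₀ : S) (z : EuclideanSpace ℝ (Fin (n - 1))) :
    Matrix (Fin (n - 1)) (Fin (n - 1)) ℝ :=
  let P : EuclideanSpace ℝ (Fin (n - 1)) → Amb n := F ∘ (extChartAt (𝓡 (n - 1)) x₀).symm
  Matrix.of fun a b => metric h (P z) (fderiv ℝ P z (EuclideanSpace.single a 1))
    (fderiv ℝ P z (EuclideanSpace.single b 1))

/-- The Riemannian measure of the induced metric on the domain of the chart at `x₀`: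
`√(det g) dz` in coordinates. -/
def chartMeasure [MeasurableSpace S] (h : ℝ → ℝ) (F : S → Amb n) (x₀ : S) : Measure S :=
  ((volume.restrict (extChartAt (𝓡 (n - 1)) x₀).target).withDensity
    fun z => ENNReal.ofReal (Real.sqrt (chartGram h F x₀ z).det)).map
      (extChartAt (𝓡 (n - 1)) x₀).symm

/-- The Riemannian measure of the induced metric: the smallest measure that dominates
`√(det g) dz` on each chart domain. Because these measures agree on overlaps, its restriction to
each chart domain is `√(det g) dz` when `S` is a compact manifold. -/
def surfaceMeasure [MeasurableSpace S] (h : ℝ → ℝ) (F : S → Amb n) : Measure S :=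
  ⨆ x₀ : S, chartMeasure h F x₀

/-- `e_1, …, e_{n-1}` is a smooth local orthonormal frame on the open set `U ⊆ S`. -/
structure IsOrthonormalFrame (h : ℝ → ℝ) (F : S → Amb n) (U : Set S)
    (e : Fin (n - 1) → ∀ x : S, TangentSpace (𝓡 (n - 1)) x)
    [IsManifold (𝓡 (n - 1)) ∞ S] : Prop where
  isOpen : IsOpen U
  smooth : ∀ i, ContMDiffOn (𝓡 (n - 1)) (𝓡 (n - 1)).tangent ∞
    (fun x => (⟨x, e i x⟩ : TangentBundle (𝓡 (n - 1)) S)) U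
  orthonormal : ∀ x ∈ U, ∀ i j, firstForm h F x (e i x) (e j x) = if i = j then 1 else 0

/-- The components `T^{(p)}_{ij} = ∂σ_p / ∂h_{ij}` at `x` in the orthonormal frame `e`, where
`h_{ij}` are the components of the second fundamental form. -/
def newtonTensor (rbar : EReal) (h : ℝ → ℝ) (F ν : S → Amb n)
    (e : Fin (n - 1) → ∀ x : S, TangentSpace (𝓡 (n - 1)) x) (p : ℕ) (i j : Fin (n - 1)) (x : S) :
    ℝ :=
  deriv (fun s : ℝ => sigma p
    ((Matrix.of fun a b => secondForm rbar h F ν x (e a x) (e b x))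
      + s • Matrix.single i j (1 : ℝ))) 0

/-- The connection coefficient `⟨D_{e_j} e_i, e_k⟩` of the Levi-Civita connection `D` of the induced
metric; `D_{e_j} e_i` is the tangential part of `D̄_{e_j} e_i`. -/
def connCoeff (rbar : EReal) (h : ℝ → ℝ) (F : S → Amb n)
    (e : Fin (n - 1) → ∀ x : S, TangentSpace (𝓡 (n - 1)) x) (j i k : Fin (n - 1)) (x : S) : ℝ :=
  metric h (F x)
    (covDeriv (𝓡 (n - 1)) rbar h F (fun y => mvfderiv (𝓡 (n - 1)) F y (e i y)) x (e j x))
    (mvfderiv (𝓡 (n - 1)) F x (e k x))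

/-- `(D_{e_l} T^{(p)})(e_i, e_j)
  = e_l(T^{(p)}(e_i, e_j)) - T^{(p)}(D_{e_l} e_i, e_j) - T^{(p)}(e_i, D_{e_l} e_j)`
in the orthonormal frame `e`. -/
def covDerivNewton (rbar : EReal) (h : ℝ → ℝ) (F ν : S → Amb n)
    (e : Fin (n - 1) → ∀ x : S, TangentSpace (𝓡 (n - 1)) x) (p : ℕ) (l i j : Fin (n - 1)) (x : S) :
    ℝ :=
  mvfderiv (𝓡 (n - 1)) (newtonTensor rbar h F ν e p i j) x (e l x)
    - ∑ k, connCoeff rbar h F e l i k x * newtonTensor rbar h F ν e p k j x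
    - ∑ k, connCoeff rbar h F e l j k x * newtonTensor rbar h F ν e p i k x

end Hypersurface

end WarpedProduct

end

noncomputable section

namespace WarpedProduct

/-! ### Elementary symmetric functions and Newton transformations of matrices -/

section Algebra

open scoped Matrix

variable {m : ℕ}

/-! Put `m = n - 1`, let `W` be the Weingarten map, and let `T_q` be the Newton transformation given
by `T_0 = 1`, `T_{q+1} = σ_{q+1} - T_q W`. Jacobi's formula identifies `∂σ_{q+1}/∂h_{ij}` with the
entry `(j, i)` of `T_q`, so both claims concern the field `T_q Xᵀ` with `q = p - 1`, where `Xᵀ = h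
∇r` is the tangential part of `X`.

Two facts of ambient geometry enter. First, `X` is closed conformal, `D̄_v X = h' v`, so on the
hypersurface `D Xᵀ = f · 1 - ⟨X, ν⟩ W`. With `tr T_q = (m - q) σ_q` and `tr (T_q W) = (q + 1)
σ_{q+1}` this gives div (T_q Xᵀ) = ⟨div T_q, Xᵀ⟩ + (m - q) f σ_q - (q + 1) ⟨X, ν⟩ σ_{q+1}. Second,
the curvature tensor of a warped product makes the Codazzi defect of `W` equal to `-K ⟨∂_r, ν⟩ (r_a
δ^d_c - r_c δ^d_a)`. Here `K = h''/h + (1 - h'²)/h²` is the sectional curvature of planes tangent to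
the spheres minus that of planes containing `∂_r`. The recursion for `T_q` then yields, for `q ≥ 1`,
⟨div T_q, Xᵀ⟩ = K ⟨∂_r, ν⟩ (m - q) h ⟨T_{q-1} ∇r, ∇r⟩. Each factor is non-negative: `K` by (H4), and
by (H1) at `r = 0`; `⟨∂_r, ν⟩` by star-shapedness; the last one because `T_{q-1}` of a positive
semidefinite form is positive semidefinite. This is the first claim. Integrating the divergence
identity over the closed hypersurface gives the second.

Convexity is assumed for some unit normal `ν'`, which may differ from the star-shaped `ν`. The two
agree up to a locally constant sign. Where the sign is negative, look at a point of that set with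
maximal `r`: if `r > 0` there, comparison with a slice makes the second fundamental form for `ν`
positive, contradicting convexity for `ν' = -ν`; if `r = 0` there, that whole set lies in the
totally geodesic slice `r = 0`.

The calculus is done in charts. The key results are `sum_dNewton_of_codazzi`,
`newton_inv_mul_nonneg`, `codazzi`, `divergence_newton_confTan`, `newtonDiv_nonneg` and
`sff_posSemidef`. A partition of unity globalises the integral, and `covDerivNewton_eq` rewrites the
frame expression of the first claim in coordinates. -/

theorem sigma_zero (A : Matrix (Fin m) (Fin m) ℝ) : sigma 0 A = 1 := by
  unfold sigma
  rw [Matrix.coeff_det_one_add_X_smul_eq_sum_minors]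
  simp

theorem sigma_eq_sum_minors (p : ℕ) (A : Matrix (Fin m) (Fin m) ℝ) :
    sigma p A = ∑ s ∈ (Finset.univ : Finset (Fin m)).powersetCard p,
      (A.submatrix (fun i : s => i.1) (fun i : s => i.1)).det :=
  Matrix.coeff_det_one_add_X_smul_eq_sum_minors A p

/-- Sylvester's identity `det (1 + UV) = det (1 + VU)`. It makes `σ_p` invariant under conjugation,
so `σ_p` of a Weingarten matrix does not depend on the basis. -/
theorem sigma_mul_comm (p : ℕ) (A B : Matrix (Fin m) (Fin m) ℝ) :
    sigma p (A * B) = sigma p (B * A) := by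
  unfold sigma
  have h1 : (X : ℝ[X]) • (A * B).map C = (A.map C) * ((X : ℝ[X]) • B.map C) := by
    rw [Matrix.map_mul, Matrix.mul_smul]
  have h2 : (X : ℝ[X]) • (B * A).map C = ((X : ℝ[X]) • B.map C) * (A.map C) := by
    rw [Matrix.map_mul, Matrix.smul_mul]
  rw [h1, h2, Matrix.det_one_add_mul_comm]

/-- The Newton transformations of `A`. -/
def newton (A : Matrix (Fin m) (Fin m) ℝ) : ℕ → Matrix (Fin m) (Fin m) ℝ
  | 0 => 1
  | q + 1 => sigma (q + 1) A • (1 : Matrix (Fin m) (Fin m) ℝ) - newton A q * A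

/-- The derivative of the Newton transformation at `A` in the direction `K`. -/
def dNewton (A K : Matrix (Fin m) (Fin m) ℝ) : ℕ → Matrix (Fin m) (Fin m) ℝ
  | 0 => 0
  | q + 1 => (newton A q * K).trace • (1 : Matrix (Fin m) (Fin m) ℝ) - dNewton A K q * A
      - newton A q * K

/-- The identity `adj(1 + tA) (1 + tA) = det(1 + tA)` rearranges to `adj = det · 1 - t adj · A`.
Comparing coefficients of `t` gives exactly the recursion defining `newton`. -/
theorem newton_apply_eq_coeff (A : Matrix (Fin m) (Fin m) ℝ) (q : ℕ) (i j : Fin m) :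
    newton A q i j = ((1 + (X : ℝ[X]) • A.map C).adjugate i j).coeff q := by
  have key : (1 + (X : ℝ[X]) • A.map C).adjugate
      = (1 + (X : ℝ[X]) • A.map C).det • (1 : Matrix (Fin m) (Fin m) ℝ[X])
        - (X : ℝ[X]) • ((1 + (X : ℝ[X]) • A.map C).adjugate * A.map C) := by
    have := Matrix.adjugate_mul (1 + (X : ℝ[X]) • A.map C)
    rw [mul_add, mul_one, Matrix.mul_smul] at this
    exact eq_sub_of_add_eq this
  induction q generalizing i j with
  | zero =>
    rw [key]
    simp only [newton, Matrix.sub_apply, Matrix.smul_apply, smul_eq_mul, coeff_sub]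
    have := sigma_zero A
    unfold sigma at this
    rw [mul_coeff_zero, this]
    simp [Matrix.one_apply]
    split_ifs <;> simp
  | succ q ih =>
    rw [key]
    simp only [newton, Matrix.sub_apply, Matrix.smul_apply, smul_eq_mul, coeff_sub, coeff_X_mul,
      Matrix.mul_apply,
      Polynomial.finsetSum_coeff, Matrix.map_apply, coeff_mul_C, ih]
    congr 1
    rw [Matrix.one_apply, Matrix.one_apply]
    split_ifs <;> simp [sigma]

theorem newton_mul_comm (A : Matrix (Fin m) (Fin m) ℝ) (q : ℕ) :
    newton A q * A = A * newton A q := by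
  induction q with
  | zero => simp [newton]
  | succ q ih =>
    simp only [newton, sub_mul, mul_sub, Matrix.smul_mul, Matrix.mul_smul, one_mul, mul_one]
    rw [← mul_assoc, ← ih]

/-- The determinant is linear in row `i`, and the perturbation adds `t s` to one entry of that row;
the coefficient of `s` is a cofactor of `1 + tA`. Hence `σ_{q+1}` is exactly affine in each entry,
with slope the transposed entry of `newton`. -/
theorem sigma_add_smul_single (A : Matrix (Fin m) (Fin m) ℝ) (q : ℕ) (i j : Fin m) (s : ℝ) :
    sigma (q + 1) (A + s • Matrix.single i j (1 : ℝ)) = sigma (q + 1) A + s * newton A q j i := by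
  have h1 : (1 + (X : ℝ[X]) • (A + s • Matrix.single i j (1 : ℝ)).map C)
      = (1 + (X : ℝ[X]) • A.map C).updateRow i
        ((1 + (X : ℝ[X]) • A.map C) i + (X * C s : ℝ[X]) • Pi.single j (1 : ℝ[X])) := by
    ext1 a b
    by_cases ha : a = i
    · subst ha
      by_cases hb : b = j
      · subst hb
        simp [Matrix.single, mul_add, add_assoc]
      · have hb' : j ≠ b := fun h => hb h.symm
        simp [Matrix.single, hb, hb']
    · have ha' : i ≠ a := fun h => ha h.symm
      simp [Matrix.single, ha, ha']
  unfold sigma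
  rw [h1, Matrix.det_updateRow_add, Matrix.updateRow_eq_self, Matrix.det_updateRow_smul,
    ← Matrix.adjugate_apply, coeff_add, mul_assoc, coeff_X_mul, coeff_C_mul,
    newton_apply_eq_coeff]

theorem contDiff_sigma (p : ℕ) :
    ContDiff ℝ ∞ (fun A : Fin m → Fin m → ℝ => sigma p (Matrix.of A)) := by
  simp only [sigma_eq_sum_minors, Matrix.det_apply]
  refine ContDiff.sum fun s _ => ContDiff.sum fun e _ => ContDiff.const_smul _ ?_
  refine contDiff_prod fun i _ => ?_
  simp only [Matrix.submatrix_apply, Matrix.of_apply]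
  fun_prop

variable {E : Type*} [NormedAddCommGroup E] [NormedSpace ℝ E]

theorem differentiableAt_matrix {M : E → Matrix (Fin m) (Fin m) ℝ} {z : E}
    (hM : ∀ i j, DifferentiableAt ℝ (fun y => M y i j) z) :
    DifferentiableAt ℝ (fun y => (fun i j => M y i j : Fin m → Fin m → ℝ)) z :=
  differentiableAt_pi.2 fun i => differentiableAt_pi.2 fun j => hM i j

/-- The derivative of a function of matrices that is affine in each entry. -/
theorem fderiv_comp_matrix {Φ : Matrix (Fin m) (Fin m) ℝ → ℝ}
    {M : E → Matrix (Fin m) (Fin m) ℝ} {z : E} {G : Matrix (Fin m) (Fin m) ℝ}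
    (hΦ : DifferentiableAt ℝ (fun B : Fin m → Fin m → ℝ => Φ (Matrix.of B)) (M z))
    (hG : ∀ i j (t : ℝ), Φ (M z + t • Matrix.single i j (1 : ℝ)) = Φ (M z) + t * G j i)
    (hM : ∀ i j, DifferentiableAt ℝ (fun y => M y i j) z) (v : E) :
    fderiv ℝ (fun y => Φ (M y)) z v
      = (G * Matrix.of fun i j => fderiv ℝ (fun y => M y i j) z v).trace := by
  -- Along each coordinate line `Φ` is affine by `hG`, so its partial derivatives are read off
  -- without a limit.
  have hs : ∀ i j, fderiv ℝ (fun B : Fin m → Fin m → ℝ => Φ (Matrix.of B)) (M z)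
      (Pi.single i (Pi.single j 1)) = G j i := by
    intro i j
    rw [← hΦ.lineDeriv_eq_fderiv]
    unfold lineDeriv
    have : (fun t : ℝ => Φ
        (Matrix.of ((fun a b => M z a b) + t • (Pi.single i (Pi.single j 1) : Fin m → Fin m → ℝ))))
        = fun t : ℝ => Φ (M z) + t * G j i := by
      funext t
      rw [← hG]
      congr 1
      ext a b
      simp only [Matrix.of_apply, Pi.add_apply, Pi.smul_apply, Matrix.add_apply, Matrix.smul_apply,
        Matrix.single]
      by_cases ha : a = i
      · subst ha
        by_cases hb : b = j
        · subst hb; simp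
        · simp [hb, Ne.symm hb]
      · simp [ha, Ne.symm ha]
    refine (congrArg (fun f => deriv f 0) this).trans ?_
    simp
  have hd := differentiableAt_matrix hM
  have h2 := fderiv_comp z (g := fun B : Fin m → Fin m → ℝ => Φ (Matrix.of B)) hΦ hd
  have h3 : (fun B : Fin m → Fin m → ℝ => Φ (Matrix.of B)) ∘
      (fun y => (fun i j => M y i j : Fin m → Fin m → ℝ)) = fun y => Φ (M y) := rfl
  rw [h3] at h2
  rw [h2, ContinuousLinearMap.comp_apply]
  have h4 : ∀ i j, fderiv ℝ (fun y => (fun i j => M y i j : Fin m → Fin m → ℝ)) z v i j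
      = fderiv ℝ (fun y => M y i j) z v := by
    intro i j
    rw [fderiv_pi (fun i => differentiableAt_pi.2 fun j => hM i j), ContinuousLinearMap.pi_apply,
      fderiv_pi (fun j => hM i j), ContinuousLinearMap.pi_apply]
  set K : Fin m → Fin m → ℝ := fderiv ℝ (fun y => (fun i j => M y i j : Fin m → Fin m → ℝ)) z v
  have hK : K = ∑ i, ∑ j, K i j • (Pi.single i (Pi.single j 1) : Fin m → Fin m → ℝ) := by
    ext a b
    simp [Finset.sum_apply, Pi.single_apply, apply_ite, ite_apply]
  rw [hK]
  simp only [map_sum, map_smul, smul_eq_mul]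
  simp only [Matrix.trace, Matrix.diag, Matrix.mul_apply, Matrix.of_apply, ← h4]
  rw [Finset.sum_comm]
  refine Finset.sum_congr rfl fun i _ => Finset.sum_congr rfl fun j _ => ?_
  rw [mul_comm]
  congr 1
  exact hs j i

theorem differentiableAt_sigma {M : E → Matrix (Fin m) (Fin m) ℝ} {z : E} (p : ℕ)
    (hM : ∀ i j, DifferentiableAt ℝ (fun y => M y i j) z) :
    DifferentiableAt ℝ (fun y => sigma p (M y)) z :=
  DifferentiableAt.comp z (g := fun B : Fin m → Fin m → ℝ => sigma p (Matrix.of B))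
    ((contDiff_sigma p).contDiffAt.differentiableAt (by simp)) (differentiableAt_matrix hM)

/-- Jacobi's formula for `σ_{q+1}`. -/
theorem fderiv_sigma {M : E → Matrix (Fin m) (Fin m) ℝ} {z : E} (q : ℕ)
    (hM : ∀ i j, DifferentiableAt ℝ (fun y => M y i j) z) (v : E) :
    fderiv ℝ (fun y => sigma (q + 1) (M y)) z v
      = (newton (M z) q * Matrix.of fun i j => fderiv ℝ (fun y => M y i j) z v).trace :=
  fderiv_comp_matrix ((contDiff_sigma (q + 1)).contDiffAt.differentiableAt (by simp))
    (sigma_add_smul_single (M z) q) hM v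

theorem contDiffAt_det {M : E → Matrix (Fin m) (Fin m) ℝ} {z : E}
    (hM : ∀ i j, ContDiffAt ℝ ∞ (fun y => M y i j) z) :
    ContDiffAt ℝ ∞ (fun y => (M y).det) z := by
  simp only [Matrix.det_apply]
  exact ContDiffAt.sum fun e _ => ContDiffAt.const_smul _ (contDiffAt_prod fun i _ => hM _ _)

theorem contDiffAt_inv {M : E → Matrix (Fin m) (Fin m) ℝ} {z : E}
    (hM : ∀ i j, ContDiffAt ℝ ∞ (fun y => M y i j) z) (hz : (M z).det ≠ 0) (i j : Fin m) :
    ContDiffAt ℝ ∞ (fun y => (M y)⁻¹ i j) z := by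
  simp only [Matrix.inv_def, Matrix.smul_apply, Ring.inverse_eq_inv', smul_eq_mul,
    Matrix.adjugate_apply]
  refine ((contDiffAt_det hM).inv hz).mul (contDiffAt_det fun a b => ?_)
  simp only [Matrix.updateRow_apply]
  split_ifs
  · exact contDiffAt_const
  · exact hM a b

/-- Jacobi's formula for the determinant. -/
theorem fderiv_det {M : E → Matrix (Fin m) (Fin m) ℝ} {z : E}
    (hM : ∀ i j, DifferentiableAt ℝ (fun y => M y i j) z) (v : E) :
    fderiv ℝ (fun y => (M y).det) z v
      = ((M z).adjugate * Matrix.of fun i j => fderiv ℝ (fun y => M y i j) z v).trace := by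
  refine fderiv_comp_matrix (Φ := Matrix.det) ?_ (fun i j t => ?_) hM v
  · refine (contDiffAt_det fun i j => ?_).differentiableAt (by simp : (∞ : WithTop ℕ∞) ≠ 0)
    simp only [Matrix.of_apply]
    fun_prop
  · have : M z + t • Matrix.single i j (1 : ℝ)
        = (M z).updateRow i (M z i + t • Pi.single j (1 : ℝ)) := by
      ext1 a b
      by_cases ha : a = i
      · subst ha
        by_cases hb : b = j
        · subst hb; simp [Matrix.single]
        · simp [Matrix.single, hb, Ne.symm hb]
      · simp [Matrix.single, ha, Ne.symm ha]
    rw [this, Matrix.det_updateRow_add, Matrix.updateRow_eq_self, Matrix.det_updateRow_smul,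
      ← Matrix.adjugate_apply]

theorem contDiffAt_sigma {M : E → Matrix (Fin m) (Fin m) ℝ} {z : E} (p : ℕ)
    (hM : ∀ i j, ContDiffAt ℝ ∞ (fun y => M y i j) z) :
    ContDiffAt ℝ ∞ (fun y => sigma p (M y)) z := by
  have h1 : ContDiffAt ℝ ∞ (fun y => (fun i j => M y i j : Fin m → Fin m → ℝ)) z :=
    contDiffAt_pi.2 fun i => contDiffAt_pi.2 fun j => hM i j
  exact ContDiffAt.comp z (g := fun B : Fin m → Fin m → ℝ => sigma p (Matrix.of B))
    (contDiff_sigma p).contDiffAt h1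

theorem contDiffAt_newton {M : E → Matrix (Fin m) (Fin m) ℝ} {z : E} (q : ℕ)
    (hM : ∀ i j, ContDiffAt ℝ ∞ (fun y => M y i j) z) (i j : Fin m) :
    ContDiffAt ℝ ∞ (fun y => newton (M y) q i j) z := by
  induction q generalizing i j with
  | zero => exact contDiffAt_const
  | succ q ih =>
    simp only [newton, Matrix.sub_apply, Matrix.smul_apply, Matrix.mul_apply, smul_eq_mul]
    exact ((contDiffAt_sigma _ hM).mul contDiffAt_const).sub
      (ContDiffAt.sum fun k _ => (ih i k).mul (hM k j))

/-- `dNewton` is the recursion of `newton` differentiated by the Leibniz rule. Differentiability and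
the formula are proved together because the inductive step needs both. -/
theorem hasFDerivAt_newton {M : E → Matrix (Fin m) (Fin m) ℝ} {z : E} (q : ℕ)
    (hM : ∀ i j, DifferentiableAt ℝ (fun y => M y i j) z) (i j : Fin m) :
    DifferentiableAt ℝ (fun y => newton (M y) q i j) z ∧
    ∀ v, fderiv ℝ (fun y => newton (M y) q i j) z v
      = dNewton (M z) (Matrix.of fun i j => fderiv ℝ (fun y => M y i j) z v) q i j := by
  induction q generalizing i j with
  | zero => exact ⟨differentiableAt_const _, fun v => by simp [newton, dNewton]⟩
  | succ q ih =>
    have hs := differentiableAt_sigma (q + 1) hM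
    have hsum : DifferentiableAt ℝ (fun y => ∑ k, newton (M y) q i k * M y k j) z :=
      DifferentiableAt.fun_sum fun k _ => (ih i k).1.mul (hM k j)
    have hs1 : DifferentiableAt ℝ
      (fun y => sigma (q + 1) (M y) * (1 : Matrix (Fin m) (Fin m) ℝ) i j) z := hs.mul_const _
    simp only [newton, dNewton, Matrix.sub_apply, Matrix.smul_apply, Matrix.mul_apply, smul_eq_mul]
    refine ⟨hs1.sub hsum, fun v => ?_⟩
    rw [fderiv_fun_sub hs1 hsum, _root_.sub_apply,
      fderiv_fun_sum (fun k _ => (ih i k).1.fun_mul (hM k j)), fderiv_mul_const hs,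
      _root_.smul_apply, fderiv_sigma q hM, smul_eq_mul, _root_.sum_apply,
      mul_comm, sub_sub, ← Finset.sum_add_distrib]
    congr 1
    refine Finset.sum_congr rfl fun k _ => ?_
    rw [fderiv_fun_mul (ih i k).1 (hM k j)]
    simp only [_root_.add_apply, _root_.smul_apply, smul_eq_mul,
      (ih i k).2, Matrix.of_apply]
    ring

theorem sigma_smul (p : ℕ) (s : ℝ) (A : Matrix (Fin m) (Fin m) ℝ) :
    sigma p (s • A) = s ^ p * sigma p A := by
  rw [sigma_eq_sum_minors, sigma_eq_sum_minors, Finset.mul_sum]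
  refine Finset.sum_congr rfl fun t ht => ?_
  rw [Matrix.submatrix_smul, Pi.smul_apply, Pi.smul_apply, Matrix.det_smul, Fintype.card_coe,
    (Finset.mem_powersetCard.1 ht).2]

/-- Euler's identity for `σ_{q+1}`. -/
theorem trace_newton_mul_self (A : Matrix (Fin m) (Fin m) ℝ) (q : ℕ) :
    (newton A q * A).trace = (q + 1) * sigma (q + 1) A := by
  -- Euler's identity comes from differentiating the homogeneous function `s ↦ σ_{q+1}(sA) = s^{q+1}
  -- σ_{q+1}(A)` at `s = 1`.
  have h1 := fderiv_sigma (M := fun s : ℝ => s • A) (z := 1) q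
    (fun i j => by simp only [Matrix.smul_apply, smul_eq_mul]; fun_prop) 1
  simp only [Matrix.smul_apply, smul_eq_mul, one_smul, sigma_smul, fderiv_eq_smul_deriv] at h1
  simp only [one_mul, deriv_mul_const_field', deriv_id'', deriv_pow_field] at h1
  have h2 : (newton A q * A).trace = _ := h1.symm
  rw [h2]
  simp

/-- Taking the trace of the recursion and using Euler's identity leaves `m σ_{q+1} - (q + 1)
σ_{q+1}`. -/
theorem trace_newton (A : Matrix (Fin m) (Fin m) ℝ) (q : ℕ) :
    (newton A q).trace = ((m : ℝ) - q) * sigma q A := by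
  cases q with
  | zero => simp [newton, sigma_zero]
  | succ q =>
    rw [newton, Matrix.trace_sub, trace_newton_mul_self, Matrix.trace_smul, Matrix.trace_one]
    simp
    ring

theorem dNewton_add (A K L : Matrix (Fin m) (Fin m) ℝ) (q : ℕ) :
    dNewton A (K + L) q = dNewton A K q + dNewton A L q := by
  induction q with
  | zero => simp [dNewton]
  | succ q ih =>
    simp only [dNewton, ih, mul_add, Matrix.trace_add, add_smul, add_mul]
    abel

/-- The infinitesimal form of the equivariance of `newton` under conjugation. It carries the
Christoffel terms of the covariant derivative of `W` over to that of `T_q`. -/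
theorem dNewton_commutator (A G : Matrix (Fin m) (Fin m) ℝ) (q : ℕ) :
    dNewton A (G * A - A * G) q = G * newton A q - newton A q * G := by
  induction q with
  | zero => simp [dNewton, newton]
  | succ q ih =>
    have htr : (newton A q * (G * A - A * G)).trace = 0 := by
      rw [mul_sub, Matrix.trace_sub, ← mul_assoc, ← mul_assoc, newton_mul_comm,
        Matrix.trace_mul_comm (newton A q * G) A, ← mul_assoc, sub_self]
    simp only [dNewton, newton, ih, htr, zero_smul]
    simp only [sub_mul, mul_sub, Matrix.smul_mul, Matrix.mul_smul, one_mul, mul_one, mul_assoc]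
    abel

/-- Conjugation commutes with products and preserves `σ_{q+1}`, so it passes through the recursion.
This makes `T_q` a well-defined endomorphism, independent of charts and frames. -/
theorem newton_conj {A B C : Matrix (Fin m) (Fin m) ℝ} (hBC : C * B = 1) (q : ℕ) :
    newton (B * A * C) q = B * newton A q * C := by
  have hCB : B * C = 1 := mul_eq_one_comm.1 hBC
  induction q with
  | zero => simp [newton, hCB]
  | succ q ih =>
    have hs : sigma (q + 1) (B * A * C) = sigma (q + 1) A := by
      rw [sigma_mul_comm, ← mul_assoc, hBC, one_mul]
    have e : B * newton A q * C * (B * A * C) = B * (newton A q * A) * C := by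
      calc B * newton A q * C * (B * A * C) = B * newton A q * (C * B) * A * C := by
            simp only [mul_assoc]
        _ = _ := by rw [hBC]; simp only [mul_assoc, mul_one]
    simp only [newton, hs, ih, e, mul_sub, sub_mul, Matrix.mul_smul, Matrix.smul_mul, mul_one, hCB]

/-- The divergence of the Newton transformations under a Codazzi equation with defect
`κ (r_a δ^d_c - r_c δ^d_a)`. -/
theorem sum_dNewton_of_codazzi {A : Matrix (Fin m) (Fin m) ℝ}
    {K : Fin m → Matrix (Fin m) (Fin m) ℝ} {κ : ℝ} {r : Fin m → ℝ}
    (hK : ∀ c a d, K c d a = K a d c + κ * (r a * (1 : Matrix (Fin m) (Fin m) ℝ) d c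
      - r c * (1 : Matrix (Fin m) (Fin m) ℝ) d a)) (q : ℕ) (b : Fin m) :
    ∑ a, dNewton A (K a) (q + 1) a b = -κ * ((m : ℝ) - (q + 1)) * ∑ a, r a * newton A q a b := by
  -- Taking the divergence of `T_{q+1} = σ_{q+1} - T_q W`: the gradient of `σ_{q+1}` cancels the
  -- part of `T_q ∇W` that a symmetric `∇W` would give, so only the previous divergence times `W`
  -- and the Codazzi defect remain.
  have step : ∀ q b, ∑ a, dNewton A (K a) (q + 1) a b
      = - ∑ c, (∑ a, dNewton A (K a) q a c) * A c b
        - κ * (((m : ℝ) - q) * sigma q A * r b - ∑ a, r a * newton A q a b) := by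
    intro q b
    -- The Codazzi equation exchanges the differentiation index `a` with the column index `b`; the
    -- contraction then becomes `tr (T_q ∇_b W)`, the derivative of `σ_{q+1}`, plus the defect.
    have h1 : ∑ a, (newton A q * K a) a b = (newton A q * K b).trace
        + κ * (r b * (newton A q).trace - ∑ a, r a * newton A q a b) := by
      simp only [Matrix.mul_apply, Matrix.trace, Matrix.diag, hK _ b]
      simp only [mul_add, Finset.sum_add_distrib]
      congr 1
      simp only [mul_sub, Finset.sum_sub_distrib, Matrix.one_apply]
      simp only [mul_ite, mul_one, mul_zero, Finset.sum_ite_eq', Finset.mem_univ, if_true,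
        Finset.mul_sum]
      congr 1 <;> exact Finset.sum_congr rfl fun _ _ => by ring
    simp only [dNewton, Matrix.sub_apply, Finset.sum_sub_distrib]
    rw [h1, trace_newton]
    have h2 : ∑ a, ((newton A q * K a).trace • (1 : Matrix (Fin m) (Fin m) ℝ)) a b
        = (newton A q * K b).trace := by
      simp [Matrix.smul_apply, Matrix.one_apply]
    have h3 : ∑ a, (dNewton A (K a) q * A) a b = ∑ c, (∑ a, dNewton A (K a) q a c) * A c b := by
      simp only [Matrix.mul_apply, Finset.sum_mul]
      exact Finset.sum_comm
    rw [h2, h3]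
    ring
  induction q generalizing b with
  | zero =>
    rw [step]
    simp [dNewton, newton, sigma_zero, Matrix.one_apply]
    ring
  | succ q ih =>
    rw [step]
    simp only [ih]
    -- The recursion recombines `σ_{q+1} r_b` and the term with `T_q A` into the contraction of `r`
    -- with `T_{q+1}`. The `+1` from the defect lowers the factor `m - (q + 1)` to `m - (q + 2)`.
    have h4 : ∑ a, r a * newton A (q + 1) a b = sigma (q + 1) A * r b
        - ∑ c, (∑ a, r a * newton A q a c) * A c b := by
      simp only [newton, Matrix.sub_apply, mul_sub, Finset.sum_sub_distrib]
      congr 1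
      · simp [Matrix.one_apply, mul_comm]
      · simp only [Matrix.mul_apply, Finset.mul_sum, Finset.sum_mul]
        rw [Finset.sum_comm]
        exact Finset.sum_congr rfl fun _ _ => Finset.sum_congr rfl fun _ _ => by ring
    have h5 : ∑ c, (-κ * ((m : ℝ) - (q + 1)) * ∑ a, r a * newton A q a c) * A c b
        = -κ * ((m : ℝ) - (q + 1)) * ∑ c, (∑ a, r a * newton A q a c) * A c b := by
      rw [Finset.mul_sum]
      exact Finset.sum_congr rfl fun _ _ => by ring
    rw [h5, h4]
    push_cast
    ring

theorem sigma_nonneg_of_posSemidef {A : Matrix (Fin m) (Fin m) ℝ} (hA : A.PosSemidef) (p : ℕ) :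
    0 ≤ sigma p A := by
  rw [sigma_eq_sum_minors]
  exact Finset.sum_nonneg fun s _ => (hA.submatrix _).det_nonneg

theorem exists_eq_transpose_mul_self_of_posDef {g : Matrix (Fin m) (Fin m) ℝ} (hg : g.PosDef) :
    ∃ B : Matrix (Fin m) (Fin m) ℝ, IsUnit B ∧ g = Bᵀ * B := by
  open scoped MatrixOrder in
  obtain ⟨B, h⟩ := CStarAlgebra.nonneg_iff_eq_star_mul_self.1 hg.posSemidef.nonneg
  have h' : g = Bᵀ * B := by simpa [Matrix.star_eq_conjTranspose] using h
  refine ⟨B, ?_, h'⟩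
  have := (Matrix.isUnit_iff_isUnit_det _).1 hg.isUnit
  rw [h', Matrix.det_mul] at this
  exact (Matrix.isUnit_iff_isUnit_det _).2 (isUnit_of_mul_isUnit_right this)

/-- The recursion preserves diagonal matrices. The `i`-th entry of `T_q` is the slope of `σ_{q+1}`
when the `i`-th eigenvalue is increased; the matrix stays positive semidefinite, so this affine
function of `s ≥ 0` is never negative and its slope cannot be negative. -/
theorem newton_diagonal (d : Fin m → ℝ) (hd : ∀ i, 0 ≤ d i) (q : ℕ) :
    ∃ d' : Fin m → ℝ, newton (Matrix.diagonal d) q = Matrix.diagonal d' ∧ ∀ i, 0 ≤ d' i := by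
  have h1 : ∃ d' : Fin m → ℝ, newton (Matrix.diagonal d) q = Matrix.diagonal d' := by
    induction q with
    | zero => exact ⟨1, by simp [newton]⟩
    | succ q ih =>
      obtain ⟨d', h⟩ := ih
      refine ⟨(fun _ => sigma (q + 1) (Matrix.diagonal d)) - fun i => d' i * d i, ?_⟩
      rw [newton, h, Matrix.diagonal_mul_diagonal, Matrix.smul_one_eq_diagonal,
        Matrix.diagonal_sub]
      rfl
  obtain ⟨d', h⟩ := h1
  refine ⟨d', h, fun i => ?_⟩
  by_contra! hneg
  have hs : ∀ s : ℝ, 0 ≤ s → 0 ≤ sigma (q + 1) (Matrix.diagonal d) + s * d' i := by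
    intro s hs
    have h2 := sigma_add_smul_single (Matrix.diagonal d) q i i s
    rw [h, Matrix.diagonal_apply_eq] at h2
    rw [← h2]
    refine sigma_nonneg_of_posSemidef ((Matrix.PosSemidef.diagonal hd).add ?_) _
    have : s • Matrix.single i i (1 : ℝ) = Matrix.diagonal (Pi.single i s) := by
      rw [Matrix.diagonal_single, Matrix.smul_single, smul_eq_mul, mul_one]
    rw [this]
    refine Matrix.PosSemidef.diagonal fun j => ?_
    by_cases hj : j = i
    · subst hj; simpa using hs
    · simp [hj]
  have h0 := hs 0 le_rfl
  -- With a negative slope, this is the parameter at which the affine function takes the value `-1`.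
  have h3 := hs ((sigma (q + 1) (Matrix.diagonal d) + 1) / (-d' i)) (by
    apply div_nonneg <;> linarith)
  have h4 : (sigma (q + 1) (Matrix.diagonal d) + 1) / (-d' i) * d' i
      = -(sigma (q + 1) (Matrix.diagonal d) + 1) := by
    rw [div_neg, neg_mul, div_mul_cancel₀ _ hneg.ne]
  rw [h4] at h3
  linarith

/-- The spectral theorem and conjugation equivariance reduce to the diagonal case. -/
theorem newton_nonneg_of_posSemidef {A : Matrix (Fin m) (Fin m) ℝ} (hA : A.PosSemidef) (q : ℕ)
    (r : Fin m → ℝ) : 0 ≤ r ⬝ᵥ newton A q *ᵥ r := by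
  have hs := hA.isHermitian.spectral_theorem
  set U : Matrix (Fin m) (Fin m) ℝ := hA.isHermitian.eigenvectorUnitary.1 with hU
  set d : Fin m → ℝ := RCLike.ofReal ∘ hA.isHermitian.eigenvalues with hd
  have hd0 : ∀ i, 0 ≤ d i := fun i => by simpa [hd] using hA.eigenvalues_nonneg i
  have hUU : Uᵀ * U = 1 := by
    have := Unitary.coe_star_mul_self hA.isHermitian.eigenvectorUnitary
    simpa [Matrix.star_eq_conjTranspose] using this
  have hs' : A = U * Matrix.diagonal d * Uᵀ := by
    rw [Unitary.conjStarAlgAut_apply] at hs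
    simpa [Matrix.star_eq_conjTranspose] using hs
  obtain ⟨d', h1, h2⟩ := newton_diagonal d hd0 q
  rw [hs', newton_conj hUU, h1]
  have := (Matrix.PosSemidef.diagonal h2).mul_mul_conjTranspose_same U
  simpa using this.dotProduct_mulVec_nonneg r

/-- Writing `g⁻¹ = BᵀB`, the matrix `g⁻¹A` is conjugate to the positive semidefinite `BABᵀ`, and
raising an index turns `T_q(g⁻¹A) g⁻¹` into `Bᵀ T_q(BABᵀ) B`. This is the coordinate form of `⟨T_q
∇r, ∇r⟩ ≥ 0`. -/
theorem newton_inv_mul_nonneg {g A : Matrix (Fin m) (Fin m) ℝ} (hg : g.PosDef)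
    (hA : A.PosSemidef) (q : ℕ) (r : Fin m → ℝ) :
    0 ≤ r ⬝ᵥ newton (g⁻¹ * A) q *ᵥ (g⁻¹ *ᵥ r) := by
  obtain ⟨B, hBu, hB⟩ := exists_eq_transpose_mul_self_of_posDef hg.inv
  have hBi : (Bᵀ)⁻¹ * Bᵀ = 1 :=
    Matrix.nonsing_inv_mul _ (by simpa using (Matrix.isUnit_iff_isUnit_det _).1 hBu)
  have hBi' : Bᵀ * (Bᵀ)⁻¹ = 1 := mul_eq_one_comm.1 hBi
  have h1 : g⁻¹ * A = Bᵀ * (B * A * Bᵀ) * (Bᵀ)⁻¹ := by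
    rw [hB]
    simp only [mul_assoc, hBi', mul_one]
  have hP : (B * A * Bᵀ).PosSemidef := by simpa using hA.mul_mul_conjTranspose_same B
  have h2 := newton_nonneg_of_posSemidef hP q (B *ᵥ r)
  rw [h1, newton_conj hBi, hB, Matrix.mulVec_mulVec]
  have h3 : Bᵀ * newton (B * A * Bᵀ) q * (Bᵀ)⁻¹ * (Bᵀ * B)
      = Bᵀ * newton (B * A * Bᵀ) q * B := by
    calc _ = Bᵀ * newton (B * A * Bᵀ) q * ((Bᵀ)⁻¹ * Bᵀ) * B := by simp only [mul_assoc]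
      _ = _ := by rw [hBi, mul_one]
  rw [h3, mul_assoc, ← Matrix.mulVec_mulVec, ← Matrix.mulVec_mulVec, Matrix.dotProduct_mulVec,
    Matrix.vecMul_transpose]
  exact h2

end Algebra

/-! ### Calculus of the Levi-Civita connection and curvature of the warped product -/

section Ambient

variable {n : ℕ}

theorem metric_comm (h : ℝ → ℝ) (q v w : Amb n) : metric h q v w = metric h q w v := by
  simp only [metric, real_inner_comm w.1 v.1, mul_comm v.2]

theorem metric_add_left (h : ℝ → ℝ) (q u v w : Amb n) :
    metric h q (u + v) w = metric h q u w + metric h q v w := by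
  simp only [metric, Prod.fst_add, Prod.snd_add, inner_add_left]; ring

theorem metric_smul_left (h : ℝ → ℝ) (q : Amb n) (c : ℝ) (v w : Amb n) :
    metric h q (c • v) w = c * metric h q v w := by
  simp only [metric, Prod.smul_fst, Prod.smul_snd, real_inner_smul_left, smul_eq_mul]; ring

/-- The metric as a bilinear form on the ambient space. -/
def metricForm (h : ℝ → ℝ) (q : Amb n) : Amb n →ₗ[ℝ] Amb n →ₗ[ℝ] ℝ :=
  LinearMap.mk₂ ℝ (metric h q) (metric_add_left h q) (metric_smul_left h q)
    (fun u v w => by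
      rw [metric_comm, metric_add_left, metric_comm h q v, metric_comm h q w])
    (fun c v w => by rw [metric_comm, metric_smul_left, metric_comm h q w, smul_eq_mul])

theorem metricForm_apply (h : ℝ → ℝ) (q v w : Amb n) : metricForm h q v w = metric h q v w := rfl

theorem metric_add_right (h : ℝ → ℝ) (q u v w : Amb n) :
    metric h q u (v + w) = metric h q u v + metric h q u w := map_add (metricForm h q u) v w

theorem metric_smul_right (h : ℝ → ℝ) (q : Amb n) (c : ℝ) (v w : Amb n) :
    metric h q v (c • w) = c * metric h q v w := map_smul (metricForm h q v) c w

theorem metric_sub_left (h : ℝ → ℝ) (q u v w : Amb n) :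
    metric h q (u - v) w = metric h q u w - metric h q v w := by
  simp only [← metricForm_apply, map_sub, LinearMap.sub_apply]

theorem metric_zero_left (h : ℝ → ℝ) (q w : Amb n) : metric h q 0 w = 0 := by
  simp [metric]

theorem metric_sum_left (h : ℝ → ℝ) (q : Amb n) {ι : Type*} (s : Finset ι) (u : ι → Amb n)
    (w : Amb n) : metric h q (∑ i ∈ s, u i) w = ∑ i ∈ s, metric h q (u i) w := by
  simp only [← metricForm_apply, map_sum, LinearMap.sum_apply]

theorem metric_sum_right (h : ℝ → ℝ) (q : Amb n) {ι : Type*} (s : Finset ι) (u : ι → Amb n)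
    (w : Amb n) : metric h q w (∑ i ∈ s, u i) = ∑ i ∈ s, metric h q w (u i) :=
  map_sum (metricForm h q w) u s

theorem metric_self_pos {h : ℝ → ℝ} {q : Amb n} (hq : 0 < h q.2) {v : Amb n} (hv : v ≠ 0) :
    0 < metric h q v v := by
  have h2 : 0 < h q.2 ^ 2 := by positivity
  unfold metric
  rw [real_inner_self_eq_norm_sq]
  by_cases h1 : v.1 = 0
  · have : v.2 ≠ 0 := fun h' => hv (Prod.ext h1 h')
    have := mul_self_pos.2 this
    positivity
  · have : 0 < ‖v.1‖ := norm_pos_iff.2 h1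
    have := mul_self_nonneg v.2
    positivity

variable {E : Type*} [NormedAddCommGroup E] [NormedSpace ℝ E]

/-- The covariant derivative of a vector field `U` along `P : E → M` in the direction `v`. -/
def cov (rbar : EReal) (h : ℝ → ℝ) (P U : E → Amb n) (z v : E) : Amb n :=
  ((fderiv ℝ U z v).1 - (inner ℝ (P z).1 (fderiv ℝ U z v).1 : ℝ) • (P z).1
      + (warpD rbar h (P z).2 / h (P z).2) • ((fderiv ℝ P z v).2 • (U z).1
        + (U z).2 • (fderiv ℝ P z v).1),
    (fderiv ℝ U z v).2
      - h (P z).2 * warpD rbar h (P z).2 * inner ℝ (fderiv ℝ P z v).1 (U z).1)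

theorem cov_add_dir (rbar : EReal) (h : ℝ → ℝ) (P U : E → Amb n) (z v w : E) :
    cov rbar h P U z (v + w) = cov rbar h P U z v + cov rbar h P U z w := by
  unfold cov
  simp only [map_add, Prod.fst_add, Prod.snd_add, inner_add_left, inner_add_right, Prod.mk_add_mk]
  congr 1
  · module
  · ring

theorem cov_smul_dir (rbar : EReal) (h : ℝ → ℝ) (P U : E → Amb n) (z : E) (c : ℝ) (v : E) :
    cov rbar h P U z (c • v) = c • cov rbar h P U z v := by
  unfold cov
  simp only [map_smul, Prod.smul_fst, Prod.smul_snd, real_inner_smul_left, real_inner_smul_right,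
    Prod.smul_mk, smul_eq_mul]
  congr 1
  · module
  · ring

theorem cov_sum_dir (rbar : EReal) (h : ℝ → ℝ) (P U : E → Amb n) (z : E) {ι : Type*}
    (s : Finset ι) (v : ι → E) :
    cov rbar h P U z (∑ i ∈ s, v i) = ∑ i ∈ s, cov rbar h P U z (v i) :=
  map_sum (IsLinearMap.mk' (cov rbar h P U z)
    ⟨cov_add_dir rbar h P U z, cov_smul_dir rbar h P U z⟩) v s

theorem cov_congr (rbar : EReal) (h : ℝ → ℝ) (P : E → Amb n) {U U' : E → Amb n} {z : E}
    (hU : U =ᶠ[nhds z] U') (v : E) : cov rbar h P U z v = cov rbar h P U' z v := by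
  unfold cov
  rw [hU.fderiv_eq, hU.eq_of_nhds]

theorem cov_add (rbar : EReal) (h : ℝ → ℝ) (P : E → Amb n) {U U' : E → Amb n} {z : E}
    (hU : DifferentiableAt ℝ U z) (hU' : DifferentiableAt ℝ U' z) (v : E) :
    cov rbar h P (fun y => U y + U' y) z v = cov rbar h P U z v + cov rbar h P U' z v := by
  unfold cov
  rw [fderiv_fun_add hU hU']
  simp only [_root_.add_apply, Prod.fst_add, Prod.snd_add, inner_add_right, Prod.mk_add_mk]
  congr 1
  · module
  · ring

/-- The Leibniz rule requires tangency at the point: the term `dφ(v) U` survives the projection away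
from the sphere's position vector only if `U` is orthogonal to that vector. -/
theorem cov_smul (rbar : EReal) (h : ℝ → ℝ) (P : E → Amb n) {φ : E → ℝ} {U : E → Amb n} {z : E}
    (hφ : DifferentiableAt ℝ φ z) (hU : DifferentiableAt ℝ U z) {q : Amb n} (hq : P z = q)
    (ht : U z ∈ tangent q) (v : E) :
    cov rbar h P (fun y => φ y • U y) z v = fderiv ℝ φ z v • U z + φ z • cov rbar h P U z v := by
  subst hq
  have ht' : inner ℝ (P z).1 (U z).1 = (0 : ℝ) := ht
  unfold cov
  rw [fderiv_fun_smul hφ hU]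
  simp only [_root_.add_apply, _root_.smul_apply, ContinuousLinearMap.smulRight_apply, Prod.fst_add,
    Prod.snd_add, Prod.smul_fst, Prod.smul_snd, inner_add_right, real_inner_smul_right, ht']
  ext1
  · simp only [Prod.fst_add, Prod.smul_fst]
    module
  · simp only [Prod.snd_add, Prod.smul_snd, smul_eq_mul]
    ring

theorem cov_sum_smul (rbar : EReal) (h : ℝ → ℝ) (P : E → Amb n) {ι : Type*} (s : Finset ι)
    {φ : ι → E → ℝ} {U : ι → E → Amb n} {z : E}
    (hφ : ∀ i, DifferentiableAt ℝ (φ i) z) (hU : ∀ i, DifferentiableAt ℝ (U i) z)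
    (ht : ∀ i, U i z ∈ tangent (P z)) (v : E) :
    cov rbar h P (fun y => ∑ i ∈ s, φ i y • U i y) z v
      = ∑ i ∈ s, (fderiv ℝ (φ i) z v • U i z + φ i z • cov rbar h P (U i) z v) := by
  classical
  induction s using Finset.induction_on with
  | empty => simp [cov]
  | insert a s ha ih =>
    simp only [Finset.sum_insert ha]
    rw [cov_add rbar h P ((hφ a).fun_smul (hU a)) (DifferentiableAt.fun_sum fun i _ =>
      (hφ i).fun_smul (hU i)), ih, cov_smul rbar h P (hφ a) (hU a) rfl (ht a)]

/-- At `r = 0` the function `g` has only a one-sided derivative, but the radial coordinate of `P`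
stays in the interval near `z`, so the composite has a full derivative even where the hypersurface
meets the boundary slice. -/
theorem hasDerivWithinAt_comp_hasFDerivAt {g : ℝ → ℝ} {s : Set ℝ} {g' : ℝ} {P : E → Amb n}
    {z : E} (hg : HasDerivWithinAt g g' s (P z).2) (hP : DifferentiableAt ℝ P z)
    (hs : ∀ᶠ y in nhds z, (P y).2 ∈ s) :
    HasFDerivAt (fun y => g (P y).2)
      (g' • (ContinuousLinearMap.snd ℝ (EuclideanSpace ℝ (Fin n)) ℝ).comp (fderiv ℝ P z)) z := by
  have h1 : HasFDerivWithinAt (fun y => (P y).2)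
      ((ContinuousLinearMap.snd ℝ (EuclideanSpace ℝ (Fin n)) ℝ).comp (fderiv ℝ P z))
      {y | (P y).2 ∈ s} z := hP.hasFDerivAt.snd.hasFDerivWithinAt
  exact (hg.comp_hasFDerivWithinAt z h1 (fun y hy => hy)).hasFDerivAt hs

theorem uniqueDiffOn_radialInterval {rbar : EReal} (hr : 0 < rbar) :
    UniqueDiffOn ℝ (radialInterval rbar) := by
  have hconv : Convex ℝ (radialInterval rbar) := by
    refine Set.OrdConnected.convex ⟨fun x hx y hy t ht => ?_⟩
    exact ⟨hx.1.trans ht.1, lt_of_le_of_lt (EReal.coe_le_coe_iff.2 ht.2) hy.2⟩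
  obtain ⟨b, hb0, hb⟩ := EReal.lt_iff_exists_real_btwn.1 hr
  refine uniqueDiffOn_convex hconv ⟨b / 2, ?_⟩
  have hb0' : 0 < b := EReal.coe_pos.1 hb0
  have hsub : Ioo 0 b ⊆ radialInterval rbar := fun x hx =>
    ⟨hx.1.le, lt_trans (EReal.coe_lt_coe_iff.2 hx.2) hb⟩
  exact interior_maximal hsub isOpen_Ioo ⟨half_pos hb0', half_lt_self hb0'⟩

namespace IsWarpingFunction

variable {rbar : EReal} {h : ℝ → ℝ}

theorem smooth_warpD (hh : IsWarpingFunction n rbar h) :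
    ContDiffOn ℝ ∞ (warpD rbar h) (radialInterval rbar) :=
  hh.smooth.derivWithin (uniqueDiffOn_radialInterval hh.rbar_pos) (by simp)

theorem hasDerivWithinAt (hh : IsWarpingFunction n rbar h) {r : ℝ} (hr : r ∈ radialInterval rbar) :
    HasDerivWithinAt h (warpD rbar h r) (radialInterval rbar) r :=
  ((hh.smooth.differentiableOn (by simp)) _ hr).hasDerivWithinAt

theorem hasDerivWithinAt_warpD (hh : IsWarpingFunction n rbar h) {r : ℝ}
    (hr : r ∈ radialInterval rbar) :
    HasDerivWithinAt (warpD rbar h) (warpDD rbar h r) (radialInterval rbar) r :=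
  ((hh.smooth_warpD.differentiableOn (by simp)) _ hr).hasDerivWithinAt

/-- (H4) covers only `r > 0`. At `r = 0`, (H1) reduces the expression to `h''(0)/h(0) + 1/h(0)²`. -/
theorem curvature_pos (hh : IsWarpingFunction n rbar h) {r : ℝ} (hr : r ∈ radialInterval rbar) :
    0 < warpDD rbar h r / h r + (1 - warpD rbar h r ^ 2) / h r ^ 2 := by
  rcases hr.1.eq_or_lt with h0 | h0
  · have hp := hh.pos r hr
    subst h0
    rw [hh.H1.1]
    have := hh.H1.2
    positivity
  · exact hh.H4 r hr h0

end IsWarpingFunction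

/-- A smooth map into `M`, near a point. -/
structure IsSmoothNear (rbar : EReal) (P : E → Amb n) (z : E) : Prop where
  smooth : ContDiffAt ℝ ∞ P z
  mem : ∀ᶠ y in nhds z, P y ∈ carrier n rbar

namespace IsSmoothNear

variable {rbar : EReal} {h : ℝ → ℝ} {P U W N : E → Amb n} {z : E}

theorem mem_self (hP : IsSmoothNear rbar P z) : P z ∈ carrier n rbar := hP.mem.self_of_nhds

theorem differentiableAt (hP : IsSmoothNear rbar P z) : DifferentiableAt ℝ P z :=
  hP.smooth.differentiableAt (by simp)

theorem contDiffAt_comp (hP : IsSmoothNear rbar P z) {g : ℝ → ℝ}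
    (hg : ContDiffOn ℝ ∞ g (radialInterval rbar)) : ContDiffAt ℝ ∞ (fun y => g (P y).2) z := by
  have h1 : ContDiffWithinAt ℝ ∞ (fun y => g (P y).2) {y | (P y).2 ∈ radialInterval rbar} z :=
    (hg _ hP.mem_self.2).comp z hP.smooth.snd.contDiffWithinAt (fun y hy => hy)
  exact h1.contDiffAt (hP.mem.mono fun y hy => hy.2)

theorem contDiffAt_warp (hP : IsSmoothNear rbar P z) (hh : IsWarpingFunction n rbar h) :
    ContDiffAt ℝ ∞ (fun y => h (P y).2) z := hP.contDiffAt_comp hh.smooth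

theorem hasFDerivAt_warp (hP : IsSmoothNear rbar P z) (hh : IsWarpingFunction n rbar h) :
    HasFDerivAt (fun y => h (P y).2) (warpD rbar h (P z).2 •
      (ContinuousLinearMap.snd ℝ (EuclideanSpace ℝ (Fin n)) ℝ).comp (fderiv ℝ P z)) z :=
  hasDerivWithinAt_comp_hasFDerivAt (hh.hasDerivWithinAt hP.mem_self.2) hP.differentiableAt
    (hP.mem.mono fun _ hy => hy.2)

theorem hasFDerivAt_warpD (hP : IsSmoothNear rbar P z) (hh : IsWarpingFunction n rbar h) :
    HasFDerivAt (fun y => warpD rbar h (P y).2) (warpDD rbar h (P z).2 •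
      (ContinuousLinearMap.snd ℝ (EuclideanSpace ℝ (Fin n)) ℝ).comp (fderiv ℝ P z)) z :=
  hasDerivWithinAt_comp_hasFDerivAt (hh.hasDerivWithinAt_warpD hP.mem_self.2)
    hP.differentiableAt (hP.mem.mono fun _ hy => hy.2)

/-- Differentiate `|ω|² = 1` along the map. -/
theorem inner_fderiv_eq_zero (hP : IsSmoothNear rbar P z) (v : E) :
    inner ℝ (P z).1 (fderiv ℝ P z v).1 = (0 : ℝ) := by
  have h1 := (hP.differentiableAt.hasFDerivAt).fst
  have h2 := h1.inner ℝ h1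
  have h3 : (fun y => inner ℝ (P y).1 (P y).1) =ᶠ[nhds z] fun _ => (1 : ℝ) := by
    filter_upwards [hP.mem] with y hy
    rw [real_inner_self_eq_norm_sq, hy.1, one_pow]
  have h4 := h2.unique ((hasFDerivAt_const (1 : ℝ) z).congr_of_eventuallyEq h3)
  have h5 := congrArg (fun L => L v) h4
  simp only [ContinuousLinearMap.comp_apply, ContinuousLinearMap.prod_apply,
    fderivInnerCLM_apply, ContinuousLinearMap.coe_fst', _root_.zero_apply] at h5
  have h6 := real_inner_comm (fderiv ℝ P z v).1 (P z).1
  linarith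

theorem fderiv_mem_tangent (hP : IsSmoothNear rbar P z) (v : E) :
    fderiv ℝ P z v ∈ tangent (P z) := hP.inner_fderiv_eq_zero v

theorem cov_mem_tangent (hP : IsSmoothNear rbar P z) (hU : U z ∈ tangent (P z)) (v : E) :
    cov rbar h P U z v ∈ tangent (P z) := by
  have h1 := hP.inner_fderiv_eq_zero v
  have h2 : inner ℝ (P z).1 (U z).1 = (0 : ℝ) := hU
  have h3 : inner ℝ (P z).1 (P z).1 = (1 : ℝ) := by
    rw [real_inner_self_eq_norm_sq, hP.mem_self.1, one_pow]
  simp only [tangent, Set.mem_ofPred_eq, cov, inner_add_right, inner_sub_right,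
    real_inner_smul_right, h1, h2, h3]
  ring

theorem contDiffAt_fderiv_apply {F : Type*} [NormedAddCommGroup F] [NormedSpace ℝ F] {G : E → F}
    (hG : ContDiffAt ℝ ∞ G z) (v : E) : ContDiffAt ℝ ∞ (fun y => fderiv ℝ G y v) z :=
  (hG.fderiv_right (m := ∞) (by simp)).clm_apply contDiffAt_const

theorem contDiffAt_cov (hP : IsSmoothNear rbar P z) (hh : IsWarpingFunction n rbar h)
    (hU : ContDiffAt ℝ ∞ U z) (v : E) : ContDiffAt ℝ ∞ (fun y => cov rbar h P U y v) z := by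
  have hw := hP.contDiffAt_warp hh
  have hw1 := hP.contDiffAt_comp hh.smooth_warpD
  have hdU := contDiffAt_fderiv_apply hU v
  have hdP := contDiffAt_fderiv_apply hP.smooth v
  have h0 : h (P z).2 ≠ 0 := (hh.pos _ hP.mem_self.2).ne'
  have hp := hP.smooth
  unfold cov
  refine ContDiffAt.prodMk ?_ ?_
  · exact (hdU.fst.sub ((hp.fst.inner ℝ hdU.fst).smul hp.fst)).add
      ((hw1.div hw h0).smul ((hdP.snd.smul hU.fst).add (hU.snd.smul hdP.fst)))
  · exact hdU.snd.sub ((hw.mul hw1).mul (hdP.fst.inner ℝ hU.fst))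

theorem contDiffAt_metric (hP : IsSmoothNear rbar P z) (hh : IsWarpingFunction n rbar h)
    (hU : ContDiffAt ℝ ∞ U z) (hW : ContDiffAt ℝ ∞ W z) :
    ContDiffAt ℝ ∞ (fun y => metric h (P y) (U y) (W y)) z :=
  (hU.snd.mul hW.snd).add (((hP.contDiffAt_warp hh).pow 2).mul (hU.fst.inner ℝ hW.fst))

/-- Compatibility of the connection with the metric. -/
theorem fderiv_metric (hP : IsSmoothNear rbar P z) (hh : IsWarpingFunction n rbar h)
    (hU : DifferentiableAt ℝ U z) (hW : DifferentiableAt ℝ W z) (hUt : U z ∈ tangent (P z))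
    (hWt : W z ∈ tangent (P z)) (v : E) :
    fderiv ℝ (fun y => metric h (P y) (U y) (W y)) z v
      = metric h (P z) (cov rbar h P U z v) (W z) + metric h (P z) (U z) (cov rbar h P W z v) := by
  have h0 : h (P z).2 ≠ 0 := (hh.pos _ hP.mem_self.2).ne'
  have htot := ((hU.hasFDerivAt.snd).mul hW.hasFDerivAt.snd).add
    (((hP.hasFDerivAt_warp hh).pow 2).mul (hU.hasFDerivAt.fst.inner ℝ hW.hasFDerivAt.fst))
  have hfd : fderiv ℝ (fun y => metric h (P y) (U y) (W y)) z = _ := htot.fderiv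
  rw [hfd]
  have t1 : inner ℝ (P z).1 (U z).1 = (0 : ℝ) := hUt
  have t2 : inner ℝ (P z).1 (W z).1 = (0 : ℝ) := hWt
  have t1' : inner ℝ (U z).1 (P z).1 = (0 : ℝ) := by rw [real_inner_comm]; exact t1
  simp only [metric, cov]
  simp [inner_add_left, inner_add_right, inner_sub_left, inner_sub_right, inner_smul_left,
    inner_smul_right, t1', t2]
  rw [real_inner_comm (fderiv ℝ P z v).1 (U z).1]
  field_simp
  ring

theorem fderiv_fderiv_comm {F : Type*} [NormedAddCommGroup F] [NormedSpace ℝ F] {G : E → F}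
    (hG : ContDiffAt ℝ ∞ G z) (u w : E) :
    fderiv ℝ (fun y => fderiv ℝ G y u) z w = fderiv ℝ (fun y => fderiv ℝ G y w) z u := by
  have hd : DifferentiableAt ℝ (fderiv ℝ G) z :=
    (hG.fderiv_right (m := 1) (by norm_cast)).differentiableAt (by norm_num)
  have e1 : ∀ a b : E, fderiv ℝ (fun y => fderiv ℝ G y a) z b = fderiv ℝ (fderiv ℝ G) z b a := by
    intro a b
    rw [fderiv_clm_apply hd (differentiableAt_const a)]
    simp
  rw [e1, e1]
  exact ((hG.of_le (by norm_cast) : ContDiffAt ℝ 2 G z).isSymmSndFDerivAt (by simp)) w u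

/-- The connection is torsion free. -/
theorem cov_fderiv_comm (hP : IsSmoothNear rbar P z) (u w : E) :
    cov rbar h P (fun y => fderiv ℝ P y u) z w = cov rbar h P (fun y => fderiv ℝ P y w) z u := by
  unfold cov
  rw [fderiv_fderiv_comm hP.smooth u w, real_inner_comm (fderiv ℝ P z u).1 (fderiv ℝ P z w).1,
    add_comm ((fderiv ℝ P z u).2 • (fderiv ℝ P z w).1)]

theorem _root_.hasDerivAt_comp_line {F : Type*} [NormedAddCommGroup F] [NormedSpace ℝ F]
    {G : E → F} (hG : DifferentiableAt ℝ G z) (w : E) :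
    HasDerivAt (fun t : ℝ => G (z + t • w)) (fderiv ℝ G z w) 0 :=
  hG.hasFDerivAt.hasLineDerivAt w

theorem _root_.HasDerivAt.fst_prod {A B : Type*} [NormedAddCommGroup A] [NormedSpace ℝ A]
    [NormedAddCommGroup B] [NormedSpace ℝ B] {f : ℝ → A × B} {f' : A × B} {t : ℝ}
    (hf : HasDerivAt f f' t) : HasDerivAt (fun s => (f s).1) f'.1 t :=
  (hasFDerivAt_fst (𝕜 := ℝ) (p := f t)).comp_hasDerivAt t hf

theorem _root_.HasDerivAt.snd_prod {A B : Type*} [NormedAddCommGroup A] [NormedSpace ℝ A]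
    [NormedAddCommGroup B] [NormedSpace ℝ B] {f : ℝ → A × B} {f' : A × B} {t : ℝ}
    (hf : HasDerivAt f f' t) : HasDerivAt (fun s => (f s).2) f'.2 t :=
  (hasFDerivAt_snd (𝕜 := ℝ) (p := f t)).comp_hasDerivAt t hf

/-- An explicit expansion of the second-order expression in components, obtained by one-variable
rules along the line `z + t w`. It reduces the curvature computation below to algebra. -/
theorem fderiv_cov (hP : IsSmoothNear rbar P z) (hh : IsWarpingFunction n rbar h)
    (hU : ContDiffAt ℝ ∞ U z) (u w : E) :
    fderiv ℝ (fun y => cov rbar h P U y u) z w =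
      (let H := h (P z).2
       let H1 := warpD rbar h (P z).2
       let H2 := warpDD rbar h (P z).2
       let Pu := fderiv ℝ P z u
       let Pw := fderiv ℝ P z w
       let Puw := fderiv ℝ (fun y => fderiv ℝ P y u) z w
       let Uu := fderiv ℝ U z u
       let Uw := fderiv ℝ U z w
       let Uuw := fderiv ℝ (fun y => fderiv ℝ U y u) z w
      (Uuw.1 - ((inner ℝ Pw.1 Uu.1 + inner ℝ (P z).1 Uuw.1 : ℝ) • (P z).1
          + (inner ℝ (P z).1 Uu.1 : ℝ) • Pw.1)
        + (((H2 * H - H1 * H1) * Pw.2 / H ^ 2) • (Pu.2 • (U z).1 + (U z).2 • Pu.1)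
          + (H1 / H) • (Puw.2 • (U z).1 + Pu.2 • Uw.1 + Uw.2 • Pu.1 + (U z).2 • Puw.1)),
      Uuw.2 - ((H1 * Pw.2 * H1 + H * (H2 * Pw.2)) * inner ℝ Pu.1 (U z).1
        + H * H1 * (inner ℝ Puw.1 (U z).1 + inner ℝ Pu.1 Uw.1)))) := by
  have h0 : h (P z).2 ≠ 0 := (hh.pos _ hP.mem_self.2).ne'
  have hd := (hP.contDiffAt_cov hh hU u).differentiableAt (by simp)
  have l0 := hasDerivAt_comp_line hd w
  have l1 := hasDerivAt_comp_line (hU.differentiableAt (by simp)) w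
  have l2 := hasDerivAt_comp_line ((contDiffAt_fderiv_apply hU u).differentiableAt (by simp)) w
  have l3 := hasDerivAt_comp_line hP.differentiableAt w
  have l4 := hasDerivAt_comp_line
    ((contDiffAt_fderiv_apply hP.smooth u).differentiableAt (by simp)) w
  have l5 := hasDerivAt_comp_line (hP.hasFDerivAt_warp hh).differentiableAt w
  have l6 := hasDerivAt_comp_line (hP.hasFDerivAt_warpD hh).differentiableAt w
  rw [(hP.hasFDerivAt_warp hh).fderiv] at l5
  rw [(hP.hasFDerivAt_warpD hh).fderiv] at l6
  have z0 : z + (0 : ℝ) • w = z := by simp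
  have hne : h (P (z + (0 : ℝ) • w)).2 ≠ 0 := by rw [z0]; exact h0
  have m1 := (l2.fst_prod.sub ((l3.fst_prod.inner ℝ l2.fst_prod).smul l3.fst_prod)).add
    ((l6.div l5 hne).smul
      ((l4.snd_prod.smul l1.fst_prod).add (l1.snd_prod.smul l4.fst_prod)))
  have m2 := l2.snd_prod.sub ((l5.mul l6).mul (l4.fst_prod.inner ℝ l1.fst_prod))
  rw [l0.unique (m1.prodMk m2)]
  simp only [Pi.div_apply, Pi.mul_apply, Pi.add_apply, Pi.smul_apply', z0, _root_.smul_apply,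
    ContinuousLinearMap.comp_apply, ContinuousLinearMap.coe_snd', smul_eq_mul]
  ext1
  · simp only
    module
  · simp only
    ring

/-- The Codazzi equation, in ambient form: the commutator of covariant derivatives of a unit normal
field. -/
theorem cov_cov_sub_cov_cov (hP : IsSmoothNear rbar P z) (hh : IsWarpingFunction n rbar h)
    (hN : ContDiffAt ℝ ∞ N z) (hNt : ∀ᶠ y in nhds z, N y ∈ tangent (P y)) (u w : E)
    (hu : metric h (P z) (N z) (fderiv ℝ P z u) = 0)
    (hw : metric h (P z) (N z) (fderiv ℝ P z w) = 0) :
    cov rbar h P (fun y => cov rbar h P N y u) z w - cov rbar h P (fun y => cov rbar h P N y w) z u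
      = (-(warpDD rbar h (P z).2 / h (P z).2
          + (1 - warpD rbar h (P z).2 ^ 2) / h (P z).2 ^ 2) * (N z).2) •
        ((fderiv ℝ P z u).2 • fderiv ℝ P z w - (fderiv ℝ P z w).2 • fderiv ℝ P z u) := by
  have h0 : h (P z).2 ≠ 0 := (hh.pos _ hP.mem_self.2).ne'
  have a1 : inner ℝ (P z).1 (P z).1 = (1 : ℝ) := by
    rw [real_inner_self_eq_norm_sq, hP.mem_self.1, one_pow]
  have a2 : inner ℝ (P z).1 (N z).1 = (0 : ℝ) := hNt.self_of_nhds
  have a3 := hP.inner_fderiv_eq_zero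
  -- Differentiate the tangency relation `⟨ω, N₁⟩ = 0`.
  have a4 : ∀ v, inner ℝ (P z).1 (fderiv ℝ N z v).1 = -inner ℝ (fderiv ℝ P z v).1 (N z).1 := by
    intro v
    have l1 := (hasDerivAt_comp_line (hN.differentiableAt (by simp)) v).fst_prod
    have l2 := (hasDerivAt_comp_line hP.differentiableAt v).fst_prod
    have l3 := l2.inner ℝ l1
    have hc : ContinuousAt (fun t : ℝ => z + t • v) 0 := by fun_prop
    have hev : ∀ᶠ t in nhds (0 : ℝ), N (z + t • v) ∈ tangent (P (z + t • v)) :=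
      hc.eventually (by simpa using hNt)
    have l4 := l3.unique ((hasDerivAt_const (0 : ℝ) (0 : ℝ)).congr_of_eventuallyEq
      (hev.mono fun t ht => ht))
    simp only [zero_smul, add_zero] at l4
    linarith
  -- Orthogonality to the hypersurface expresses the spherical inner product through the radial
  -- components. This collapses the curvature tensor to a multiple of `N_r`, with the spherical and
  -- radial sectional curvatures entering only through their difference.
  have a5 : ∀ v, metric h (P z) (N z) (fderiv ℝ P z v) = 0 →
      inner ℝ (fderiv ℝ P z v).1 (N z).1
        = -((h (P z).2)⁻¹ ^ 2 * (N z).2 * (fderiv ℝ P z v).2) := by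
    intro v hv
    rw [metric, real_inner_comm] at hv
    field_simp
    linear_combination hv
  have b1 := a5 u hu
  have b2 := a5 w hw
  have k1 := fderiv_cov hP hh hN u w
  have k2 := fderiv_cov hP hh hN w u
  rw [fderiv_fderiv_comm hP.smooth w u, fderiv_fderiv_comm hN w u] at k2
  rw [cov.eq_def rbar h P (fun y => cov rbar h P N y u), k1,
    cov.eq_def rbar h P (fun y => cov rbar h P N y w), k2]
  clear k1 k2
  simp only [cov]
  have c1 := real_inner_comm (fderiv ℝ P z u).1 (fderiv ℝ P z w).1
  have c2 : ∀ v, inner ℝ (fderiv ℝ P z v).1 (P z).1 = (0 : ℝ) := fun v => by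
    rw [real_inner_comm]; exact a3 v
  simp only [inner_add_right, inner_sub_right, real_inner_smul_right, a1, a2, a3,
    a4, c1, c2, b1, b2]
  -- From here the reciprocal of `h` is an independent variable `q` subject to `H q = 1`, and the
  -- identity is checked coefficient by coefficient as a polynomial identity modulo this relation.
  have e : h (P z).2 * (h (P z).2)⁻¹ = 1 := mul_inv_cancel₀ h0
  generalize h (P z).2 = H at *
  obtain ⟨q, rfl⟩ : ∃ q, H⁻¹ = q := ⟨_, rfl⟩
  simp only [div_eq_mul_inv, ← inv_pow]
  generalize H⁻¹ = q at *
  generalize warpD rbar h (P z).2 = H1 at *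
  generalize warpDD rbar h (P z).2 = H2 at *
  ext1
  · simp only [Prod.fst_sub, Prod.smul_fst]
    match_scalars <;> first
      | ring1
      | linear_combination (-q * (N z).2 * (fderiv ℝ P z u).2 * H2
          + q ^ 2 * (N z).2 * (fderiv ℝ P z u).2 * H1 ^ 2) * e
      | linear_combination (q * (N z).2 * (fderiv ℝ P z w).2 * H2
          - q ^ 2 * (N z).2 * (fderiv ℝ P z w).2 * H1 ^ 2) * e
  · simp only [Prod.snd_sub, Prod.smul_snd, smul_eq_mul]
    ring

end IsSmoothNear

end Ambient

/-! ### Parametrized hypersurfaces: the Gauss, Weingarten and Codazzi equations -/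

section Coordinates

open scoped Matrix

variable {m n : ℕ}

/-- A parametrized hypersurface in `M` together with a unit normal field. -/
structure IsParamHypersurface (rbar : EReal) (h : ℝ → ℝ) (V : Set (EuclideanSpace ℝ (Fin m)))
    (P N : EuclideanSpace ℝ (Fin m) → Amb n) : Prop where
  dim : n = m + 1
  isOpen : IsOpen V
  smooth : ContDiffOn ℝ ∞ P V
  smooth_normal : ContDiffOn ℝ ∞ N V
  mem : ∀ z ∈ V, P z ∈ carrier n rbar
  immersion : ∀ z ∈ V, Function.Injective (fderiv ℝ P z)
  tangent : ∀ z ∈ V, N z ∈ tangent (P z)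
  unit : ∀ z ∈ V, metric h (P z) (N z) (N z) = 1
  normal : ∀ z ∈ V, ∀ v, metric h (P z) (N z) (fderiv ℝ P z v) = 0

/-- The coordinate vector fields of a parametrization. -/
def coordField (P : EuclideanSpace ℝ (Fin m) → Amb n) (a : Fin m)
    (z : EuclideanSpace ℝ (Fin m)) : Amb n := fderiv ℝ P z (EuclideanSpace.single a 1)

/-- The matrix of the first fundamental form. -/
def gram (h : ℝ → ℝ) (P : EuclideanSpace ℝ (Fin m) → Amb n) (z : EuclideanSpace ℝ (Fin m)) :
    Matrix (Fin m) (Fin m) ℝ :=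
  Matrix.of fun a b => metric h (P z) (coordField P a z) (coordField P b z)

/-- The matrix of the second fundamental form. -/
def sff (rbar : EReal) (h : ℝ → ℝ) (P N : EuclideanSpace ℝ (Fin m) → Amb n)
    (z : EuclideanSpace ℝ (Fin m)) : Matrix (Fin m) (Fin m) ℝ :=
  Matrix.of fun a b =>
    metric h (P z) (cov rbar h P N z (EuclideanSpace.single a 1)) (coordField P b z)

/-- The matrix of the Weingarten map. -/
def shape (rbar : EReal) (h : ℝ → ℝ) (P N : EuclideanSpace ℝ (Fin m) → Amb n)
    (z : EuclideanSpace ℝ (Fin m)) : Matrix (Fin m) (Fin m) ℝ :=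
  (gram h P z)⁻¹ * sff rbar h P N z

/-- The Christoffel symbols: `christoffel c d a` is `Γ^d_{ca}`. -/
def christoffel (rbar : EReal) (h : ℝ → ℝ) (P : EuclideanSpace ℝ (Fin m) → Amb n)
    (z : EuclideanSpace ℝ (Fin m)) (c : Fin m) : Matrix (Fin m) (Fin m) ℝ :=
  (gram h P z)⁻¹ * Matrix.of fun b a => metric h (P z)
    (cov rbar h P (coordField P a) z (EuclideanSpace.single c 1)) (coordField P b z)

/-- The components of the tangential part of the conformal field. -/
def confTan (h : ℝ → ℝ) (P : EuclideanSpace ℝ (Fin m) → Amb n)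
    (z : EuclideanSpace ℝ (Fin m)) : Fin m → ℝ :=
  (gram h P z)⁻¹ *ᵥ fun c => h (P z).2 * (coordField P c z).2

/-- The covariant derivative of the Weingarten map. -/
def covShape (rbar : EReal) (h : ℝ → ℝ) (P N : EuclideanSpace ℝ (Fin m) → Amb n)
    (z : EuclideanSpace ℝ (Fin m)) (c : Fin m) : Matrix (Fin m) (Fin m) ℝ :=
  (Matrix.of fun i j => fderiv ℝ (fun y => shape rbar h P N y i j) z (EuclideanSpace.single c 1))
    + (christoffel rbar h P z c * shape rbar h P N z
      - shape rbar h P N z * christoffel rbar h P z c)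

theorem sff_apply (rbar : EReal) (h : ℝ → ℝ) (P N : EuclideanSpace ℝ (Fin m) → Amb n)
    (z : EuclideanSpace ℝ (Fin m)) (a b : Fin m) : sff rbar h P N z a b =
      metric h (P z) (cov rbar h P N z (EuclideanSpace.single a 1)) (coordField P b z) := rfl

theorem covShape_apply (rbar : EReal) (h : ℝ → ℝ) (P N : EuclideanSpace ℝ (Fin m) → Amb n)
    (z : EuclideanSpace ℝ (Fin m)) (c i j : Fin m) : covShape rbar h P N z c i j =
      fderiv ℝ (fun y => shape rbar h P N y i j) z (EuclideanSpace.single c 1)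
      + ((christoffel rbar h P z c * shape rbar h P N z) i j
        - (shape rbar h P N z * christoffel rbar h P z c) i j) := rfl

theorem sum_smul_coordField (P : EuclideanSpace ℝ (Fin m) → Amb n)
    (z : EuclideanSpace ℝ (Fin m)) (x : Fin m → ℝ) :
    ∑ a, x a • coordField P a z = fderiv ℝ P z (WithLp.toLp 2 x) := by
  unfold coordField
  simp only [← map_smul, ← map_sum]
  congr 1
  ext i
  simp [Finset.sum_apply, Pi.single_apply]

namespace IsParamHypersurface

variable {rbar : EReal} {h : ℝ → ℝ} {V : Set (EuclideanSpace ℝ (Fin m))}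
  {P N : EuclideanSpace ℝ (Fin m) → Amb n} {z : EuclideanSpace ℝ (Fin m)}

theorem near (hL : IsParamHypersurface rbar h V P N) (hz : z ∈ V) : IsSmoothNear rbar P z :=
  ⟨hL.smooth.contDiffAt (hL.isOpen.mem_nhds hz),
    Filter.eventually_of_mem (hL.isOpen.mem_nhds hz) hL.mem⟩

theorem eventually_mem (hL : IsParamHypersurface rbar h V P N) (hz : z ∈ V) :
    ∀ᶠ y in nhds z, y ∈ V := hL.isOpen.mem_nhds hz

theorem contDiffAt_normal (hL : IsParamHypersurface rbar h V P N) (hz : z ∈ V) :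
    ContDiffAt ℝ ∞ N z := hL.smooth_normal.contDiffAt (hL.isOpen.mem_nhds hz)

theorem contDiffAt_coordField (hL : IsParamHypersurface rbar h V P N) (hz : z ∈ V) (a : Fin m) :
    ContDiffAt ℝ ∞ (coordField P a) z := IsSmoothNear.contDiffAt_fderiv_apply (hL.near hz).smooth _

theorem coordField_mem_tangent (hL : IsParamHypersurface rbar h V P N) (hz : z ∈ V) (a : Fin m) :
    coordField P a z ∈ WarpedProduct.tangent (P z) := (hL.near hz).fderiv_mem_tangent _

theorem contDiffAt_gram (hL : IsParamHypersurface rbar h V P N) (hh : IsWarpingFunction n rbar h)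
    (hz : z ∈ V) (a b : Fin m) : ContDiffAt ℝ ∞ (fun y => gram h P y a b) z :=
  (hL.near hz).contDiffAt_metric hh (hL.contDiffAt_coordField hz a) (hL.contDiffAt_coordField hz b)

theorem contDiffAt_sff (hL : IsParamHypersurface rbar h V P N) (hh : IsWarpingFunction n rbar h)
    (hz : z ∈ V) (a b : Fin m) : ContDiffAt ℝ ∞ (fun y => sff rbar h P N y a b) z :=
  (hL.near hz).contDiffAt_metric hh ((hL.near hz).contDiffAt_cov hh (hL.contDiffAt_normal hz) _)
    (hL.contDiffAt_coordField hz b)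

theorem gram_mulVec (P : EuclideanSpace ℝ (Fin m) → Amb n) (x : Fin m → ℝ) (b : Fin m) :
    (gram h P z *ᵥ x) b = metric h (P z) (coordField P b z) (∑ a, x a • coordField P a z) := by
  rw [metric_sum_right]
  simp [Matrix.mulVec, dotProduct, gram, metric_smul_right, mul_comm]

theorem gram_isSymm (P : EuclideanSpace ℝ (Fin m) → Amb n) : (gram h P z)ᵀ = gram h P z := by
  ext a b
  simp [gram, metric_comm h (P z) (coordField P b z)]

theorem posDef_gram (hL : IsParamHypersurface rbar h V P N) (hh : IsWarpingFunction n rbar h)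
    (hz : z ∈ V) : (gram h P z).PosDef := by
  refine Matrix.PosDef.of_dotProduct_mulVec_pos ?_ fun x hx => ?_
  · rw [Matrix.IsHermitian, Matrix.conjTranspose_eq_transpose_of_trivial, gram_isSymm]
  · have h1 : star x ⬝ᵥ gram h P z *ᵥ x
        = metric h (P z) (∑ a, x a • coordField P a z) (∑ a, x a • coordField P a z) := by
      rw [metric_sum_left]
      simp only [dotProduct, gram_mulVec, metric_smul_left, star_trivial]
    rw [h1]
    refine metric_self_pos (hh.pos _ (hL.mem z hz).2) ?_
    rw [sum_smul_coordField]
    intro h0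
    have := hL.immersion z hz (h0.trans (map_zero _).symm)
    exact hx (by simpa using this)

theorem det_gram_pos (hL : IsParamHypersurface rbar h V P N) (hh : IsWarpingFunction n rbar h)
    (hz : z ∈ V) : 0 < (gram h P z).det := (hL.posDef_gram hh hz).det_pos

theorem inv_mul_gram (hL : IsParamHypersurface rbar h V P N) (hh : IsWarpingFunction n rbar h)
    (hz : z ∈ V) : (gram h P z)⁻¹ * gram h P z = 1 :=
  Matrix.nonsing_inv_mul _ (isUnit_iff_ne_zero.2 (hL.det_gram_pos hh hz).ne')

theorem gram_mul_inv (hL : IsParamHypersurface rbar h V P N) (hh : IsWarpingFunction n rbar h)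
    (hz : z ∈ V) : gram h P z * (gram h P z)⁻¹ = 1 :=
  Matrix.mul_nonsing_inv _ (isUnit_iff_ne_zero.2 (hL.det_gram_pos hh hz).ne')

theorem contDiffAt_gram_inv (hL : IsParamHypersurface rbar h V P N)
    (hh : IsWarpingFunction n rbar h) (hz : z ∈ V) (a b : Fin m) :
    ContDiffAt ℝ ∞ (fun y => (gram h P y)⁻¹ a b) z :=
  contDiffAt_inv (hL.contDiffAt_gram hh hz) (hL.det_gram_pos hh hz).ne' a b

theorem contDiffAt_shape (hL : IsParamHypersurface rbar h V P N)
    (hh : IsWarpingFunction n rbar h) (hz : z ∈ V) (a b : Fin m) :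
    ContDiffAt ℝ ∞ (fun y => shape rbar h P N y a b) z := by
  simp only [shape, Matrix.mul_apply]
  exact ContDiffAt.sum fun c _ =>
    (hL.contDiffAt_gram_inv hh hz a c).mul (hL.contDiffAt_sff hh hz c b)

theorem contDiffAt_confTan (hL : IsParamHypersurface rbar h V P N)
    (hh : IsWarpingFunction n rbar h) (hz : z ∈ V) (a : Fin m) :
    ContDiffAt ℝ ∞ (fun y => confTan h P y a) z := by
  simp only [confTan, Matrix.mulVec, dotProduct]
  exact ContDiffAt.sum fun c _ => (hL.contDiffAt_gram_inv hh hz a c).mul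
    (((hL.near hz).contDiffAt_warp hh).mul (hL.contDiffAt_coordField hz c).snd)

theorem normal_coordField (hL : IsParamHypersurface rbar h V P N) (hz : z ∈ V) (a : Fin m) :
    metric h (P z) (N z) (coordField P a z) = 0 := hL.normal z hz _

theorem coordField_normal (hL : IsParamHypersurface rbar h V P N) (hz : z ∈ V) (a : Fin m) :
    metric h (P z) (coordField P a z) (N z) = 0 := by
  rw [metric_comm]; exact hL.normal z hz _

/-- A tangent vector of `M` orthogonal to the hypersurface and its normal vanishes. -/
theorem eq_zero_of_orthogonal (hL : IsParamHypersurface rbar h V P N)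
    (hh : IsWarpingFunction n rbar h) (hz : z ∈ V) {u : Amb n}
    (hu : u ∈ WarpedProduct.tangent (P z)) (h1 : ∀ a, metric h (P z) u (coordField P a z) = 0)
    (h2 : metric h (P z) u (N z) = 0) : u = 0 := by
  -- A dimension count: `L` records the pairings with the coordinate fields, with `N` and with the
  -- sphere's position vector. Source and target both have dimension `n + 1 = m + 2`, so
  -- surjectivity gives injectivity.
  let L : Amb n →ₗ[ℝ] (Fin m → ℝ) × ℝ × ℝ :=
    (LinearMap.pi fun a => metricForm h (P z) (coordField P a z)).prod
      ((metricForm h (P z) (N z)).prod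
        ((innerSL ℝ (P z).1).toLinearMap ∘ₗ LinearMap.fst ℝ _ _))
  have hfin : Module.finrank ℝ (Amb n) = Module.finrank ℝ ((Fin m → ℝ) × ℝ × ℝ) := by
    simp [hL.dim]
  have hLu : L u = 0 := by
    ext
    · simp [L, metricForm_apply, metric_comm h (P z) _ u, h1]
    · simp [L, metricForm_apply, metric_comm h (P z) _ u, h2]
    · exact hu
  have hsurj : Function.Surjective L := by
    rintro ⟨c, s, t⟩
    -- The preimage has tangential coefficients `g⁻¹c`, normal component `s` and component `t` along
    -- the position vector; these three directions are mutually orthogonal for the ambient form.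
    refine ⟨∑ d, ((gram h P z)⁻¹ *ᵥ c) d • coordField P d z + s • N z
      + ((t • (P z).1, 0) : Amb n), ?_⟩
    have e1 : ∀ v ∈ WarpedProduct.tangent (P z), metric h (P z) v ((t • (P z).1, 0) : Amb n) = 0 := by
      intro v hv
      have : inner ℝ (P z).1 v.1 = (0 : ℝ) := hv
      simp [metric, real_inner_smul_right, real_inner_comm (P z).1 v.1, this]
    ext a
    · change metric h (P z) (coordField P a z) _ = c a
      rw [metric_add_right, metric_add_right, metric_smul_right, hL.coordField_normal hz,
        e1 _ (hL.coordField_mem_tangent hz a), ← gram_mulVec, Matrix.mulVec_mulVec,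
        hL.gram_mul_inv hh hz, Matrix.one_mulVec, mul_zero, add_zero, add_zero]
    · change metric h (P z) (N z) _ = s
      simp only [metric_add_right, metric_smul_right, hL.unit z hz, metric_sum_right,
        hL.normal_coordField hz, e1 _ (hL.tangent z hz)]
      simp
    · have t1 : ∀ a, inner ℝ (P z).1 (coordField P a z).1 = (0 : ℝ) :=
        hL.coordField_mem_tangent hz
      have t2 : inner ℝ (P z).1 (N z).1 = (0 : ℝ) := hL.tangent z hz
      simp [L, inner_add_right, inner_sum, real_inner_smul_right, t1, t2, Prod.fst_sum,
        (hL.mem z hz).1]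
  exact (LinearMap.injective_iff_surjective_of_finrank_eq_finrank hfin).2 hsurj
    (hLu.trans (map_zero L).symm)

/-- Decomposition of a tangent vector of `M` into its tangential and normal parts. -/
theorem eq_sum_coordField_add_normal (hL : IsParamHypersurface rbar h V P N)
    (hh : IsWarpingFunction n rbar h) (hz : z ∈ V) {u : Amb n}
    (hu : u ∈ WarpedProduct.tangent (P z)) :
    u = ∑ d, ((gram h P z)⁻¹ *ᵥ fun b => metric h (P z) u (coordField P b z)) d • coordField P d z
      + metric h (P z) u (N z) • N z := by
  rw [← sub_eq_zero]
  refine hL.eq_zero_of_orthogonal hh hz ?_ (fun a => ?_) ?_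
  · have t1 : ∀ a, inner ℝ (P z).1 (coordField P a z).1 = (0 : ℝ) :=
      hL.coordField_mem_tangent hz
    have t2 : inner ℝ (P z).1 (N z).1 = (0 : ℝ) := hL.tangent z hz
    have t3 : inner ℝ (P z).1 u.1 = (0 : ℝ) := hu
    simp [WarpedProduct.tangent, inner_sub_right, inner_add_right, inner_sum,
      real_inner_smul_right, t1, t2, t3, Prod.fst_sum]
  · rw [metric_sub_left, metric_add_left, metric_smul_left, hL.normal_coordField hz,
      metric_comm h (P z) (∑ d, _), ← gram_mulVec, Matrix.mulVec_mulVec, hL.gram_mul_inv hh hz,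
      Matrix.one_mulVec]
    ring
  · rw [metric_sub_left, metric_add_left, metric_smul_left, hL.unit z hz, metric_sum_left]
    simp [metric_smul_left, hL.coordField_normal hz]

theorem coordField_coeff_injective (hL : IsParamHypersurface rbar h V P N)
    (hz : z ∈ V) {x y : Fin m → ℝ}
    (hxy : ∑ d, x d • coordField P d z = ∑ d, y d • coordField P d z) : x = y := by
  rw [sum_smul_coordField, sum_smul_coordField] at hxy
  simpa using hL.immersion z hz hxy

/-- Differentiate `|N|² = 1`. -/
theorem metric_cov_normal (hL : IsParamHypersurface rbar h V P N)
    (hh : IsWarpingFunction n rbar h) (hz : z ∈ V) (v : EuclideanSpace ℝ (Fin m)) :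
    metric h (P z) (cov rbar h P N z v) (N z) = 0 := by
  have hd := (hL.contDiffAt_normal hz).differentiableAt (by simp : (∞ : WithTop ℕ∞) ≠ 0)
  have h1 := (hL.near hz).fderiv_metric hh hd hd (hL.tangent z hz) (hL.tangent z hz) v
  have h2 : (fun y => metric h (P y) (N y) (N y)) =ᶠ[nhds z] fun _ => 1 :=
    (hL.eventually_mem hz).mono fun y hy => hL.unit y hy
  rw [h2.fderiv_eq, metric_comm h (P z) (N z)] at h1
  simp at h1
  linarith

/-- Differentiate `⟨N, ∂_a⟩ = 0`; the derivative falls once on `N` and once on `∂_a`. -/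
theorem metric_cov_coordField_normal (hL : IsParamHypersurface rbar h V P N)
    (hh : IsWarpingFunction n rbar h) (hz : z ∈ V) (c a : Fin m) :
    metric h (P z) (cov rbar h P (coordField P a) z (EuclideanSpace.single c 1)) (N z)
      = -sff rbar h P N z c a := by
  have hd := (hL.contDiffAt_normal hz).differentiableAt (by simp : (∞ : WithTop ℕ∞) ≠ 0)
  have hd' := (hL.contDiffAt_coordField hz a).differentiableAt (by simp : (∞ : WithTop ℕ∞) ≠ 0)
  have h1 := (hL.near hz).fderiv_metric hh hd hd' (hL.tangent z hz)
    (hL.coordField_mem_tangent hz a) (EuclideanSpace.single c 1)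
  have h2 : (fun y => metric h (P y) (N y) (coordField P a y)) =ᶠ[nhds z] fun _ => 0 :=
    (hL.eventually_mem hz).mono fun y hy => hL.normal_coordField hy a
  rw [h2.fderiv_eq, metric_comm h (P z) (N z)] at h1
  simp only [fderiv_fun_const, Pi.zero_apply, _root_.zero_apply] at h1
  rw [sff_apply]
  linarith

theorem cov_coordField_comm (hL : IsParamHypersurface rbar h V P N) (hz : z ∈ V) (c a : Fin m) :
    cov rbar h P (coordField P a) z (EuclideanSpace.single c 1)
      = cov rbar h P (coordField P c) z (EuclideanSpace.single a 1) :=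
  (hL.near hz).cov_fderiv_comm _ _

/-- Both sides are minus the normal component of `D̄_{∂_a} ∂_b`, which is symmetric because the
connection is torsion free. -/
theorem sff_comm (hL : IsParamHypersurface rbar h V P N)
    (hh : IsWarpingFunction n rbar h) (hz : z ∈ V) (a b : Fin m) :
    sff rbar h P N z a b = sff rbar h P N z b a := by
  have h1 := hL.metric_cov_coordField_normal hh hz a b
  have h2 := hL.metric_cov_coordField_normal hh hz b a
  rw [hL.cov_coordField_comm hz] at h1
  linarith

theorem christoffel_comm (hL : IsParamHypersurface rbar h V P N) (hz : z ∈ V) (c d a : Fin m) :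
    christoffel rbar h P z c d a = christoffel rbar h P z a d c := by
  simp only [christoffel, Matrix.mul_apply, Matrix.of_apply, hL.cov_coordField_comm hz c a]

/-- The Weingarten equation. -/
theorem cov_normal (hL : IsParamHypersurface rbar h V P N)
    (hh : IsWarpingFunction n rbar h) (hz : z ∈ V) (a : Fin m) :
    cov rbar h P N z (EuclideanSpace.single a 1)
      = ∑ d, shape rbar h P N z d a • coordField P d z := by
  have h1 := hL.eq_sum_coordField_add_normal hh hz
    ((hL.near hz).cov_mem_tangent (h := h) (hL.tangent z hz) (EuclideanSpace.single a 1))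
  rw [hL.metric_cov_normal hh hz, zero_smul, add_zero] at h1
  rw [h1]
  refine Finset.sum_congr rfl fun d _ => ?_
  congr 1
  simp only [shape, Matrix.mul_apply, Matrix.mulVec, dotProduct]
  exact Finset.sum_congr rfl fun b _ => by rw [hL.sff_comm hh hz b a]; rfl

/-- The Gauss formula. -/
theorem cov_coordField (hL : IsParamHypersurface rbar h V P N)
    (hh : IsWarpingFunction n rbar h) (hz : z ∈ V) (c a : Fin m) :
    cov rbar h P (coordField P a) z (EuclideanSpace.single c 1)
      = ∑ d, christoffel rbar h P z c d a • coordField P d z - sff rbar h P N z c a • N z := by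
  have h1 := hL.eq_sum_coordField_add_normal hh hz
    ((hL.near hz).cov_mem_tangent (h := h) (hL.coordField_mem_tangent hz a)
      (EuclideanSpace.single c 1))
  rw [hL.metric_cov_coordField_normal hh hz, neg_smul, ← sub_eq_add_neg] at h1
  rw [h1]
  rfl

/-- The Codazzi equation. -/
theorem codazzi (hL : IsParamHypersurface rbar h V P N)
    (hh : IsWarpingFunction n rbar h) (hz : z ∈ V) (c a d : Fin m) :
    covShape rbar h P N z c d a = covShape rbar h P N z a d c
      + (-(warpDD rbar h (P z).2 / h (P z).2
          + (1 - warpD rbar h (P z).2 ^ 2) / h (P z).2 ^ 2) * (N z).2) *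
        ((coordField P a z).2 * (1 : Matrix (Fin m) (Fin m) ℝ) d c
          - (coordField P c z).2 * (1 : Matrix (Fin m) (Fin m) ℝ) d a) := by
  -- Differentiate the Weingarten equation and insert the Gauss formula. The tangential part is `∂_c
  -- W + Γ_c W`; the remaining term `-W Γ_c` of the covariant derivative is symmetric in the two
  -- directions and is restored at the end.
  have key : ∀ a c : Fin m, cov rbar h P
      (fun y => cov rbar h P N y (EuclideanSpace.single a 1)) z (EuclideanSpace.single c 1)
      = ∑ d, (fderiv ℝ (fun y => shape rbar h P N y d a) z (EuclideanSpace.single c 1)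
          + (christoffel rbar h P z c * shape rbar h P N z) d a) • coordField P d z
        - (∑ d, shape rbar h P N z d a * sff rbar h P N z c d) • N z := by
    intro a c
    have he : (fun y => cov rbar h P N y (EuclideanSpace.single a 1)) =ᶠ[nhds z]
        fun y => ∑ d, shape rbar h P N y d a • coordField P d y :=
      (hL.eventually_mem hz).mono fun y hy => hL.cov_normal hh hy a
    rw [cov_congr rbar h P he, cov_sum_smul rbar h P _
      (fun d => (hL.contDiffAt_shape hh hz d a).differentiableAt (by simp))
      (fun d => (hL.contDiffAt_coordField hz d).differentiableAt (by simp))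
      (hL.coordField_mem_tangent hz)]
    simp only [hL.cov_coordField hh hz, smul_sub, Finset.smul_sum, Finset.sum_add_distrib,
      Finset.sum_sub_distrib, add_smul, Finset.sum_smul, Matrix.mul_apply, smul_smul]
    rw [add_sub_assoc]
    congr 2
    rw [Finset.sum_comm]
    exact Finset.sum_congr rfl fun _ _ => Finset.sum_congr rfl fun _ _ => by rw [mul_comm]
  have hcomm := (hL.near hz).cov_cov_sub_cov_cov hh (hL.contDiffAt_normal hz)
    ((hL.eventually_mem hz).mono hL.tangent) (EuclideanSpace.single a 1) (EuclideanSpace.single c 1)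
    (hL.normal z hz _) (hL.normal z hz _)
  rw [key a c, key c a] at hcomm
  -- The normal components are the entries of the symmetric matrix `A g⁻¹ A`, with `A` the second
  -- fundamental form, so they cancel in the commutator.
  have hsymm : ∑ d, shape rbar h P N z d a * sff rbar h P N z c d
      = ∑ d, shape rbar h P N z d c * sff rbar h P N z a d := by
    have h1 : ∀ a c, ∑ d, shape rbar h P N z d a * sff rbar h P N z c d
        = (sff rbar h P N z * (gram h P z)⁻¹ * sff rbar h P N z) c a := by
      intro a c
      rw [mul_assoc]
      simp only [Matrix.mul_apply, shape]
      exact Finset.sum_congr rfl fun _ _ => mul_comm _ _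
    rw [h1, h1]
    have hs : (sff rbar h P N z)ᵀ = sff rbar h P N z := by
      ext i j; exact hL.sff_comm hh hz j i
    rw [← Matrix.transpose_apply (sff rbar h P N z * (gram h P z)⁻¹ * sff rbar h P N z) a c]
    simp only [Matrix.transpose_mul, hs, Matrix.transpose_nonsing_inv, gram_isSymm, mul_assoc]
  rw [hsymm, sub_sub_sub_cancel_right, ← Finset.sum_sub_distrib] at hcomm
  simp only [← sub_smul] at hcomm
  set κ := (-(warpDD rbar h (P z).2 / h (P z).2
          + (1 - warpD rbar h (P z).2 ^ 2) / h (P z).2 ^ 2) * (N z).2) with hκ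
  have hr : κ • ((fderiv ℝ P z (EuclideanSpace.single a 1)).2
        • fderiv ℝ P z (EuclideanSpace.single c 1)
      - (fderiv ℝ P z (EuclideanSpace.single c 1)).2 • fderiv ℝ P z (EuclideanSpace.single a 1))
      = ∑ d, (κ * ((coordField P a z).2 * (1 : Matrix (Fin m) (Fin m) ℝ) d c
          - (coordField P c z).2 * (1 : Matrix (Fin m) (Fin m) ℝ) d a)) • coordField P d z := by
    simp only [← smul_smul, ← Finset.smul_sum, sub_smul, Finset.sum_sub_distrib, Matrix.one_apply,
      ite_smul, one_smul, zero_smul]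
    simp
    rfl
  rw [hr] at hcomm
  have hfin := congrFun (hL.coordField_coeff_injective hz hcomm) d
  -- Symmetry of the Christoffel symbols in the lower indices: the correction term is the same on
  -- both sides, so partial derivatives can be replaced by covariant ones.
  have hΓ : (shape rbar h P N z * christoffel rbar h P z c) d a
      = (shape rbar h P N z * christoffel rbar h P z a) d c := by
    simp only [Matrix.mul_apply, hL.christoffel_comm hz c _ a]
  rw [covShape_apply, covShape_apply, hΓ]
  linarith

end IsParamHypersurface

end Coordinates

/-! ### The divergence of the Newton transformation applied to the tangential conformal field -/

section Divergence

open scoped Matrix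

variable {m n : ℕ}

/-- `X` is a closed conformal field: differentiating the factor `h` gives `h' dr(v)` radially, and
the warping term `(h'/h) X_r v₁` gives `h' v₁` along the sphere. -/
theorem fderiv_confField (rbar : EReal) (h : ℝ → ℝ) {E : Type*} [NormedAddCommGroup E]
    [NormedSpace ℝ E] {P : E → Amb n} {z : E} (hP : IsSmoothNear rbar P z)
    (hh : IsWarpingFunction n rbar h) (v : E) :
    DifferentiableAt ℝ (fun y => confField h (P y)) z ∧
    cov rbar h P (fun y => confField h (P y)) z v = warpD rbar h (P z).2 • fderiv ℝ P z v := by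
  have h0 : h (P z).2 ≠ 0 := (hh.pos _ hP.mem_self.2).ne'
  have h1 := (hP.hasFDerivAt_warp hh).smul_const (radial n)
  refine ⟨h1.differentiableAt, ?_⟩
  have h2 : fderiv ℝ (fun y => confField h (P y)) z v
      = (warpD rbar h (P z).2 * (fderiv ℝ P z v).2) • radial n := by
    have : fderiv ℝ (fun y => confField h (P y)) z = _ := h1.fderiv
    rw [this]
    simp
  unfold cov
  rw [h2]
  ext1
  · simp [confField, radial, smul_smul, h0]
  · simp [confField, radial]

namespace IsParamHypersurface

variable {rbar : EReal} {h : ℝ → ℝ} {V : Set (EuclideanSpace ℝ (Fin m))}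
  {P N : EuclideanSpace ℝ (Fin m) → Amb n} {z : EuclideanSpace ℝ (Fin m)}

theorem gram_mul_christoffel (hL : IsParamHypersurface rbar h V P N)
    (hh : IsWarpingFunction n rbar h) (hz : z ∈ V) (c b a : Fin m) :
    (gram h P z * christoffel rbar h P z c) b a = metric h (P z)
      (cov rbar h P (coordField P a) z (EuclideanSpace.single c 1)) (coordField P b z) := by
  rw [christoffel, ← mul_assoc, hL.gram_mul_inv hh hz, one_mul]
  rfl

/-- Metric compatibility of the ambient connection. Only the tangential parts of `D̄_c ∂_a` meet
coordinate fields, and these are the Christoffel symbols. -/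
theorem fderiv_gram (hL : IsParamHypersurface rbar h V P N)
    (hh : IsWarpingFunction n rbar h) (hz : z ∈ V) (c : Fin m) :
    (Matrix.of fun a b => fderiv ℝ (fun y => gram h P y a b) z (EuclideanSpace.single c 1))
      = (christoffel rbar h P z c)ᵀ * gram h P z + gram h P z * christoffel rbar h P z c := by
  ext a b
  have h1 : (christoffel rbar h P z c)ᵀ * gram h P z
      = (gram h P z * christoffel rbar h P z c)ᵀ := by
    rw [Matrix.transpose_mul, gram_isSymm]
  rw [h1, Matrix.add_apply, Matrix.transpose_apply, hL.gram_mul_christoffel hh hz,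
    hL.gram_mul_christoffel hh hz, Matrix.of_apply]
  have h2 := (hL.near hz).fderiv_metric hh
    ((hL.contDiffAt_coordField hz a).differentiableAt (by simp))
    ((hL.contDiffAt_coordField hz b).differentiableAt (by simp))
    (hL.coordField_mem_tangent hz a) (hL.coordField_mem_tangent hz b) (EuclideanSpace.single c 1)
  rw [metric_comm h (P z) (coordField P a z)] at h2
  exact h2

theorem contDiffAt_sqrt_det (hL : IsParamHypersurface rbar h V P N)
    (hh : IsWarpingFunction n rbar h) (hz : z ∈ V) :
    ContDiffAt ℝ ∞ (fun y => √(gram h P y).det) z :=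
  (contDiffAt_det (hL.contDiffAt_gram hh hz)).sqrt (hL.det_gram_pos hh hz).ne'

/-- Jacobi's formula: by cyclicity the two terms of `∂_c g` contribute equally to the trace against
`adj g`, which cancels the `1/2` coming from the square root. -/
theorem fderiv_sqrt_det (hL : IsParamHypersurface rbar h V P N)
    (hh : IsWarpingFunction n rbar h) (hz : z ∈ V) (c : Fin m) :
    fderiv ℝ (fun y => √(gram h P y).det) z (EuclideanSpace.single c 1)
      = √(gram h P z).det * (christoffel rbar h P z c).trace := by
  have hg := fun i j => (hL.contDiffAt_gram hh hz i j).differentiableAt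
    (by simp : (∞ : WithTop ℕ∞) ≠ 0)
  have hd := (contDiffAt_det (hL.contDiffAt_gram hh hz)).differentiableAt
    (by simp : (∞ : WithTop ℕ∞) ≠ 0)
  have hpos := hL.det_gram_pos hh hz
  rw [fderiv_sqrt hd hpos.ne', _root_.smul_apply, fderiv_det hg, hL.fderiv_gram hh hz, mul_add,
    Matrix.trace_add, ← mul_assoc, ← mul_assoc, Matrix.trace_mul_comm, ← mul_assoc,
    Matrix.mul_adjugate, Matrix.adjugate_mul]
  simp only [Matrix.smul_mul, one_mul, Matrix.trace_smul, Matrix.trace_transpose, smul_eq_mul]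
  have hs : √(gram h P z).det ≠ 0 := (Real.sqrt_pos.2 hpos).ne'
  field_simp
  rw [Real.sq_sqrt hpos.le]
  ring

theorem coeff_eq_of_sum_add_normal (hL : IsParamHypersurface rbar h V P N) (hz : z ∈ V)
    {x y : Fin m → ℝ} {s : ℝ}
    (hxy : ∑ d, x d • coordField P d z + s • N z = ∑ d, y d • coordField P d z) : x = y := by
  have h1 := congrArg (fun u => metric h (P z) u (N z)) hxy
  simp only [metric_add_left, metric_sum_left, metric_smul_left, hL.unit z hz,
    hL.coordField_normal hz, mul_zero, Finset.sum_const_zero, zero_add, mul_one] at h1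
  rw [h1, zero_smul, add_zero] at hxy
  exact hL.coordField_coeff_injective hz hxy

theorem metric_confField (q w : Amb n) : metric h q (confField h q) w = h q.2 * w.2 := by
  simp [metric, confField, radial]

theorem confField_eq (hL : IsParamHypersurface rbar h V P N)
    (hh : IsWarpingFunction n rbar h) (hz : z ∈ V) :
    confField h (P z) = ∑ d, confTan h P z d • coordField P d z
      + metric h (P z) (confField h (P z)) (N z) • N z := by
  have h1 := hL.eq_sum_coordField_add_normal hh hz (u := confField h (P z))
    (by simp [WarpedProduct.tangent, confField, radial])
  simp only [metric_confField] at h1 ⊢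
  exact h1

theorem contDiffAt_support (hL : IsParamHypersurface rbar h V P N)
    (hh : IsWarpingFunction n rbar h) (hz : z ∈ V) :
    ContDiffAt ℝ ∞ (fun y => metric h (P y) (confField h (P y)) (N y)) z := by
  simp only [metric_confField]
  exact ((hL.near hz).contDiffAt_warp hh).mul (hL.contDiffAt_normal hz).snd

/-- The covariant derivative of the tangential part of the conformal field. -/
theorem fderiv_confTan (hL : IsParamHypersurface rbar h V P N)
    (hh : IsWarpingFunction n rbar h) (hz : z ∈ V) (a b : Fin m) :
    fderiv ℝ (fun y => confTan h P y b) z (EuclideanSpace.single a 1)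
      = warpD rbar h (P z).2 * (1 : Matrix (Fin m) (Fin m) ℝ) b a
        - (christoffel rbar h P z a *ᵥ confTan h P z) b
        - metric h (P z) (confField h (P z)) (N z) * shape rbar h P N z b a := by
  have he : (fun y => confField h (P y)) =ᶠ[nhds z] fun y =>
      ∑ d, confTan h P y d • coordField P d y
      + metric h (P y) (confField h (P y)) (N y) • N y :=
    (hL.eventually_mem hz).mono fun y hy => hL.confField_eq hh hy
  have hZ := fun d => (hL.contDiffAt_confTan hh hz d).differentiableAt
    (by simp : (∞ : WithTop ℕ∞) ≠ 0)
  have hC := fun d => (hL.contDiffAt_coordField hz d).differentiableAt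
    (by simp : (∞ : WithTop ℕ∞) ≠ 0)
  have hS := (hL.contDiffAt_support hh hz).differentiableAt (by simp : (∞ : WithTop ℕ∞) ≠ 0)
  have hN := (hL.contDiffAt_normal hz).differentiableAt (by simp : (∞ : WithTop ℕ∞) ≠ 0)
  have h1 := (fderiv_confField rbar h (hL.near hz) hh (EuclideanSpace.single a 1)).2
  rw [cov_congr rbar h P he, cov_add rbar h P
    (DifferentiableAt.fun_sum fun d _ => (hZ d).fun_smul (hC d)) (hS.fun_smul hN),
    cov_sum_smul rbar h P _ hZ hC (hL.coordField_mem_tangent hz),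
    cov_smul rbar h P hS hN rfl (hL.tangent z hz), hL.cov_normal hh hz] at h1
  simp only [hL.cov_coordField hh hz] at h1
  -- The identity `D̄_a X = f ∂_a`, with `X` split into tangential and normal parts and sorted by
  -- coordinate fields and `N`; the tangential coefficients give the claim.
  have h2 : ∑ d, (fderiv ℝ (fun y => confTan h P y d) z (EuclideanSpace.single a 1)
        + (christoffel rbar h P z a *ᵥ confTan h P z) d
        + metric h (P z) (confField h (P z)) (N z) * shape rbar h P N z d a) • coordField P d z
      + (fderiv ℝ (fun y => metric h (P y) (confField h (P y)) (N y)) z (EuclideanSpace.single a 1)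
        - ∑ d, confTan h P z d * sff rbar h P N z a d) • N z
      = ∑ d, (warpD rbar h (P z).2 * (1 : Matrix (Fin m) (Fin m) ℝ) d a) • coordField P d z := by
    have h3 : ∑ d, (warpD rbar h (P z).2 * (1 : Matrix (Fin m) (Fin m) ℝ) d a) • coordField P d z
        = warpD rbar h (P z).2 • fderiv ℝ P z (EuclideanSpace.single a 1) := by
      simp [Matrix.one_apply, ite_smul]
      rfl
    rw [h3, ← h1]
    have h4 : ∑ d, (christoffel rbar h P z a *ᵥ confTan h P z) d • coordField P d z
        = ∑ d, confTan h P z d • ∑ k, christoffel rbar h P z a k d • coordField P k z := by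
      simp only [Matrix.mulVec, dotProduct, Finset.sum_smul, Finset.smul_sum, smul_smul]
      rw [Finset.sum_comm]
      exact Finset.sum_congr rfl fun _ _ => Finset.sum_congr rfl fun _ _ => by rw [mul_comm]
    simp only [add_smul, Finset.sum_add_distrib, h4, sub_smul, smul_sub, Finset.sum_sub_distrib,
      Finset.sum_smul, Finset.smul_sum, smul_smul]
    abel
  have h5 := congrFun (hL.coeff_eq_of_sum_add_normal hz h2) b
  linarith

/-- The components of the Newton transformation applied to the tangential part of the conformal
field. -/
theorem contDiffAt_newton_confTan (hL : IsParamHypersurface rbar h V P N)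
    (hh : IsWarpingFunction n rbar h) (hz : z ∈ V) (q : ℕ) (a : Fin m) :
    ContDiffAt ℝ ∞ (fun y => (newton (shape rbar h P N y) q *ᵥ confTan h P y) a) z := by
  simp only [Matrix.mulVec, dotProduct]
  exact ContDiffAt.sum fun b _ => (contDiffAt_newton q (hL.contDiffAt_shape hh hz) a b).mul
    (hL.contDiffAt_confTan hh hz b)

/-- The divergence of the Newton transformation, paired with the conformal field. -/
def newtonDiv (rbar : EReal) (h : ℝ → ℝ) (P N : EuclideanSpace ℝ (Fin m) → Amb n) (q : ℕ)
    (z : EuclideanSpace ℝ (Fin m)) : ℝ :=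
  ∑ b, (∑ a, dNewton (shape rbar h P N z) (covShape rbar h P N z a) q a b) * confTan h P z b

/-- The product rule for `√g · T_q Xᵀ`. The derivative of `T_q` gives its divergence, and `D Xᵀ = f
· 1 - ⟨X, N⟩ W` contributes the traces `tr T_q` and `tr (T_q W)`. All Christoffel terms cancel, as
they must for a divergence. -/
theorem divergence_newton_confTan (hL : IsParamHypersurface rbar h V P N)
    (hh : IsWarpingFunction n rbar h) (hz : z ∈ V) (q : ℕ) :
    ∑ a, fderiv ℝ (fun y => √(gram h P y).det *
        (newton (shape rbar h P N y) q *ᵥ confTan h P y) a) z (EuclideanSpace.single a 1)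
      = √(gram h P z).det * (newtonDiv rbar h P N q z
        + ((m : ℝ) - q) * (warpD rbar h (P z).2 * sigma q (shape rbar h P N z))
        - (q + 1) * (metric h (P z) (confField h (P z)) (N z)
            * sigma (q + 1) (shape rbar h P N z))) := by
  have hD := (hL.contDiffAt_sqrt_det hh hz).differentiableAt (by simp : (∞ : WithTop ℕ∞) ≠ 0)
  have hW := fun i j => (hL.contDiffAt_shape hh hz i j).differentiableAt
    (by simp : (∞ : WithTop ℕ∞) ≠ 0)
  have hZ := fun d => (hL.contDiffAt_confTan hh hz d).differentiableAt
    (by simp : (∞ : WithTop ℕ∞) ≠ 0)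
  have hY := fun a => (hL.contDiffAt_newton_confTan hh hz q a).differentiableAt
    (by simp : (∞ : WithTop ℕ∞) ≠ 0)
  set W := shape rbar h P N z with hWdef
  set Z := confTan h P z with hZdef
  set f := warpD rbar h (P z).2
  set φ := metric h (P z) (confField h (P z)) (N z)
  set Γ := christoffel rbar h P z with hΓ
  have h1 : ∀ a, fderiv ℝ (fun y => √(gram h P y).det *
        (newton (shape rbar h P N y) q *ᵥ confTan h P y) a) z (EuclideanSpace.single a 1)
      = √(gram h P z).det * ((Γ a).trace * (newton W q *ᵥ Z) a
        + fderiv ℝ (fun y => (newton (shape rbar h P N y) q *ᵥ confTan h P y) a) z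
          (EuclideanSpace.single a 1)) := by
    intro a
    rw [fderiv_fun_mul hD (hY a), _root_.add_apply, _root_.smul_apply, _root_.smul_apply,
      hL.fderiv_sqrt_det hh hz, smul_eq_mul, smul_eq_mul]
    ring
  have h2 : ∀ a, fderiv ℝ (fun y => (newton (shape rbar h P N y) q *ᵥ confTan h P y) a) z
          (EuclideanSpace.single a 1)
      = ∑ b, (dNewton W (covShape rbar h P N z a) q a b) * Z b
        - (Γ a *ᵥ (newton W q *ᵥ Z)) a + f * newton W q a a - φ * (newton W q * W) a a := by
    intro a
    -- The partial and covariant derivatives of `W` differ by the commutator with `Γ_a`, hence those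
    -- of `T_q` differ by the commutator of `Γ_a` with `T_q`.
    have e1 : dNewton W (Matrix.of fun i j => fderiv ℝ (fun y => shape rbar h P N y i j) z
        (EuclideanSpace.single a 1)) q
        = dNewton W (covShape rbar h P N z a) q - (Γ a * newton W q - newton W q * Γ a) := by
      rw [← dNewton_commutator, eq_sub_iff_add_eq, ← dNewton_add]
      rfl
    simp only [Matrix.mulVec, dotProduct]
    rw [fderiv_fun_sum fun b _ => ((hasFDerivAt_newton q hW a b).1.fun_mul (hZ b)),
      _root_.sum_apply]
    have e2 : ∀ b, fderiv ℝ (fun y => newton (shape rbar h P N y) q a b * confTan h P y b) z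
        (EuclideanSpace.single a 1)
        = (dNewton W (covShape rbar h P N z a) q a b) * Z b - (Γ a * newton W q) a b * Z b
          + (newton W q * Γ a) a b * Z b - newton W q a b * (Γ a *ᵥ Z) b
          + f * (newton W q a b * (1 : Matrix (Fin m) (Fin m) ℝ) b a)
          - φ * (newton W q a b * W b a) := by
      intro b
      rw [fderiv_fun_mul (hasFDerivAt_newton q hW a b).1 (hZ b), _root_.add_apply,
        _root_.smul_apply, _root_.smul_apply, (hasFDerivAt_newton q hW a b).2,
        hL.fderiv_confTan hh hz, ← hWdef, e1, Matrix.sub_apply, Matrix.sub_apply, smul_eq_mul,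
        smul_eq_mul]
      ring
    simp only [e2, Finset.sum_add_distrib, Finset.sum_sub_distrib, ← Finset.mul_sum]
    have e3 : ∑ b, (newton W q * Γ a) a b * Z b = ∑ b, newton W q a b * (Γ a *ᵥ Z) b := by
      change ((newton W q * Γ a) *ᵥ Z) a = (newton W q *ᵥ (Γ a *ᵥ Z)) a
      rw [Matrix.mulVec_mulVec]
    have e4 : ∑ b, (Γ a * newton W q) a b * Z b = ∑ x, Γ a a x * ∑ b, newton W q x b * Z b := by
      change ((Γ a * newton W q) *ᵥ Z) a = (Γ a *ᵥ (newton W q *ᵥ Z)) a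
      rw [Matrix.mulVec_mulVec]
    have e5 : ∑ b, newton W q a b * (1 : Matrix (Fin m) (Fin m) ℝ) b a = newton W q a a := by
      rw [← Matrix.mul_apply, mul_one]
    rw [e3, e4, e5, Matrix.mul_apply]
    ring
  simp only [h1, h2, ← Finset.mul_sum]
  congr 1
  simp only [Finset.sum_add_distrib, Finset.sum_sub_distrib, ← Finset.mul_sum]
  -- The Christoffel terms left over from the covariant derivatives contract to those produced by
  -- `√g`; lower-index symmetry identifies the two.
  have h3 : ∑ a, (Γ a *ᵥ (newton W q *ᵥ Z)) a = ∑ a, (Γ a).trace * (newton W q *ᵥ Z) a := by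
    generalize newton W q *ᵥ Z = Y
    simp only [Matrix.mulVec, dotProduct, Matrix.trace, Matrix.diag, Finset.sum_mul]
    rw [Finset.sum_comm]
    refine Finset.sum_congr rfl fun c _ => Finset.sum_congr rfl fun a _ => ?_
    rw [hΓ, hL.christoffel_comm hz a a c]
  have h4 : ∑ a, newton W q a a = ((m : ℝ) - q) * sigma q W := trace_newton W q
  have h5 : ∑ a, (newton W q * W) a a = (q + 1) * sigma (q + 1) W := trace_newton_mul_self W q
  have h6 : ∑ a, ∑ b, dNewton W (covShape rbar h P N z a) q a b * Z b
      = newtonDiv rbar h P N q z := by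
    rw [newtonDiv, Finset.sum_comm]
    exact Finset.sum_congr rfl fun b _ => (Finset.sum_mul _ _ _).symm
  rw [h3, h4, h5, h6]
  ring

/-- For `q = 0` the tensor is the identity, which is parallel. For larger `q` the Codazzi recursion
turns the divergence into a curvature factor times `⟨∂_r, N⟩`, a dimension factor, `h`, and the
quadratic form of the preceding Newton transformation at `∇r`. -/
theorem newtonDiv_nonneg (hL : IsParamHypersurface rbar h V P N)
    (hh : IsWarpingFunction n rbar h) (hz : z ∈ V) (hstar : 0 ≤ (N z).2)
    (hconv : (sff rbar h P N z).PosSemidef) {q : ℕ} (hq : q ≤ m) :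
    0 ≤ newtonDiv rbar h P N q z := by
  cases q with
  | zero => simp [newtonDiv, dNewton]
  | succ q =>
    have hr := (hL.mem z hz).2
    have hcurv := hh.curvature_pos hr
    have hpos := hh.pos _ hr
    have h1 := sum_dNewton_of_codazzi (A := shape rbar h P N z) (hL.codazzi hh hz) q
    have h2 := newton_inv_mul_nonneg (hL.posDef_gram hh hz) hconv q fun a => (coordField P a z).2
    have h3 : newtonDiv rbar h P N (q + 1) z
        = (warpDD rbar h (P z).2 / h (P z).2
          + (1 - warpD rbar h (P z).2 ^ 2) / h (P z).2 ^ 2) * (N z).2 * ((m : ℝ) - (q + 1))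
          * h (P z).2 * ((fun a => (coordField P a z).2) ⬝ᵥ
            newton ((gram h P z)⁻¹ * sff rbar h P N z) q *ᵥ
              ((gram h P z)⁻¹ *ᵥ fun a => (coordField P a z).2)) := by
      have h4 : confTan h P z
          = h (P z).2 • ((gram h P z)⁻¹ *ᵥ fun a => (coordField P a z).2) := by
        rw [← Matrix.mulVec_smul]
        rfl
      simp only [newtonDiv, h1, h4, Pi.smul_apply, smul_eq_mul]
      rw [Matrix.dotProduct_mulVec]
      simp only [dotProduct, Matrix.vecMul, Finset.mul_sum, Finset.sum_mul, shape]
      refine Finset.sum_congr rfl fun b _ => Finset.sum_congr rfl fun a _ => ?_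
      ring
    rw [h3]
    -- The only use of the bound on the order; at `q + 1 = m` the dimension factor vanishes.
    have h5 : (0 : ℝ) ≤ (m : ℝ) - (q + 1) := by
      have : ((q + 1 : ℕ) : ℝ) ≤ m := by exact_mod_cast hq
      push_cast at this
      linarith
    exact mul_nonneg (mul_nonneg (mul_nonneg (mul_nonneg hcurv.le hstar) h5) hpos.le) h2

end IsParamHypersurface

end Divergence

/-! ### Comparing intrinsic quantities on the manifold with their chart expressions -/

section Transfer

open scoped Matrix

variable {n : ℕ} {S : Type*} [TopologicalSpace S]
  [ChartedSpace (EuclideanSpace ℝ (Fin (n - 1))) S]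

/-- The expression of a map in the chart at `x₀`. -/
def inChart {B : Type*} (x₀ : S) (G : S → B) : EuclideanSpace ℝ (Fin (n - 1)) → B :=
  G ∘ (extChartAt (𝓡 (n - 1)) x₀).symm

/-- The differential of the inverse chart. -/
def chartVec (x₀ : S) (z : EuclideanSpace ℝ (Fin (n - 1))) :
    EuclideanSpace ℝ (Fin (n - 1)) →L[ℝ]
      TangentSpace (𝓡 (n - 1)) ((extChartAt (𝓡 (n - 1)) x₀).symm z) :=
  mfderivWithin 𝓘(ℝ, EuclideanSpace ℝ (Fin (n - 1))) (𝓡 (n - 1))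
    (extChartAt (𝓡 (n - 1)) x₀).symm (range (𝓡 (n - 1))) z

/-- The matrix of the differential of the inverse chart, with respect to the standard bases. -/
def chartJac (x₀ : S) (z : EuclideanSpace ℝ (Fin (n - 1))) :
    Matrix (Fin (n - 1)) (Fin (n - 1)) ℝ :=
  Matrix.of fun b a => (show EuclideanSpace ℝ (Fin (n - 1)) from
    chartVec x₀ z (EuclideanSpace.single a 1)) b

theorem euclidean_eq_sum {m : ℕ} (v : EuclideanSpace ℝ (Fin m)) :
    v = ∑ b, v b • EuclideanSpace.single b (1 : ℝ) := by
  ext i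
  simp [Finset.sum_apply, Pi.single_apply]

theorem stdVec_eq_sum (x : S) (a : Fin (n - 1)) :
    stdVec x a = ∑ b, (Pi.single a 1 : Fin (n - 1) → ℝ) b • stdVec x b := by
  rw [Finset.sum_eq_single a (fun b _ hb => by rw [Pi.single_eq_of_ne hb, zero_smul]) (by simp),
    Pi.single_eq_same, one_smul]

theorem chartVec_eq_sum (x₀ : S) (z : EuclideanSpace ℝ (Fin (n - 1)))
    (v : EuclideanSpace ℝ (Fin (n - 1))) :
    chartVec x₀ z v = ∑ b, (chartJac x₀ z *ᵥ v.ofLp) b •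
      stdVec ((extChartAt (𝓡 (n - 1)) x₀).symm z) b := by
  have h1 : ∀ u : TangentSpace (𝓡 (n - 1)) ((extChartAt (𝓡 (n - 1)) x₀).symm z),
      u = ∑ b, (show EuclideanSpace ℝ (Fin (n - 1)) from u) b •
        stdVec ((extChartAt (𝓡 (n - 1)) x₀).symm z) b := fun u => euclidean_eq_sum _
  conv_lhs => rw [euclidean_eq_sum v]
  simp only [map_sum, map_smul]
  conv_lhs =>
    enter [2, a]
    rw [h1 (chartVec x₀ z (EuclideanSpace.single a 1))]
  simp only [Finset.smul_sum, smul_smul]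
  rw [Finset.sum_comm]
  refine Finset.sum_congr rfl fun b _ => ?_
  rw [← Finset.sum_smul]
  congr 1
  simp only [Matrix.mulVec, dotProduct]
  exact Finset.sum_congr rfl fun a _ => mul_comm _ _

theorem mvfderiv_eq_fderiv {V B : Type*} [NormedAddCommGroup V] [NormedSpace ℝ V]
    [NormedAddCommGroup B] [NormedSpace ℝ B] (G : V → B) (x v : V) :
    mvfderiv 𝓘(ℝ, V) G x v = fderiv ℝ G x v := by
  simp [mvfderiv, mfderiv_eq_fderiv]
  rfl

variable [IsManifold (𝓡 (n - 1)) ∞ S]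

theorem chartVec_bijective (x₀ : S) {z : EuclideanSpace ℝ (Fin (n - 1))}
    (hz : z ∈ (extChartAt (𝓡 (n - 1)) x₀).target) : Function.Bijective (chartVec x₀ z) := by
  have : IsManifold (𝓡 (n - 1)) 1 S := IsManifold.of_le (n := ∞) (by norm_cast)
  exact (isInvertible_mfderivWithin_extChartAt_symm hz).bijective

theorem mvfderiv_chartVec {B : Type*} [NormedAddCommGroup B] [NormedSpace ℝ B] {G : S → B}
    (x₀ : S) {z : EuclideanSpace ℝ (Fin (n - 1))}
    (hz : z ∈ (extChartAt (𝓡 (n - 1)) x₀).target)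
    (hG : MDifferentiableAt (𝓡 (n - 1)) 𝓘(ℝ, B) G ((extChartAt (𝓡 (n - 1)) x₀).symm z))
    (v : EuclideanSpace ℝ (Fin (n - 1))) :
    mvfderiv (𝓡 (n - 1)) G ((extChartAt (𝓡 (n - 1)) x₀).symm z) (chartVec x₀ z v)
      = fderiv ℝ (inChart x₀ G) z v := by
  have : IsManifold (𝓡 (n - 1)) 1 S := IsManifold.of_le (n := ∞) (by norm_cast)
  have h1 := mdifferentiableWithinAt_extChartAt_symm hz
  have hr : range (𝓡 (n - 1)) = univ := by simp
  have h2 : MDifferentiableAt 𝓘(ℝ, EuclideanSpace ℝ (Fin (n - 1))) (𝓡 (n - 1))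
      (extChartAt (𝓡 (n - 1)) x₀).symm z := by
    rw [hr, mdifferentiableWithinAt_univ] at h1; exact h1
  have h3 := mfderiv_comp z hG h2
  rw [← mvfderiv_eq_fderiv]
  unfold mvfderiv chartVec inChart
  rw [hr, mfderivWithin_univ]
  rw [h3]
  rfl

theorem covDeriv_chartVec {rbar : EReal} {h : ℝ → ℝ} {F W : S → Amb n}
    (x₀ : S) {z : EuclideanSpace ℝ (Fin (n - 1))}
    (hz : z ∈ (extChartAt (𝓡 (n - 1)) x₀).target)
    (hF : MDifferentiableAt (𝓡 (n - 1)) 𝓘(ℝ, Amb n) F ((extChartAt (𝓡 (n - 1)) x₀).symm z))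
    (hW : MDifferentiableAt (𝓡 (n - 1)) 𝓘(ℝ, Amb n) W ((extChartAt (𝓡 (n - 1)) x₀).symm z))
    (v : EuclideanSpace ℝ (Fin (n - 1))) :
    covDeriv (𝓡 (n - 1)) rbar h F W ((extChartAt (𝓡 (n - 1)) x₀).symm z) (chartVec x₀ z v)
      = cov rbar h (inChart x₀ F) (inChart x₀ W) z v := by
  unfold covDeriv cov
  simp only [mvfderiv_chartVec x₀ hz hF, mvfderiv_chartVec x₀ hz hW]
  rfl

theorem contDiffOn_inChart {B : Type*} [NormedAddCommGroup B] [NormedSpace ℝ B] {G : S → B}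
    (hG : ContMDiff (𝓡 (n - 1)) 𝓘(ℝ, B) ∞ G) (x₀ : S) :
    ContDiffOn ℝ ∞ (inChart x₀ G) (extChartAt (𝓡 (n - 1)) x₀).target :=
  (hG.comp_contMDiffOn (contMDiffOn_extChartAt_symm x₀)).contDiffOn

theorem isParamHypersurface {rbar : EReal} {h : ℝ → ℝ} {F ν : S → Amb n} (hn : 3 ≤ n)
    (hF : IsHypersurface rbar F) (hν : IsUnitNormal h F ν) (x₀ : S) :
    IsParamHypersurface rbar h (extChartAt (𝓡 (n - 1)) x₀).target (inChart x₀ F)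
      (inChart x₀ ν) where
  dim := by omega
  isOpen := isOpen_extChartAt_target x₀
  smooth := contDiffOn_inChart hF.smooth x₀
  smooth_normal := contDiffOn_inChart hν.smooth x₀
  mem := fun z _ => hF.mem _
  immersion := fun z hz v w hvw => by
    have hd := (hF.smooth.mdifferentiable (by simp)) ((extChartAt (𝓡 (n - 1)) x₀).symm z)
    rw [← mvfderiv_chartVec x₀ hz hd, ← mvfderiv_chartVec x₀ hz hd] at hvw
    exact (chartVec_bijective x₀ hz).1 (hF.immersion _ hvw)
  tangent := fun z _ => hν.tangent _
  unit := fun z _ => hν.unit _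
  normal := fun z hz v => by
    have hd := (hF.smooth.mdifferentiable (by simp)) ((extChartAt (𝓡 (n - 1)) x₀).symm z)
    rw [← mvfderiv_chartVec x₀ hz hd]
    exact hν.normal _ _

variable {rbar : EReal} {h : ℝ → ℝ} {F ν : S → Amb n}

theorem firstForm_chartVec (hF : IsHypersurface rbar F) (x₀ : S)
    {z : EuclideanSpace ℝ (Fin (n - 1))} (hz : z ∈ (extChartAt (𝓡 (n - 1)) x₀).target)
    (v w : EuclideanSpace ℝ (Fin (n - 1))) :
    firstForm h F ((extChartAt (𝓡 (n - 1)) x₀).symm z) (chartVec x₀ z v) (chartVec x₀ z w)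
      = metric h (inChart x₀ F z) (fderiv ℝ (inChart x₀ F) z v) (fderiv ℝ (inChart x₀ F) z w) := by
  have hd := (hF.smooth.mdifferentiable (by simp)) ((extChartAt (𝓡 (n - 1)) x₀).symm z)
  rw [firstForm, mvfderiv_chartVec x₀ hz hd, mvfderiv_chartVec x₀ hz hd]
  rfl

theorem secondForm_chartVec (hF : IsHypersurface rbar F) (hν : IsUnitNormal h F ν) (x₀ : S)
    {z : EuclideanSpace ℝ (Fin (n - 1))} (hz : z ∈ (extChartAt (𝓡 (n - 1)) x₀).target)
    (v w : EuclideanSpace ℝ (Fin (n - 1))) :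
    secondForm rbar h F ν ((extChartAt (𝓡 (n - 1)) x₀).symm z) (chartVec x₀ z v)
        (chartVec x₀ z w)
      = metric h (inChart x₀ F z) (cov rbar h (inChart x₀ F) (inChart x₀ ν) z v)
        (fderiv ℝ (inChart x₀ F) z w) := by
  have hd := (hF.smooth.mdifferentiable (by simp)) ((extChartAt (𝓡 (n - 1)) x₀).symm z)
  have hd' := (hν.smooth.mdifferentiable (by simp)) ((extChartAt (𝓡 (n - 1)) x₀).symm z)
  rw [secondForm, mvfderiv_chartVec x₀ hz hd, covDeriv_chartVec x₀ hz hd hd']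
  rfl

theorem fderiv_eq_sum_coordField {m : ℕ} (P : EuclideanSpace ℝ (Fin m) → Amb n)
    (z v : EuclideanSpace ℝ (Fin m)) :
    fderiv ℝ P z v = ∑ a, v a • coordField P a z := by
  rw [sum_smul_coordField]

theorem cov_eq_sum {m : ℕ} (P N : EuclideanSpace ℝ (Fin m) → Amb n)
    (z v : EuclideanSpace ℝ (Fin m)) :
    cov rbar h P N z v = ∑ a, v a • cov rbar h P N z (EuclideanSpace.single a 1) := by
  conv_lhs => rw [euclidean_eq_sum v]
  simp only [cov_sum_dir, cov_smul_dir]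

theorem metric_fderiv_fderiv {m : ℕ} (P : EuclideanSpace ℝ (Fin m) → Amb n)
    (z v w : EuclideanSpace ℝ (Fin m)) :
    metric h (P z) (fderiv ℝ P z v) (fderiv ℝ P z w) = v.ofLp ⬝ᵥ gram h P z *ᵥ w.ofLp := by
  rw [fderiv_eq_sum_coordField, fderiv_eq_sum_coordField, metric_sum_left]
  simp only [dotProduct, IsParamHypersurface.gram_mulVec, metric_smul_left]

theorem metric_cov_fderiv {m : ℕ} (P N : EuclideanSpace ℝ (Fin m) → Amb n)
    (z v w : EuclideanSpace ℝ (Fin m)) :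
    metric h (P z) (cov rbar h P N z v) (fderiv ℝ P z w)
      = v.ofLp ⬝ᵥ sff rbar h P N z *ᵥ w.ofLp := by
  rw [fderiv_eq_sum_coordField, cov_eq_sum, metric_sum_left]
  simp only [dotProduct, Matrix.mulVec, metric_smul_left, metric_sum_right, metric_smul_right,
    sff_apply]
  refine Finset.sum_congr rfl fun a _ => ?_
  rw [Finset.mul_sum]
  exact Finset.sum_congr rfl fun _ _ => by ring

/-- The matrix of the induced metric in the standard basis of the tangent space. -/
def stdGram (h : ℝ → ℝ) (F : S → Amb n) (x : S) : Matrix (Fin (n - 1)) (Fin (n - 1)) ℝ :=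
  Matrix.of fun a b => firstForm h F x (stdVec x a) (stdVec x b)

/-- The matrix of the second fundamental form in the standard basis of the tangent space. -/
def stdSff (rbar : EReal) (h : ℝ → ℝ) (F ν : S → Amb n) (x : S) :
    Matrix (Fin (n - 1)) (Fin (n - 1)) ℝ :=
  Matrix.of fun a b => secondForm rbar h F ν x (stdVec x a) (stdVec x b)

/-- The standard basis at a point belongs to the preferred chart at that point, which need not vary
continuously with it. `K` is the inverse Jacobian relating it to the fixed chart at `x₀`, where
derivatives can be taken. -/
theorem exists_chartVec_eq_stdVec (x₀ : S) {z : EuclideanSpace ℝ (Fin (n - 1))}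
    (hz : z ∈ (extChartAt (𝓡 (n - 1)) x₀).target) :
    ∃ K : Matrix (Fin (n - 1)) (Fin (n - 1)) ℝ, K * chartJac x₀ z = 1 ∧
      ∀ c : Fin (n - 1) → ℝ, (∑ a, c a • stdVec ((extChartAt (𝓡 (n - 1)) x₀).symm z) a :
        TangentSpace (𝓡 (n - 1)) ((extChartAt (𝓡 (n - 1)) x₀).symm z))
        = chartVec x₀ z (WithLp.toLp 2 (K *ᵥ c)) := by
  have hJ : IsUnit (chartJac x₀ z) := by
    rw [← Matrix.mulVec_injective_iff_isUnit]
    intro c d hcd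
    have h1 : chartVec x₀ z (WithLp.toLp 2 c) = chartVec x₀ z (WithLp.toLp 2 d) := by
      rw [chartVec_eq_sum, chartVec_eq_sum]
      simp only [hcd]
    simpa using (chartVec_bijective x₀ hz).1 h1
  have hJ' := (Matrix.isUnit_iff_isUnit_det _).1 hJ
  refine ⟨(chartJac x₀ z)⁻¹, Matrix.nonsing_inv_mul _ hJ', fun c => ?_⟩
  rw [chartVec_eq_sum]
  simp only [Matrix.mulVec_mulVec, Matrix.mul_nonsing_inv _ hJ', Matrix.one_mulVec]

theorem gram_eq_stdGram (hF : IsHypersurface rbar F) (x₀ : S)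
    {z : EuclideanSpace ℝ (Fin (n - 1))} (hz : z ∈ (extChartAt (𝓡 (n - 1)) x₀).target)
    {K : Matrix (Fin (n - 1)) (Fin (n - 1)) ℝ}
    (hK : ∀ c : Fin (n - 1) → ℝ, (∑ a, c a • stdVec ((extChartAt (𝓡 (n - 1)) x₀).symm z) a :
        TangentSpace (𝓡 (n - 1)) ((extChartAt (𝓡 (n - 1)) x₀).symm z))
        = chartVec x₀ z (WithLp.toLp 2 (K *ᵥ c))) :
    stdGram h F ((extChartAt (𝓡 (n - 1)) x₀).symm z) = Kᵀ * gram h (inChart x₀ F) z * K := by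
  ext a b
  have hs : ∀ a, stdVec ((extChartAt (𝓡 (n - 1)) x₀).symm z) a
      = chartVec x₀ z (WithLp.toLp 2 (K *ᵥ Pi.single a 1)) := by
    intro a
    rw [← hK]
    exact stdVec_eq_sum _ a
  rw [stdGram, Matrix.of_apply, hs a, hs b, firstForm_chartVec hF x₀ hz, metric_fderiv_fderiv,
    Matrix.mulVec_single_one, Matrix.mulVec_single_one, mul_assoc]
  rfl

theorem sff_eq_stdSff (hF : IsHypersurface rbar F) (hν : IsUnitNormal h F ν) (x₀ : S)
    {z : EuclideanSpace ℝ (Fin (n - 1))} (hz : z ∈ (extChartAt (𝓡 (n - 1)) x₀).target)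
    {K : Matrix (Fin (n - 1)) (Fin (n - 1)) ℝ}
    (hK : ∀ c : Fin (n - 1) → ℝ, (∑ a, c a • stdVec ((extChartAt (𝓡 (n - 1)) x₀).symm z) a :
        TangentSpace (𝓡 (n - 1)) ((extChartAt (𝓡 (n - 1)) x₀).symm z))
        = chartVec x₀ z (WithLp.toLp 2 (K *ᵥ c))) :
    stdSff rbar h F ν ((extChartAt (𝓡 (n - 1)) x₀).symm z)
      = Kᵀ * sff rbar h (inChart x₀ F) (inChart x₀ ν) z * K := by
  ext a b
  have hs : ∀ a, stdVec ((extChartAt (𝓡 (n - 1)) x₀).symm z) a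
      = chartVec x₀ z (WithLp.toLp 2 (K *ᵥ Pi.single a 1)) := by
    intro a
    rw [← hK]
    exact stdVec_eq_sum _ a
  rw [stdSff, Matrix.of_apply, hs a, hs b, secondForm_chartVec hF hν x₀ hz, metric_cov_fderiv,
    Matrix.mulVec_single_one, Matrix.mulVec_single_one, mul_assoc]
  rfl

/-- The Weingarten matrix in the standard basis is conjugate to the one in a chart. -/
theorem weingarten_eq_conj (hF : IsHypersurface rbar F) (hν : IsUnitNormal h F ν) (x₀ : S)
    {z : EuclideanSpace ℝ (Fin (n - 1))} (hz : z ∈ (extChartAt (𝓡 (n - 1)) x₀).target)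
    {K J : Matrix (Fin (n - 1)) (Fin (n - 1)) ℝ} (hKJ : K * J = 1)
    (hK : ∀ c : Fin (n - 1) → ℝ, (∑ a, c a • stdVec ((extChartAt (𝓡 (n - 1)) x₀).symm z) a :
        TangentSpace (𝓡 (n - 1)) ((extChartAt (𝓡 (n - 1)) x₀).symm z))
        = chartVec x₀ z (WithLp.toLp 2 (K *ᵥ c))) :
    weingarten rbar h F ν ((extChartAt (𝓡 (n - 1)) x₀).symm z)
      = J * shape rbar h (inChart x₀ F) (inChart x₀ ν) z * K := by
  change (stdGram h F _)⁻¹ * stdSff rbar h F ν _ = _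
  have hJK : J * K = 1 := mul_eq_one_comm.1 hKJ
  have hKT : (Kᵀ)⁻¹ * Kᵀ = 1 := by
    rw [← Matrix.transpose_nonsing_inv, ← Matrix.transpose_mul, Matrix.inv_eq_left_inv hJK, hKJ,
      Matrix.transpose_one]
  rw [gram_eq_stdGram hF x₀ hz hK, sff_eq_stdSff hF hν x₀ hz hK, Matrix.mul_inv_rev,
    Matrix.mul_inv_rev, Matrix.inv_eq_left_inv hJK, shape]
  calc _ = J * ((gram h (inChart x₀ F) z)⁻¹ * ((Kᵀ)⁻¹ * Kᵀ)
        * sff rbar h (inChart x₀ F) (inChart x₀ ν) z) * K := by simp only [mul_assoc]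
    _ = _ := by rw [hKT, mul_one]

/-- The change of basis conjugates the Weingarten matrix, and `σ_p` is conjugation invariant.
Smoothness of `σ_p` on the hypersurface is read off from the right-hand side. -/
theorem sigmaCurv_eq (hF : IsHypersurface rbar F) (hν : IsUnitNormal h F ν) (x₀ : S)
    {z : EuclideanSpace ℝ (Fin (n - 1))} (hz : z ∈ (extChartAt (𝓡 (n - 1)) x₀).target) (p : ℕ) :
    sigmaCurv rbar h F ν p ((extChartAt (𝓡 (n - 1)) x₀).symm z)
      = sigma p (shape rbar h (inChart x₀ F) (inChart x₀ ν) z) := by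
  obtain ⟨K, hKJ, hK⟩ := exists_chartVec_eq_stdVec x₀ hz
  rw [sigmaCurv, weingarten_eq_conj hF hν x₀ hz hKJ hK, sigma_mul_comm, ← mul_assoc, hKJ, one_mul]

/-- The vector field `T^{(q+1)} X^⊤` on the hypersurface. -/
def newtonField (rbar : EReal) (h : ℝ → ℝ) (F ν : S → Amb n) (q : ℕ) (x : S) :
    TangentSpace (𝓡 (n - 1)) x :=
  ∑ a, (newton (weingarten rbar h F ν x) q *ᵥ ((stdGram h F x)⁻¹ *ᵥ fun c =>
    h (F x).2 * (mvfderiv (𝓡 (n - 1)) F x (stdVec x c)).2)) a • stdVec x a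

/-- The field is independent of the basis: `newton` transforms by conjugation and the raised index
by the inverse Gram matrix, so every factor `K` cancels. It can thus be used as a global vector
field. -/
theorem newtonField_eq (hF : IsHypersurface rbar F) (hν : IsUnitNormal h F ν) (x₀ : S)
    {z : EuclideanSpace ℝ (Fin (n - 1))} (hz : z ∈ (extChartAt (𝓡 (n - 1)) x₀).target) (q : ℕ) :
    newtonField rbar h F ν q ((extChartAt (𝓡 (n - 1)) x₀).symm z)
      = chartVec x₀ z (WithLp.toLp 2
        (newton (shape rbar h (inChart x₀ F) (inChart x₀ ν) z) q *ᵥ confTan h (inChart x₀ F) z)) := by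
  obtain ⟨K, hKJ, hK⟩ := exists_chartVec_eq_stdVec x₀ hz
  set J := chartJac x₀ z
  have hJK : J * K = 1 := mul_eq_one_comm.1 hKJ
  have hKT : (Kᵀ)⁻¹ * Kᵀ = 1 := by
    rw [← Matrix.transpose_nonsing_inv, ← Matrix.transpose_mul, Matrix.inv_eq_left_inv hJK, hKJ,
      Matrix.transpose_one]
  have hd := (hF.smooth.mdifferentiable (by simp)) ((extChartAt (𝓡 (n - 1)) x₀).symm z)
  have hr : (fun c => h (F ((extChartAt (𝓡 (n - 1)) x₀).symm z)).2 *
      (mvfderiv (𝓡 (n - 1)) F ((extChartAt (𝓡 (n - 1)) x₀).symm z)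
        (stdVec ((extChartAt (𝓡 (n - 1)) x₀).symm z) c)).2)
      = Kᵀ *ᵥ fun c => h (inChart x₀ F z).2 * (coordField (inChart x₀ F) c z).2 := by
    funext a
    have hs : stdVec ((extChartAt (𝓡 (n - 1)) x₀).symm z) a
        = chartVec x₀ z (WithLp.toLp 2 (K *ᵥ Pi.single a 1)) := by
      rw [← hK]
      exact stdVec_eq_sum _ a
    rw [hs, mvfderiv_chartVec x₀ hz hd, fderiv_eq_sum_coordField, Prod.snd_sum]
    rw [Matrix.mulVec_single_one]
    simp only [Matrix.mulVec, dotProduct, Finset.mul_sum, Prod.smul_snd, smul_eq_mul]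
    refine Finset.sum_congr rfl fun b _ => ?_
    change h (inChart x₀ F z).2 * (K b a * _) = K b a * _
    ring
  rw [newtonField, hK, hr]
  congr 2
  rw [weingarten_eq_conj hF hν x₀ hz hKJ hK, newton_conj hKJ, gram_eq_stdGram hF x₀ hz hK,
    confTan, Matrix.mul_inv_rev, Matrix.mul_inv_rev, Matrix.inv_eq_left_inv hJK]
  simp only [Matrix.mulVec_mulVec]
  congr 1
  calc _ = (K * J) * newton (shape rbar h (inChart x₀ F) (inChart x₀ ν) z) q * (K * J)
        * (gram h (inChart x₀ F) z)⁻¹ * ((Kᵀ)⁻¹ * Kᵀ) := by simp only [mul_assoc]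
    _ = _ := by rw [hKT, hKJ, one_mul, mul_one, mul_one]

end Transfer

/-! ### Convexity with respect to the star-shaped unit normal -/

section Convexity

open scoped Matrix

/-- A symmetric matrix whose eigenvalues relative to a positive definite one are non-negative is
positive semidefinite. -/
theorem posSemidef_of_relative_eigenvalues {m : ℕ} {g A : Matrix (Fin m) (Fin m) ℝ}
    (hg : g.PosDef) (hA : Aᵀ = A)
    (hk : ∀ (k : ℝ) (v : Fin m → ℝ), v ≠ 0 → A *ᵥ v = k • (g *ᵥ v) → 0 ≤ k) : A.PosSemidef := by
  obtain ⟨B, hBu, hB⟩ := exists_eq_transpose_mul_self_of_posDef hg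
  have hdet := (Matrix.isUnit_iff_isUnit_det _).1 hBu
  have hBi : B * B⁻¹ = 1 := Matrix.mul_nonsing_inv _ hdet
  have hBi' : B⁻¹ * B = 1 := Matrix.nonsing_inv_mul _ hdet
  have hT : Bᵀ * (B⁻¹)ᵀ = 1 := by rw [← Matrix.transpose_mul, hBi', Matrix.transpose_one]
  have hC : ((B⁻¹)ᵀ * A * B⁻¹).IsHermitian := by
    rw [Matrix.IsHermitian, Matrix.conjTranspose_eq_transpose_of_trivial, Matrix.transpose_mul,
      Matrix.transpose_mul, hA, Matrix.transpose_transpose, mul_assoc]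
  -- With `g = BᵀB`, an eigenvector `w` of `B⁻ᵀ A B⁻¹` gives the relative eigenvector `B⁻¹w` of `A`
  -- with the same eigenvalue, so the hypothesis controls the whole spectrum.
  have hP : ((B⁻¹)ᵀ * A * B⁻¹).PosSemidef := by
    rw [hC.posSemidef_iff_eigenvalues_nonneg]
    intro i
    set w : Fin m → ℝ := (hC.eigenvectorBasis i).ofLp
    have hw : ((B⁻¹)ᵀ * A * B⁻¹) *ᵥ w = hC.eigenvalues i • w := hC.mulVec_eigenvectorBasis i
    have hw0 : w ≠ 0 := by
      intro h0
      exact hC.eigenvectorBasis.orthonormal.ne_zero i (WithLp.ofLp_injective 2 h0)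
    refine hk _ (B⁻¹ *ᵥ w) (fun h0 => hw0 ?_) ?_
    · have := congrArg (fun u => B *ᵥ u) h0
      simpa [Matrix.mulVec_mulVec, hBi] using this
    · have h1 := congrArg (fun u => Bᵀ *ᵥ u) hw
      simp only [Matrix.mulVec_mulVec, Matrix.mulVec_smul] at h1
      rw [← mul_assoc, ← mul_assoc, hT, one_mul] at h1
      have h3 : g * B⁻¹ = Bᵀ := by rw [hB, mul_assoc, hBi, mul_one]
      rw [Matrix.mulVec_mulVec, h1, Matrix.mulVec_mulVec, h3]
  have h2 : A = Bᵀ * ((B⁻¹)ᵀ * A * B⁻¹) * B := by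
    calc A = (Bᵀ * (B⁻¹)ᵀ) * A * (B⁻¹ * B) := by rw [hT, hBi', one_mul, mul_one]
      _ = _ := by simp only [mul_assoc]
  rw [h2]
  simpa using hP.conjTranspose_mul_mul_same B

/-- A positive second derivative would make `x` a local minimum as well; `f` would then be locally
constant, with vanishing second derivative. -/
theorem deriv_deriv_nonpos_of_isLocalMax {f : ℝ → ℝ} {x : ℝ} (hf : ContinuousAt f x)
    (hmax : IsLocalMax f x) : deriv (deriv f) x ≤ 0 := by
  by_contra! hpos
  have hmin := isLocalMin_of_deriv_deriv_pos hpos hmax.deriv_eq_zero hf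
  have hc : f =ᶠ[nhds x] fun _ => f x := by
    filter_upwards [hmax, hmin] with y h1 h2
    exact le_antisymm h1 h2
  have h2 : deriv (deriv f) x = 0 := by
    rw [hc.deriv.deriv_eq]
    simp
  linarith

theorem fderiv_fderiv_nonpos_of_isLocalMax {E : Type*} [NormedAddCommGroup E] [NormedSpace ℝ E]
    {ρ : E → ℝ} {z : E} (hρ : ContDiffAt ℝ ∞ ρ z) (hmax : IsLocalMax ρ z) (v : E) :
    fderiv ℝ (fun y => fderiv ℝ ρ y v) z v ≤ 0 := by
  have hc : ContinuousAt (fun t : ℝ => z + t • v) 0 := by fun_prop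
  have hz : z + (0 : ℝ) • v = z := by simp
  have ht : Filter.Tendsto (fun t : ℝ => z + t • v) (nhds 0) (nhds z) := by
    have := hc.tendsto; rwa [hz] at this
  have hev : ∀ᶠ y in nhds z, DifferentiableAt ℝ ρ y := by
    filter_upwards [(hρ.of_le (m := 1) (by norm_cast)).eventually (by simp)] with y hy
    exact hy.differentiableAt (by simp)
  have h1 : deriv (fun t : ℝ => ρ (z + t • v)) =ᶠ[nhds 0] fun t => fderiv ℝ ρ (z + t • v) v := by
    filter_upwards [ht.eventually hev] with t hy
    have := hy.hasFDerivAt.comp_hasDerivAt t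
      (((hasDerivAt_id t).smul_const v).const_add z)
    simpa [Function.comp_def] using this.deriv
  have h2 := hasDerivAt_comp_line
    ((IsSmoothNear.contDiffAt_fderiv_apply hρ v).differentiableAt (by simp)) v
  rw [← h2.deriv, ← h1.deriv_eq]
  refine deriv_deriv_nonpos_of_isLocalMax ?_ ?_
  · exact ContinuousAt.comp (by rw [hz]; exact hρ.continuousAt) hc
  · have := ht.eventually hmax
    simpa [IsLocalMax, IsMaxFilter] using this

namespace IsParamHypersurface

variable {m n : ℕ} {rbar : EReal} {h : ℝ → ℝ} {V : Set (EuclideanSpace ℝ (Fin m))}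
  {P N N' : EuclideanSpace ℝ (Fin m) → Amb n} {z : EuclideanSpace ℝ (Fin m)}

theorem metric_radial (q w : Amb n) : metric h q (radial n) w = w.2 := by
  simp [metric, radial]

/-- If `dr` vanishes on the tangent space, then `∂_r` has no tangential part, so `∂_r = ⟨∂_r, N⟩ N`.
Both are unit vectors, and the sign condition makes the factor `1`. -/
theorem normal_eq_radial (hL : IsParamHypersurface rbar h V P N) (hh : IsWarpingFunction n rbar h)
    (hz : z ∈ V) (h0 : ∀ v, (fderiv ℝ P z v).2 = 0) (hN : 0 ≤ (N z).2) : N z = radial n := by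
  have h1 := hL.eq_sum_coordField_add_normal hh hz (u := radial n)
    (by simp [WarpedProduct.tangent, radial])
  simp only [metric_radial, coordField, h0] at h1
  have h1' : radial n = (N z).2 • N z := by
    rw [h1]
    have : ((gram h P z)⁻¹ *ᵥ fun _ => (0 : ℝ)) = 0 := Matrix.mulVec_zero _
    simp [this]
  have h3 : metric h (P z) (radial n) (N z) = (N z).2 * metric h (P z) (N z) (N z) := by
    simp only [metric_radial, hL.unit z hz, mul_one]
  have h4 : metric h (P z) (radial n) (radial n) = (N z).2 * (N z).2 := by
    conv_lhs => rw [h1', metric_smul_left, metric_smul_right, hL.unit z hz]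
    ring
  rw [metric_radial] at h4
  have h5 : (N z).2 = 1 := by
    have : (radial n : Amb n).2 = 1 := rfl
    rw [this] at h4
    nlinarith
  rw [h1', h5, one_smul]

/-- Near the point the hypersurface is part of the slice `r = 0` with normal `∂_r`. This slice is
totally geodesic because `h'(0) = 0`. -/
theorem sff_eq_zero (hL : IsParamHypersurface rbar h V P N) (hh : IsWarpingFunction n rbar h)
    (hz : z ∈ V) (h0 : ∀ᶠ y in nhds z, (P y).2 = 0) (hN : ∀ y ∈ V, 0 ≤ (N y).2) :
    sff rbar h P N z = 0 := by
  have hd : ∀ᶠ y in nhds z, ∀ v, (fderiv ℝ P y v).2 = 0 := by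
    filter_upwards [h0.eventually_nhds, hL.eventually_mem hz] with y hy hyV v
    have h1 := ((hL.near hyV).differentiableAt.hasFDerivAt.snd).fderiv
    have h2 : (fun y => (P y).2) =ᶠ[nhds y] fun _ => 0 := hy
    rw [h2.fderiv_eq] at h1
    have h3 := congrArg (fun L => L v) h1
    simpa using h3.symm
  have hNr : N =ᶠ[nhds z] fun _ => radial n := by
    filter_upwards [hd, hL.eventually_mem hz] with y hy hyV
    exact hL.normal_eq_radial hh hyV hy (hN y hyV)
  have hc : ∀ v, cov rbar h P N z v = 0 := by
    intro v
    rw [cov_congr rbar h P hNr, cov, h0.self_of_nhds, hh.H1.1]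
    simp
  ext a b
  rw [sff_apply, hc, metric_zero_left]
  rfl

/-- Comparison with a slice: at a local maximum of `r` the normal is `∂_r`, and the Gauss formula
gives the diagonal entry as `h h' |ω_a|² - ∂_a² r`. The first term is positive because the immersion
leaves a nonzero spherical part, and `∂_a² r ≤ 0`. -/
theorem sff_diag_pos (hL : IsParamHypersurface rbar h V P N) (hh : IsWarpingFunction n rbar h)
    (hz : z ∈ V) (hmax : IsLocalMax (fun y => (P y).2) z) (hpos : 0 < (P z).2)
    (hN : 0 ≤ (N z).2) (a : Fin m) : 0 < sff rbar h P N z a a := by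
  have hs : ContDiffAt ℝ ∞ (fun y => (P y).2) z := (hL.near hz).smooth.snd
  have hd : ∀ v, (fderiv ℝ P z v).2 = 0 := by
    intro v
    have h1 := ((hL.near hz).differentiableAt.hasFDerivAt.snd).fderiv
    rw [hmax.fderiv_eq_zero] at h1
    have h3 := congrArg (fun L => L v) h1
    simpa using h3.symm
  have hNz := hL.normal_eq_radial hh hz hd hN
  have h1 := hL.metric_cov_coordField_normal hh hz a a
  rw [hNz, metric_comm, metric_radial] at h1
  have h2 := fderiv_fderiv_nonpos_of_isLocalMax hs hmax (EuclideanSpace.single a 1)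
  have h3 : (fun y => fderiv ℝ (fun y => (P y).2) y (EuclideanSpace.single a 1))
      =ᶠ[nhds z] fun y => (coordField P a y).2 := by
    filter_upwards [hL.eventually_mem hz] with y hy
    rw [((hL.near hy).differentiableAt.hasFDerivAt.snd).fderiv]
    rfl
  have h4 : fderiv ℝ (fun y => (coordField P a y).2) z (EuclideanSpace.single a 1)
      = (fderiv ℝ (coordField P a) z (EuclideanSpace.single a 1)).2 := by
    rw [(((hL.contDiffAt_coordField hz a).differentiableAt (by simp)).hasFDerivAt.snd).fderiv]
    rfl
  rw [h3.fderiv_eq, h4] at h2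
  have hr := (hL.mem z hz).2
  have hh0 := hh.pos _ hr
  have hh1 := hh.H2 _ hr hpos
  have h5 : 0 < inner ℝ (coordField P a z).1 (coordField P a z).1 := by
    rw [real_inner_self_eq_norm_sq]
    have : (coordField P a z).1 ≠ 0 := by
      intro h0
      have h6 : fderiv ℝ P z (EuclideanSpace.single a 1) = 0 := Prod.ext h0 (hd _)
      have h7 := hL.immersion z hz (h6.trans (map_zero _).symm)
      simp at h7
    have := norm_pos_iff.2 this
    positivity
  have h6 : (cov rbar h P (coordField P a) z (EuclideanSpace.single a 1)).2
      = (fderiv ℝ (coordField P a) z (EuclideanSpace.single a 1)).2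
        - h (P z).2 * warpD rbar h (P z).2
          * inner ℝ (coordField P a z).1 (coordField P a z).1 := rfl
  rw [h6] at h1
  have := mul_pos (mul_pos hh0 hh1) h5
  linarith

theorem cov_neg (P N : EuclideanSpace ℝ (Fin m) → Amb n) (z v : EuclideanSpace ℝ (Fin m)) :
    cov rbar h P (fun y => -N y) z v = -cov rbar h P N z v := by
  unfold cov
  rw [fderiv_fun_neg]
  ext1
  · simp only [_root_.neg_apply, Prod.fst_neg, Prod.snd_neg, inner_neg_right]
    module
  · simp only [_root_.neg_apply, Prod.fst_neg, Prod.snd_neg, inner_neg_right]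
    ring

theorem sff_congr (hN : N =ᶠ[nhds z] N') : sff rbar h P N z = sff rbar h P N' z := by
  ext a b
  rw [sff_apply, sff_apply, cov_congr rbar h P hN]

theorem sff_neg (hN : N' =ᶠ[nhds z] fun y => -N y) : sff rbar h P N' z = -sff rbar h P N z := by
  ext a b
  rw [sff_apply, cov_congr rbar h P hN, cov_neg, Matrix.neg_apply, sff_apply, ← neg_one_smul ℝ,
    metric_smul_left]
  ring

/-- The orthogonal complement of the hypersurface in the tangent space of `M` is a line, so two unit
normals differ by a factor of square one. -/
theorem unitNormal_eq (hL : IsParamHypersurface rbar h V P N)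
    (hL' : IsParamHypersurface rbar h V P N') (hh : IsWarpingFunction n rbar h) (hz : z ∈ V) :
    N' z = metric h (P z) (N' z) (N z) • N z ∧ metric h (P z) (N' z) (N z) ^ 2 = 1 := by
  have h1 := hL.eq_sum_coordField_add_normal hh hz (hL'.tangent z hz)
  simp only [hL'.normal_coordField hz] at h1
  have h2 : ((gram h P z)⁻¹ *ᵥ fun _ => (0 : ℝ)) = 0 := Matrix.mulVec_zero _
  simp only [h2, Pi.zero_apply, zero_smul, Finset.sum_const_zero, zero_add] at h1
  refine ⟨h1, ?_⟩
  have h3 := hL'.unit z hz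
  rw [h1, metric_smul_left, metric_smul_right, hL.unit z hz] at h3
  rw [sq]
  linarith

end IsParamHypersurface

variable {n : ℕ} {S : Type*} [TopologicalSpace S]
  [ChartedSpace (EuclideanSpace ℝ (Fin (n - 1))) S] [IsManifold (𝓡 (n - 1)) ∞ S]
  {rbar : EReal} {h : ℝ → ℝ} {F ν : S → Amb n}

/-- Principal curvatures are the eigenvalues of the second fundamental form relative to the Gram
matrix. -/
theorem sff_posSemidef_of_principalCurvature (hn : 3 ≤ n) (hh : IsWarpingFunction n rbar h)
    (hF : IsHypersurface rbar F) (hν : IsUnitNormal h F ν)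
    (hk : ∀ x k, IsPrincipalCurvature rbar h F ν x k → 0 ≤ k) (x₀ : S)
    {z : EuclideanSpace ℝ (Fin (n - 1))} (hz : z ∈ (extChartAt (𝓡 (n - 1)) x₀).target) :
    (sff rbar h (inChart x₀ F) (inChart x₀ ν) z).PosSemidef := by
  have hL := isParamHypersurface hn hF hν x₀
  have hsymm : (sff rbar h (inChart x₀ F) (inChart x₀ ν) z)ᵀ
      = sff rbar h (inChart x₀ F) (inChart x₀ ν) z := by
    ext a b; exact hL.sff_comm hh hz b a
  refine posSemidef_of_relative_eigenvalues (hL.posDef_gram hh hz) hsymm fun k v hv hkv => ?_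
  refine hk ((extChartAt (𝓡 (n - 1)) x₀).symm z) k
    ⟨chartVec x₀ z (WithLp.toLp 2 v), fun h0 => hv ?_, fun w => ?_⟩
  · simpa using (chartVec_bijective x₀ hz).1 (h0.trans (map_zero (chartVec x₀ z)).symm)
  · obtain ⟨w, rfl⟩ := (chartVec_bijective x₀ hz).2 w
    rw [secondForm_chartVec hF hν x₀ hz, firstForm_chartVec hF x₀ hz, metric_cov_fderiv,
      metric_fderiv_fderiv, Matrix.dotProduct_mulVec, Matrix.dotProduct_mulVec,
      ← Matrix.mulVec_transpose, ← Matrix.mulVec_transpose, hsymm,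
      IsParamHypersurface.gram_isSymm]
    change (_ *ᵥ v) ⬝ᵥ _ = k * ((_ *ᵥ v) ⬝ᵥ _)
    rw [hkv, smul_dotProduct, smul_eq_mul]

/-- A convex hypersurface has non-negative second fundamental form with respect to the normal that
makes it star-shaped. -/
theorem sff_posSemidef [CompactSpace S] (hn : 3 ≤ n) (hh : IsWarpingFunction n rbar h)
    (hF : IsHypersurface rbar F) (hν : IsUnitNormal h F ν) (hstar : IsStarShapedWith h F ν)
    (hconv : IsConvexHypersurface rbar h F) (x₀ : S)
    {z : EuclideanSpace ℝ (Fin (n - 1))} (hz : z ∈ (extChartAt (𝓡 (n - 1)) x₀).target) :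
    (sff rbar h (inChart x₀ F) (inChart x₀ ν) z).PosSemidef := by
  obtain ⟨ν', hν', hk⟩ := hconv
  have hpsd := fun x₀ : S => fun z => sff_posSemidef_of_principalCurvature hn hh hF hν' hk x₀ (z := z)
  set c : S → ℝ := fun x => metric h (F x) (ν' x) (ν x) with hc
  have hFc := hF.smooth.continuous
  have hcont : Continuous c := by
    have h1 : Continuous fun x => h (F x).2 :=
      hh.smooth.continuousOn.comp_continuous hFc.snd fun x => (hF.mem x).2
    have h2 := hν.smooth.continuous
    have h3 := hν'.smooth.continuous
    exact (h3.snd.mul h2.snd).add ((h1.pow 2).mul (h3.fst.inner h2.fst))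
  have hstar' : ∀ x, 0 ≤ (ν x).2 := fun x => by
    have := hstar x
    rwa [IsParamHypersurface.metric_radial] at this
  -- The two normals differ by a continuous function `c` with `c² = 1`, so `{c < 0} = {c ≤ 0}` is
  -- both open and compact.
  have hcs : ∀ x, ν' x = c x • ν x ∧ c x ^ 2 = 1 := by
    intro x
    have hx := mem_extChartAt_source (I := 𝓡 (n - 1)) x
    have h1 := (isParamHypersurface hn hF hν x).unitNormal_eq (isParamHypersurface hn hF hν' x) hh
      ((extChartAt (𝓡 (n - 1)) x).map_source hx)
    simp only [inChart, Function.comp_apply, (extChartAt (𝓡 (n - 1)) x).left_inv hx] at h1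
    exact h1
  have hchart : ∀ x₀ : S, ∀ z ∈ (extChartAt (𝓡 (n - 1)) x₀).target, ∀ U : Set S, IsOpen U →
      (extChartAt (𝓡 (n - 1)) x₀).symm z ∈ U →
      ∀ᶠ y in nhds z, (extChartAt (𝓡 (n - 1)) x₀).symm y ∈ U := by
    intro x₀ z hz U hU hzU
    exact (continuousAt_extChartAt_symm'' hz).eventually (hU.mem_nhds hzU)
  have hneg : IsOpen {x | c x < 0} := isOpen_lt hcont continuous_const
  have hnegsff : ∀ x₀ : S, ∀ z ∈ (extChartAt (𝓡 (n - 1)) x₀).target,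
      c ((extChartAt (𝓡 (n - 1)) x₀).symm z) < 0 →
      sff rbar h (inChart x₀ F) (inChart x₀ ν') z
        = -sff rbar h (inChart x₀ F) (inChart x₀ ν) z := by
    intro x₀ z hz hcz
    refine IsParamHypersurface.sff_neg ?_
    filter_upwards [hchart x₀ z hz _ hneg hcz] with y hy
    have h1 := hcs ((extChartAt (𝓡 (n - 1)) x₀).symm y)
    have h2 : c ((extChartAt (𝓡 (n - 1)) x₀).symm y) = -1 := by
      have h3 : c ((extChartAt (𝓡 (n - 1)) x₀).symm y) < 0 := hy
      nlinarith [h1.2]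
    simp only [inChart, Function.comp_apply]
    rw [h1.1, h2, neg_one_smul]
  rcases lt_or_ge (c ((extChartAt (𝓡 (n - 1)) x₀).symm z)) 0 with hneg0 | hpos0
  -- On the part where the normals are opposite, take a point where `r` is largest; as this part is
  -- open, the point is a local maximum of `r` on the hypersurface.
  · have hcompact : IsCompact {x | c x ≤ 0} := (isClosed_le hcont continuous_const).isCompact
    obtain ⟨x₁, hx₁, hmax⟩ := hcompact.exists_isMaxOn ⟨_, hneg0.le⟩ hFc.snd.continuousOn
    have hx₁n : c x₁ < 0 := by
      have h1 := (hcs x₁).2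
      refine lt_of_le_of_ne hx₁ fun h0 => ?_
      rw [h0] at h1
      norm_num at h1
    have hmem := mem_extChartAt_source (I := 𝓡 (n - 1)) x₁
    have hz₁ := (extChartAt (𝓡 (n - 1)) x₁).map_source hmem
    have hinv := (extChartAt (𝓡 (n - 1)) x₁).left_inv hmem
    -- If the largest value of `r` is `0`, the whole part lies in the boundary slice and the form
    -- vanishes. Otherwise the comparison with a slice contradicts convexity for the opposite
    -- normal.
    rcases (hF.mem x₁).2.1.eq_or_lt with hr0 | hr0
    · have h0 : sff rbar h (inChart x₀ F) (inChart x₀ ν) z = 0 := by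
        refine (isParamHypersurface hn hF hν x₀).sff_eq_zero hh hz ?_ fun y _ => hstar' _
        filter_upwards [hchart x₀ z hz _ hneg hneg0] with y hy
        have h1 : (F ((extChartAt (𝓡 (n - 1)) x₀).symm y)).2 ≤ (F x₁).2 :=
          hmax (le_of_lt hy)
        exact le_antisymm (h1.trans hr0.symm.le) (hF.mem _).2.1
      rw [h0]
      exact Matrix.PosSemidef.zero
    · exfalso
      have h1 := (isParamHypersurface hn hF hν x₁).sff_diag_pos hh hz₁ (by
          filter_upwards [hchart x₁ _ hz₁ _ hneg (by rw [hinv]; exact hx₁n)] with y hy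
          simp only [inChart, Function.comp_apply, hinv]
          exact hmax (le_of_lt hy))
        (by simp only [inChart, Function.comp_apply, hinv]; exact hr0) (hstar' _)
        (⟨0, by omega⟩ : Fin (n - 1))
      have h2 := (hpsd x₁ _ hz₁).diag_nonneg (i := (⟨0, by omega⟩ : Fin (n - 1)))
      rw [hnegsff x₁ _ hz₁ (by rw [hinv]; exact hx₁n), Matrix.neg_apply] at h2
      linarith
  · have h1 : sff rbar h (inChart x₀ F) (inChart x₀ ν) z
        = sff rbar h (inChart x₀ F) (inChart x₀ ν') z := by
      refine IsParamHypersurface.sff_congr ?_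
      have hpos : IsOpen {x | 0 < c x} := isOpen_lt continuous_const hcont
      have hpos1 : 0 < c ((extChartAt (𝓡 (n - 1)) x₀).symm z) := by
        refine lt_of_le_of_ne hpos0 fun h0 => ?_
        have h1 := (hcs ((extChartAt (𝓡 (n - 1)) x₀).symm z)).2
        rw [← h0] at h1
        norm_num at h1
      filter_upwards [hchart x₀ z hz _ hpos hpos1] with y hy
      have h1 := hcs ((extChartAt (𝓡 (n - 1)) x₀).symm y)
      have h2 : c ((extChartAt (𝓡 (n - 1)) x₀).symm y) = 1 := by
        have h3 : 0 < c ((extChartAt (𝓡 (n - 1)) x₀).symm y) := hy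
        nlinarith [h1.2]
      simp only [inChart, Function.comp_apply]
      rw [h1.1, h2, one_smul]
    rw [h1]
    exact hpsd x₀ z hz

end Convexity

/-! ### The divergence theorem in a chart and the Riemannian measure -/

section Integration

open scoped Matrix

/-- The divergence theorem for compactly supported vector fields on an open set. -/
theorem integral_divergence_eq_zero {m : ℕ} {V K : Set (EuclideanSpace ℝ (Fin m))}
    (hV : IsOpen V) (hK : IsCompact K) (hKV : K ⊆ V)
    {G : Fin m → EuclideanSpace ℝ (Fin m) → ℝ}
    (hG : ∀ a, ∀ z ∈ V, ContDiffAt ℝ 1 (G a) z) (h0 : ∀ a, ∀ z ∈ V, z ∉ K → G a z = 0) :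
    IntegrableOn (fun z => ∑ a, fderiv ℝ (G a) z (EuclideanSpace.single a 1)) V ∧
      ∫ z in V, ∑ a, fderiv ℝ (G a) z (EuclideanSpace.single a 1) = 0 := by
  -- Extension by zero gives globally `C¹` functions, since each `G a` already vanishes on `V`
  -- outside the compact set `K`.
  set G' : Fin m → EuclideanSpace ℝ (Fin m) → ℝ := fun a => V.indicator (G a) with hG'
  have hzero : ∀ a, ∀ z, z ∉ K → G' a z = 0 := by
    intro a z hz
    by_cases hzV : z ∈ V
    · rw [hG']; simp only [indicator_of_mem hzV]; exact h0 a z hzV hz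
    · rw [hG']; simp only [indicator_of_notMem hzV]
  have hloc : ∀ a, ∀ z ∈ V, G' a =ᶠ[nhds z] G a := by
    intro a z hz
    filter_upwards [hV.mem_nhds hz] with y hy
    exact indicator_of_mem hy _
  have hsm : ∀ a, ContDiff ℝ 1 (G' a) := by
    intro a
    rw [contDiff_iff_contDiffAt]
    intro z
    by_cases hz : z ∈ K
    · exact (hG a z (hKV hz)).congr_of_eventuallyEq (hloc a z (hKV hz))
    · have : G' a =ᶠ[nhds z] fun _ => 0 := by
        filter_upwards [hK.isClosed.isOpen_compl.mem_nhds hz] with y hy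
        exact hzero a y hy
      exact contDiffAt_const.congr_of_eventuallyEq this
  have hsupp : ∀ a, HasCompactSupport (G' a) := fun a =>
    HasCompactSupport.intro hK fun z hz => hzero a z hz
  have hcont : ∀ a, Continuous fun z => fderiv ℝ (G' a) z (EuclideanSpace.single a 1) := fun a =>
    ((hsm a).continuous_fderiv (by simp)).clm_apply continuous_const
  have hsupp' : ∀ a, HasCompactSupport fun z =>
      fderiv ℝ (G' a) z (EuclideanSpace.single a 1) := fun a =>
    HasCompactSupport.fderiv_apply ℝ (hsupp a) _
  have hint : ∀ a, Integrable fun z => fderiv ℝ (G' a) z (EuclideanSpace.single a 1) := fun a =>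
    (hcont a).integrable_of_hasCompactSupport (hsupp' a)
  have hI : ∀ a, ∫ z, fderiv ℝ (G' a) z (EuclideanSpace.single a 1) = 0 := by
    intro a
    -- Integration by parts against the constant function `1`.
    have h1 := integral_mul_fderiv_eq_neg_fderiv_mul_of_integrable (μ := volume)
      (f := fun _ : EuclideanSpace ℝ (Fin m) => (1 : ℝ)) (g := G' a)
      (v := EuclideanSpace.single a 1) (by simp) (by simpa using hint a)
      (by simpa using (hsm a).continuous.integrable_of_hasCompactSupport (hsupp a))
      (fun x _ => differentiableAt_const _)
      (fun x _ => (hsm a).differentiable (by simp) x)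
    simpa using h1
  have heq : ∀ z ∈ V, ∑ a, fderiv ℝ (G' a) z (EuclideanSpace.single a 1)
      = ∑ a, fderiv ℝ (G a) z (EuclideanSpace.single a 1) := fun z hz =>
    Finset.sum_congr rfl fun a _ => by rw [(hloc a z hz).fderiv_eq]
  have hsum : Integrable fun z => ∑ a, fderiv ℝ (G' a) z (EuclideanSpace.single a 1) :=
    integrable_finsetSum _ fun a _ => hint a
  refine ⟨hsum.integrableOn.congr_fun heq hV.measurableSet, ?_⟩
  rw [← setIntegral_congr_fun hV.measurableSet heq,
    setIntegral_eq_integral_of_forall_compl_eq_zero, integral_finsetSum _ fun a _ => hint a]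
  · simp [hI]
  · intro z hz
    refine Finset.sum_eq_zero fun a _ => ?_
    by_contra hne
    have : z ∈ tsupport (G' a) := by
      have h3 := subset_tsupport (fun z => fderiv ℝ (G' a) z (EuclideanSpace.single a 1))
        (show z ∈ Function.support _ from hne)
      exact tsupport_fderiv_apply_subset ℝ _ h3
    have h4 : tsupport (G' a) ⊆ K :=
      closure_minimal (fun y hy => by_contra fun hyK => hy (hzero a y hyK)) hK.isClosed
    exact hz (hKV (h4 this))

/-- The Gram matrix of a composition. -/
theorem gram_comp {m n : ℕ} {h : ℝ → ℝ} {P : EuclideanSpace ℝ (Fin m) → Amb n}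
    {ψ : EuclideanSpace ℝ (Fin m) → EuclideanSpace ℝ (Fin m)} {z : EuclideanSpace ℝ (Fin m)}
    (hP : DifferentiableAt ℝ P (ψ z)) (hψ : DifferentiableAt ℝ ψ z) :
    (gram h (P ∘ ψ) z).det = (fderiv ℝ ψ z).det ^ 2 * (gram h P (ψ z)).det := by
  set b := (EuclideanSpace.basisFun (Fin m) ℝ).toBasis
  set J := LinearMap.toMatrix b b (fderiv ℝ ψ z : _ →ₗ[ℝ] EuclideanSpace ℝ (Fin m)) with hJ
  have h1 : gram h (P ∘ ψ) z = Jᵀ * gram h P (ψ z) * J := by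
    ext i j
    have h2 : ∀ a, coordField (P ∘ ψ) a z
        = fderiv ℝ P (ψ z) (fderiv ℝ ψ z (EuclideanSpace.single a 1)) := by
      intro a
      rw [coordField, fderiv_comp z hP hψ]
      rfl
    have h3 : ∀ a, (fderiv ℝ ψ z (EuclideanSpace.single a 1)).ofLp = fun c => J c a := by
      intro a
      funext c
      rw [hJ, LinearMap.toMatrix_apply]
      simp [b]
    change metric h (P (ψ z)) (coordField (P ∘ ψ) i z) (coordField (P ∘ ψ) j z) = _
    rw [h2, h2, metric_fderiv_fderiv, h3, h3, mul_assoc]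
    rfl
  have h4 : J.det = (fderiv ℝ ψ z).det := by
    rw [hJ, LinearMap.det_toMatrix]
  rw [h1, Matrix.det_mul, Matrix.det_mul, Matrix.det_transpose, h4]
  ring

variable {n : ℕ} {S : Type*} [TopologicalSpace S]
  [ChartedSpace (EuclideanSpace ℝ (Fin (n - 1))) S]

theorem continuous_of_inChart {B : Type*} [TopologicalSpace B] {g : S → B}
    (hg : ∀ x₀, ContinuousOn (inChart x₀ g) (extChartAt (𝓡 (n - 1)) x₀).target) :
    Continuous g := by
  rw [continuous_iff_continuousAt]
  intro x
  have h1 : ContinuousAt (inChart x g) (extChartAt (𝓡 (n - 1)) x x) :=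
    (hg x).continuousAt ((isOpen_extChartAt_target x).mem_nhds (mem_extChartAt_target x))
  refine (h1.comp (continuousAt_extChartAt x)).congr ?_
  filter_upwards [extChartAt_source_mem_nhds (I := 𝓡 (n - 1)) x] with y hy
  simp only [Function.comp_apply, inChart, (extChartAt (𝓡 (n - 1)) x).left_inv hy]

variable [MeasurableSpace S] [BorelSpace S]

theorem aemeasurable_extChartAt_symm (x₀ : S)
    (d : EuclideanSpace ℝ (Fin (n - 1)) → ENNReal) :
    AEMeasurable (extChartAt (𝓡 (n - 1)) x₀).symm
      ((volume.restrict (extChartAt (𝓡 (n - 1)) x₀).target).withDensity d) :=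
  ((continuousOn_extChartAt_symm x₀).aemeasurable
    (isOpen_extChartAt_target x₀).measurableSet).mono_ac (withDensity_absolutelyContinuous _ _)

theorem measurableSet_chart_preimage (x₀ : S) {A : Set S} (hA : MeasurableSet A) :
    MeasurableSet ((extChartAt (𝓡 (n - 1)) x₀).target ∩
      (extChartAt (𝓡 (n - 1)) x₀).symm ⁻¹' A) := by
  have hT := (isOpen_extChartAt_target (I := 𝓡 (n - 1)) x₀).measurableSet
  have h1 : Measurable ((extChartAt (𝓡 (n - 1)) x₀).target.domRestrict
      (extChartAt (𝓡 (n - 1)) x₀).symm) :=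
    (continuousOn_iff_continuous_domRestrict.1 (continuousOn_extChartAt_symm x₀)).measurable
  have h2 := hT.subtype_image (h1 hA)
  convert h2 using 1
  ext z
  constructor
  · rintro ⟨hz, hzA⟩
    exact ⟨⟨z, hz⟩, hzA, rfl⟩
  · rintro ⟨⟨y, hy⟩, hyA, rfl⟩
    exact ⟨hy, hyA⟩

theorem chartMeasure_apply (h : ℝ → ℝ) (F : S → Amb n) (x₀ : S) {A : Set S}
    (hA : MeasurableSet A) :
    chartMeasure h F x₀ A = ∫⁻ z in (extChartAt (𝓡 (n - 1)) x₀).target ∩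
      (extChartAt (𝓡 (n - 1)) x₀).symm ⁻¹' A,
        ENNReal.ofReal (Real.sqrt (gram h (inChart x₀ F) z).det) := by
  have hT := (isOpen_extChartAt_target (I := 𝓡 (n - 1)) x₀).measurableSet
  have hm := measurableSet_chart_preimage (n := n) x₀ hA
  rw [chartMeasure, Measure.map_apply_of_aemeasurable (aemeasurable_extChartAt_symm x₀ _) hA]
  have h1 : ((volume.restrict (extChartAt (𝓡 (n - 1)) x₀).target).withDensity
      fun z => ENNReal.ofReal (Real.sqrt (chartGram h F x₀ z).det))
      ((extChartAt (𝓡 (n - 1)) x₀).symm ⁻¹' A)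
      = ((volume.restrict (extChartAt (𝓡 (n - 1)) x₀).target).withDensity
      fun z => ENNReal.ofReal (Real.sqrt (chartGram h F x₀ z).det))
      ((extChartAt (𝓡 (n - 1)) x₀).target ∩ (extChartAt (𝓡 (n - 1)) x₀).symm ⁻¹' A) := by
    refine measure_congr ?_
    refine (withDensity_absolutelyContinuous _ _).ae_le ?_
    filter_upwards [ae_restrict_mem hT] with z hz
    exact propext ⟨fun h => ⟨hz, h⟩, fun h => h.2⟩
  rw [h1, withDensity_apply _ hm, Measure.restrict_restrict hm,
    inter_eq_left.2 (inter_subset_left)]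
  rfl

theorem chartMeasure_compl_source (h : ℝ → ℝ) (F : S → Amb n) (x₀ : S) :
    chartMeasure h F x₀ (extChartAt (𝓡 (n - 1)) x₀).sourceᶜ = 0 := by
  rw [chartMeasure_apply h F x₀ (isOpen_extChartAt_source x₀).measurableSet.compl]
  have : (extChartAt (𝓡 (n - 1)) x₀).target ∩ (extChartAt (𝓡 (n - 1)) x₀).symm ⁻¹'
      (extChartAt (𝓡 (n - 1)) x₀).sourceᶜ = ∅ := by
    ext z
    simp only [mem_inter_iff, mem_preimage, mem_compl_iff, mem_empty_iff_false, iff_false, not_and,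
      not_not]
    exact fun hz => (extChartAt (𝓡 (n - 1)) x₀).map_target hz
  rw [this]
  simp

variable [IsManifold (𝓡 (n - 1)) ∞ S] {rbar : EReal} {h : ℝ → ℝ} {F ν : S → Amb n}

/-- The Riemannian measures of two charts agree on the overlap. -/
theorem chartMeasure_eq_of_subset (hF : IsHypersurface rbar F) (x₀ x₁ : S) {A : Set S}
    (hA : MeasurableSet A) (h0 : A ⊆ (extChartAt (𝓡 (n - 1)) x₀).source)
    (h1 : A ⊆ (extChartAt (𝓡 (n - 1)) x₁).source) :
    chartMeasure h F x₀ A = chartMeasure h F x₁ A := by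
  rw [chartMeasure_apply h F x₀ hA, chartMeasure_apply h F x₁ hA]
  set φ₀ := extChartAt (𝓡 (n - 1)) x₀
  set φ₁ := extChartAt (𝓡 (n - 1)) x₁
  set ψ : EuclideanSpace ℝ (Fin (n - 1)) → EuclideanSpace ℝ (Fin (n - 1)) := φ₀ ∘ φ₁.symm
  have hd : ∀ z ∈ φ₁.target, φ₁.symm z ∈ φ₀.source → DifferentiableAt ℝ ψ z := by
    intro z hz hz0
    have e1 : ContMDiffAt (𝓡 (n - 1)) 𝓘(ℝ, EuclideanSpace ℝ (Fin (n - 1))) ∞ φ₀ (φ₁.symm z) :=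
      (contMDiffOn_extChartAt (n := ∞) (x := x₀)).contMDiffAt
        ((chartAt _ x₀).open_source.mem_nhds (by simpa [φ₀] using hz0))
    have e2 : ContMDiffAt 𝓘(ℝ, EuclideanSpace ℝ (Fin (n - 1))) (𝓡 (n - 1)) ∞ φ₁.symm z :=
      (contMDiffOn_extChartAt_symm x₁).contMDiffAt
        ((isOpen_extChartAt_target x₁).mem_nhds hz)
    exact (e1.comp z e2).contDiffAt.differentiableAt (by simp)
  have himg : φ₀.target ∩ φ₀.symm ⁻¹' A = ψ '' (φ₁.target ∩ φ₁.symm ⁻¹' A) := by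
    ext z
    constructor
    · rintro ⟨hz, hzA⟩
      refine ⟨φ₁ (φ₀.symm z), ⟨φ₁.map_source (h1 hzA), ?_⟩, ?_⟩
      · rw [mem_preimage, φ₁.left_inv (h1 hzA)]; exact hzA
      · simp only [ψ, Function.comp_apply]
        rw [φ₁.left_inv (h1 hzA), φ₀.right_inv hz]
    · rintro ⟨y, ⟨hy, hyA⟩, rfl⟩
      refine ⟨φ₀.map_source (h0 hyA), ?_⟩
      rw [mem_preimage]
      simp only [ψ, Function.comp_apply]
      rw [φ₀.left_inv (h0 hyA)]
      exact hyA
  have hm := measurableSet_chart_preimage (n := n) x₁ hA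
  have hinj : InjOn ψ (φ₁.target ∩ φ₁.symm ⁻¹' A) := by
    rintro y ⟨hy, hyA⟩ z ⟨hz, hzA⟩ hyz
    exact φ₁.symm.injOn hy hz (φ₀.injOn (h0 hyA) (h0 hzA) hyz)
  -- Change of variables along the transition map. Its factor `|det ψ'|` is what the Gram
  -- determinants absorb, since `det g` scales by `(det ψ')²`.
  rw [himg, lintegral_image_eq_lintegral_abs_det_fderiv_mul volume hm
    (fun z hz => (hd z hz.1 (h0 hz.2)).hasFDerivAt.hasFDerivWithinAt) hinj]
  refine setLIntegral_congr_fun hm fun z hz => ?_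
  have hz0 := h0 hz.2
  have hP : DifferentiableAt ℝ (inChart x₀ F) (ψ z) :=
    ((contDiffOn_inChart hF.smooth x₀).contDiffAt
      ((isOpen_extChartAt_target x₀).mem_nhds (φ₀.map_source hz0))).differentiableAt (by simp)
  have hev : inChart x₁ F =ᶠ[nhds z] inChart x₀ F ∘ ψ := by
    have hc : ContinuousAt φ₁.symm z :=
      (continuousOn_extChartAt_symm x₁).continuousAt ((isOpen_extChartAt_target x₁).mem_nhds hz.1)
    filter_upwards [hc.eventually ((isOpen_extChartAt_source x₀).mem_nhds hz0)] with y hy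
    simp only [inChart, Function.comp_apply, ψ]
    rw [φ₀.left_inv hy]
  have hg : gram h (inChart x₁ F) z = gram h (inChart x₀ F ∘ ψ) z := by
    ext a b
    change metric h (inChart x₁ F z) (coordField _ a z) (coordField _ b z)
      = metric h ((inChart x₀ F ∘ ψ) z) (coordField _ a z) (coordField _ b z)
    rw [coordField, coordField, hev.fderiv_eq, hev.eq_of_nhds]
    rfl
  rw [hg, gram_comp hP (hd z hz.1 hz0), Real.sqrt_mul (sq_nonneg _), Real.sqrt_sq_eq_abs,
    ENNReal.ofReal_mul (abs_nonneg _)]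

/-- The supremum of the chart measures restricts correctly because they agree on overlaps. -/
theorem surfaceMeasure_restrict_source (hF : IsHypersurface rbar F) (x₀ : S) :
    (surfaceMeasure h F).restrict (extChartAt (𝓡 (n - 1)) x₀).source = chartMeasure h F x₀ := by
  set s := (extChartAt (𝓡 (n - 1)) x₀).source
  have hs : MeasurableSet s := (isOpen_extChartAt_source x₀).measurableSet
  -- A measure above every chart measure, hence above the supremum: inside the chart domain compare
  -- on the overlap, outside keep the supremum itself.
  have hle : surfaceMeasure h F
      ≤ chartMeasure h F x₀ + (surfaceMeasure h F).restrict sᶜ := by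
    refine iSup_le fun x₁ => Measure.le_iff.2 fun A hA => ?_
    set s₁ := (extChartAt (𝓡 (n - 1)) x₁).source
    have hs₁ : MeasurableSet s₁ := (isOpen_extChartAt_source x₁).measurableSet
    rw [Measure.add_apply, Measure.restrict_apply hA, ← measure_inter_add_sdiff A hs,
      ← sdiff_eq_compl_inter.trans (inter_comm _ _)]
    refine add_le_add ?_ (le_iSup (chartMeasure h F) x₁ _)
    have h2 : chartMeasure h F x₁ (A ∩ s) = chartMeasure h F x₁ (A ∩ s ∩ s₁) :=
      (measure_inter_conull (chartMeasure_compl_source h F x₁)).symm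
    rw [h2, ← chartMeasure_eq_of_subset hF x₀ x₁ ((hA.inter hs).inter hs₁)
      (inter_subset_left.trans inter_subset_right) inter_subset_right]
    exact measure_mono (inter_subset_left.trans inter_subset_left)
  refine le_antisymm ?_ ?_
  · refine Measure.le_iff.2 fun A hA => ?_
    rw [Measure.restrict_apply hA]
    refine (hle _).trans ?_
    rw [Measure.add_apply, Measure.restrict_apply (hA.inter hs)]
    have : A ∩ s ∩ sᶜ = ∅ := by rw [inter_assoc, inter_compl_self, inter_empty]
    rw [this, measure_empty, add_zero]
    exact measure_mono inter_subset_left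
  · refine Measure.le_iff.2 fun A hA => ?_
    rw [Measure.restrict_apply hA,
      ← measure_inter_conull (s := A) (chartMeasure_compl_source h F x₀)]
    exact le_iSup (chartMeasure h F) x₀ _

end Integration

/-! ### The integral inequality: localization, partition of unity and summation -/

section Minkowski

open scoped Matrix

variable {n : ℕ} {S : Type*} [TopologicalSpace S]
  [ChartedSpace (EuclideanSpace ℝ (Fin (n - 1))) S]
  {rbar : EReal} {h : ℝ → ℝ} {F ν : S → Amb n}

theorem continuous_warpD_comp (hh : IsWarpingFunction n rbar h)
    (hF : IsHypersurface rbar F) : Continuous fun x => warpD rbar h (F x).2 :=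
  hh.smooth_warpD.continuousOn.comp_continuous hF.smooth.continuous.snd fun x => (hF.mem x).2

theorem continuous_metric_confField (hh : IsWarpingFunction n rbar h)
    (hF : IsHypersurface rbar F) (hν : IsUnitNormal h F ν) :
    Continuous fun x => metric h (F x) (confField h (F x)) (ν x) := by
  simp only [IsParamHypersurface.metric_confField]
  exact (hh.smooth.continuousOn.comp_continuous hF.smooth.continuous.snd fun x => (hF.mem x).2).mul
    hν.smooth.continuous.snd

variable [IsManifold (𝓡 (n - 1)) ∞ S]

theorem mvfderiv_newtonField (hF : IsHypersurface rbar F) (hν : IsUnitNormal h F ν) (x₀ : S)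
    {z : EuclideanSpace ℝ (Fin (n - 1))} (hz : z ∈ (extChartAt (𝓡 (n - 1)) x₀).target) (q : ℕ)
    {ρ : S → ℝ} (hρ : ContMDiff (𝓡 (n - 1)) 𝓘(ℝ, ℝ) ∞ ρ) :
    mvfderiv (𝓡 (n - 1)) ρ ((extChartAt (𝓡 (n - 1)) x₀).symm z)
      (newtonField rbar h F ν q ((extChartAt (𝓡 (n - 1)) x₀).symm z))
      = ∑ a, (newton (shape rbar h (inChart x₀ F) (inChart x₀ ν) z) q
          *ᵥ confTan h (inChart x₀ F) z) a
        * fderiv ℝ (inChart x₀ ρ) z (EuclideanSpace.single a 1) := by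
  rw [newtonField_eq hF hν x₀ hz, mvfderiv_chartVec x₀ hz (hρ.mdifferentiable (by simp) _)]
  conv_lhs => rw [euclidean_eq_sum (WithLp.toLp 2 _)]
  simp only [map_sum, map_smul, smul_eq_mul]

/-- The integrand of the Minkowski-type inequality. -/
def minkowskiIntegrand (rbar : EReal) (h : ℝ → ℝ) (F ν : S → Amb n) (q : ℕ) (x : S) : ℝ :=
  (((n - 1 : ℕ) : ℝ) - q) * (warpD rbar h (F x).2 * sigmaCurv rbar h F ν q x)
    - (q + 1) * (metric h (F x) (confField h (F x)) (ν x) * sigmaCurv rbar h F ν (q + 1) x)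

theorem continuous_sigmaCurv (hn : 3 ≤ n) (hh : IsWarpingFunction n rbar h)
    (hF : IsHypersurface rbar F) (hν : IsUnitNormal h F ν) (q : ℕ) :
    Continuous (sigmaCurv rbar h F ν q) := by
  refine continuous_of_inChart (n := n) fun x₀ => ?_
  have hL := isParamHypersurface hn hF hν x₀
  refine ContinuousOn.congr (f := fun z => sigma q (shape rbar h (inChart x₀ F) (inChart x₀ ν) z))
    (fun z hz => ?_) (fun z hz => sigmaCurv_eq hF hν x₀ hz q)
  exact (contDiffAt_sigma q (hL.contDiffAt_shape hh hz)).continuousAt.continuousWithinAt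

theorem continuous_minkowskiIntegrand (hn : 3 ≤ n) (hh : IsWarpingFunction n rbar h)
    (hF : IsHypersurface rbar F) (hν : IsUnitNormal h F ν) (q : ℕ) :
    Continuous (minkowskiIntegrand rbar h F ν q) :=
  (continuous_const.mul ((continuous_warpD_comp hh hF).mul
    (continuous_sigmaCurv hn hh hF hν q))).sub
  (continuous_const.mul ((continuous_metric_confField hh hF hν).mul
    (continuous_sigmaCurv hn hh hF hν (q + 1))))

theorem continuous_mvfderiv_newtonField (hn : 3 ≤ n) (hh : IsWarpingFunction n rbar h)
    (hF : IsHypersurface rbar F) (hν : IsUnitNormal h F ν) (q : ℕ) {ρ : S → ℝ}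
    (hρ : ContMDiff (𝓡 (n - 1)) 𝓘(ℝ, ℝ) ∞ ρ) :
    Continuous fun x => mvfderiv (𝓡 (n - 1)) ρ x (newtonField rbar h F ν q x) := by
  refine continuous_of_inChart (n := n) fun x₀ => ?_
  have hL := isParamHypersurface hn hF hν x₀
  refine ContinuousOn.congr (fun z hz => ?_) (fun z hz => mvfderiv_newtonField hF hν x₀ hz q hρ)
  refine ContinuousAt.continuousWithinAt ?_
  refine tendsto_finsetSum _ fun a _ => ?_
  exact (hL.contDiffAt_newton_confTan hh hz q a).continuousAt.mul
    (IsSmoothNear.contDiffAt_fderiv_apply ((contDiffOn_inChart hρ x₀).contDiffAt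
      ((isOpen_extChartAt_target x₀).mem_nhds hz)) _).continuousAt

theorem aemeasurable_sqrt_det_gram (hn : 3 ≤ n) (hh : IsWarpingFunction n rbar h)
    (hF : IsHypersurface rbar F) (hν : IsUnitNormal h F ν) (x₀ : S) :
    AEMeasurable (fun z => ENNReal.ofReal √(gram h (inChart x₀ F) z).det)
      (volume.restrict (extChartAt (𝓡 (n - 1)) x₀).target) := by
  have hL := isParamHypersurface hn hF hν x₀
  have h1 : ContinuousOn (fun z => √(gram h (inChart x₀ F) z).det)
      (extChartAt (𝓡 (n - 1)) x₀).target := fun z hz =>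
    (hL.contDiffAt_sqrt_det hh hz).continuousAt.continuousWithinAt
  exact (h1.aemeasurable (isOpen_extChartAt_target x₀).measurableSet).ennreal_ofReal

variable [MeasurableSpace S] [BorelSpace S]

theorem integral_eq_integral_chart (hn : 3 ≤ n) (hh : IsWarpingFunction n rbar h)
    (hF : IsHypersurface rbar F) (hν : IsUnitNormal h F ν) (x₀ : S) {g : S → ℝ}
    (hg : Continuous g) (h0 : ∀ x ∉ (extChartAt (𝓡 (n - 1)) x₀).source, g x = 0) :
    ∫ x, g x ∂(surfaceMeasure h F) = ∫ z in (extChartAt (𝓡 (n - 1)) x₀).target,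
      √(gram h (inChart x₀ F) z).det * inChart x₀ g z := by
  rw [← setIntegral_eq_integral_of_forall_compl_eq_zero h0, surfaceMeasure_restrict_source hF,
    chartMeasure, integral_map (aemeasurable_extChartAt_symm x₀ _)
      hg.measurable.aestronglyMeasurable]
  refine (integral_withDensity_eq_integral_toReal_smul₀
    (aemeasurable_sqrt_det_gram hn hh hF hν x₀) (by simp) _).trans ?_
  simp only [ENNReal.toReal_ofReal (Real.sqrt_nonneg _), smul_eq_mul]
  rfl

theorem integrableOn_chart (hn : 3 ≤ n) (hh : IsWarpingFunction n rbar h)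
    (hF : IsHypersurface rbar F) (hν : IsUnitNormal h F ν) (x₀ : S) {g : S → ℝ}
    (hg : Continuous g) (hi : Integrable g (surfaceMeasure h F)) :
    IntegrableOn (fun z => √(gram h (inChart x₀ F) z).det * inChart x₀ g z)
      (extChartAt (𝓡 (n - 1)) x₀).target := by
  have h1 := hi.restrict (s := (extChartAt (𝓡 (n - 1)) x₀).source)
  rw [surfaceMeasure_restrict_source hF, chartMeasure,
    integrable_map_measure hg.measurable.aestronglyMeasurable
      (aemeasurable_extChartAt_symm x₀ _)] at h1
  have h2 := (integrable_withDensity_iff_integrable_smul₀'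
    (aemeasurable_sqrt_det_gram hn hh hF hν x₀) (by simp)).1 h1
  simp only [ENNReal.toReal_ofReal (Real.sqrt_nonneg _), smul_eq_mul] at h2
  exact h2

/-- On a small coordinate ball the continuous density `√g` is bounded. With compactness, every
continuous function becomes integrable. -/
theorem isLocallyFiniteMeasure_surfaceMeasure (hn : 3 ≤ n) (hh : IsWarpingFunction n rbar h)
    (hF : IsHypersurface rbar F) (hν : IsUnitNormal h F ν) :
    IsLocallyFiniteMeasure (surfaceMeasure h F) := by
  refine ⟨fun x => ?_⟩
  have hL := isParamHypersurface hn hF hν x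
  have hz := mem_extChartAt_target (I := 𝓡 (n - 1)) x
  have hc : ContinuousAt (fun z => √(gram h (inChart x F) z).det) (extChartAt (𝓡 (n - 1)) x x) :=
    (hL.contDiffAt_sqrt_det hh hz).continuousAt
  set C := √(gram h (inChart x F) (extChartAt (𝓡 (n - 1)) x x)).det + 1 with hC
  have hev : ∀ᶠ z in nhds (extChartAt (𝓡 (n - 1)) x x), √(gram h (inChart x F) z).det < C :=
    hc.eventually_lt continuousAt_const (by simp [hC])
  obtain ⟨r, hr, hball⟩ := Metric.eventually_nhds_iff_ball.1 hev
  set U := (extChartAt (𝓡 (n - 1)) x).source ∩ (extChartAt (𝓡 (n - 1)) x) ⁻¹'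
    Metric.ball (extChartAt (𝓡 (n - 1)) x x) r with hU
  have hUo : IsOpen U := isOpen_extChartAt_preimage' x Metric.isOpen_ball
  refine ⟨U, hUo.mem_nhds ⟨mem_extChartAt_source x, Metric.mem_ball_self hr⟩, ?_⟩
  have h1 : surfaceMeasure h F U = chartMeasure h F x U := by
    rw [← surfaceMeasure_restrict_source hF, Measure.restrict_apply hUo.measurableSet,
      inter_eq_left.2 inter_subset_left]
  have hsub : (extChartAt (𝓡 (n - 1)) x).target ∩ (extChartAt (𝓡 (n - 1)) x).symm ⁻¹' U
      ⊆ Metric.ball (extChartAt (𝓡 (n - 1)) x x) r := by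
    rintro z ⟨hz, -, hz2⟩
    rw [mem_preimage, (extChartAt (𝓡 (n - 1)) x).right_inv hz] at hz2
    exact hz2
  rw [h1, chartMeasure_apply h F x hUo.measurableSet]
  calc _ ≤ ∫⁻ _ in (extChartAt (𝓡 (n - 1)) x).target ∩
        (extChartAt (𝓡 (n - 1)) x).symm ⁻¹' U, ENNReal.ofReal C := by
        refine setLIntegral_mono measurable_const fun z hz => ?_
        exact ENNReal.ofReal_le_ofReal (hball z (hsub hz)).le
    _ = ENNReal.ofReal C * volume ((extChartAt (𝓡 (n - 1)) x).target ∩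
        (extChartAt (𝓡 (n - 1)) x).symm ⁻¹' U) := by rw [setLIntegral_const]
    _ ≤ ENNReal.ofReal C * volume (Metric.ball (extChartAt (𝓡 (n - 1)) x x) r) := by
        gcongr
    _ < ⊤ := ENNReal.mul_lt_top ENNReal.ofReal_lt_top measure_ball_lt_top

variable [CompactSpace S]

theorem integrable_surfaceMeasure (hn : 3 ≤ n) (hh : IsWarpingFunction n rbar h)
    (hF : IsHypersurface rbar F) (hν : IsUnitNormal h F ν) {g : S → ℝ} (hg : Continuous g) :
    Integrable g (surfaceMeasure h F) := by
  have := isLocallyFiniteMeasure_surfaceMeasure hn hh hF hν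
  exact hg.integrable_of_hasCompactSupport (HasCompactSupport.of_compactSpace g)

/-- The inequality localized to a chart: `div (ρ T_q Xᵀ)` is `ρ` times the integrand, plus `dρ(T_q
Xᵀ)`, plus `ρ` times the non-negative divergence term. Its integral vanishes, and the last term is
dropped. -/
theorem integral_mul_minkowskiIntegrand_le (hn : 3 ≤ n) (hh : IsWarpingFunction n rbar h)
    (hF : IsHypersurface rbar F) (hν : IsUnitNormal h F ν) (hstar : IsStarShapedWith h F ν)
    (hconv : IsConvexHypersurface rbar h F) {q : ℕ} (hq : q ≤ n - 1) (x₀ : S) {ρ : S → ℝ}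
    (hρ : ContMDiff (𝓡 (n - 1)) 𝓘(ℝ, ℝ) ∞ ρ) (hρ0 : ∀ x, 0 ≤ ρ x)
    (hsupp : tsupport ρ ⊆ (extChartAt (𝓡 (n - 1)) x₀).source) :
    ∫ x, ρ x * minkowskiIntegrand rbar h F ν q x ∂(surfaceMeasure h F)
      ≤ -∫ x, mvfderiv (𝓡 (n - 1)) ρ x (newtonField rbar h F ν q x) ∂(surfaceMeasure h F) := by
  have hL := isParamHypersurface hn hF hν x₀
  have hV := isOpen_extChartAt_target (I := 𝓡 (n - 1)) x₀
  have hc1 : Continuous fun x => ρ x * minkowskiIntegrand rbar h F ν q x :=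
    hρ.continuous.mul (continuous_minkowskiIntegrand hn hh hF hν q)
  have hc2 := continuous_mvfderiv_newtonField hn hh hF hν q hρ
  have hi1 := integrable_surfaceMeasure hn hh hF hν hc1
  have hi2 := integrable_surfaceMeasure hn hh hF hν hc2
  have hc12 : Continuous fun x => ρ x * minkowskiIntegrand rbar h F ν q x
      + mvfderiv (𝓡 (n - 1)) ρ x (newtonField rbar h F ν q x) := hc1.add hc2
  have hρz : ∀ x ∉ tsupport ρ, ρ =ᶠ[nhds x] fun _ => 0 := fun x hx =>
    notMem_tsupport_iff_eventuallyEq.1 hx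
  have hz1 : ∀ x ∉ (extChartAt (𝓡 (n - 1)) x₀).source,
      ρ x * minkowskiIntegrand rbar h F ν q x
        + mvfderiv (𝓡 (n - 1)) ρ x (newtonField rbar h F ν q x) = 0 := by
    intro x hx
    have h1 := hρz x fun h => hx (hsupp h)
    have h2 : mvfderiv (𝓡 (n - 1)) ρ x = 0 := by
      unfold mvfderiv
      rw [h1.mfderiv_eq, mfderiv_const]
      rfl
    rw [h1.eq_of_nhds, h2]
    simp
  have hle : ∫ x, (ρ x * minkowskiIntegrand rbar h F ν q x
      + mvfderiv (𝓡 (n - 1)) ρ x (newtonField rbar h F ν q x)) ∂(surfaceMeasure h F) ≤ 0 := by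
    rw [integral_eq_integral_chart hn hh hF hν x₀ hc12 hz1]
    set Y := fun (a : Fin (n - 1)) z =>
      (newton (shape rbar h (inChart x₀ F) (inChart x₀ ν) z) q *ᵥ confTan h (inChart x₀ F) z) a
    have hρc : ∀ z ∈ (extChartAt (𝓡 (n - 1)) x₀).target, ContDiffAt ℝ ∞ (inChart x₀ ρ) z :=
      fun z hz => (contDiffOn_inChart hρ x₀).contDiffAt (hV.mem_nhds hz)
    have hGc : ∀ a, ∀ z ∈ (extChartAt (𝓡 (n - 1)) x₀).target,
        ContDiffAt ℝ ∞ (fun z => √(gram h (inChart x₀ F) z).det * Y a z) z := fun a z hz =>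
      (hL.contDiffAt_sqrt_det hh hz).mul (hL.contDiffAt_newton_confTan hh hz q a)
    obtain ⟨hA, hA0⟩ := integral_divergence_eq_zero hV
      (K := extChartAt (𝓡 (n - 1)) x₀ '' tsupport ρ)
      ((isClosed_tsupport ρ).isCompact.image_of_continuousOn
        ((continuousOn_extChartAt x₀).mono hsupp))
      (by rintro _ ⟨x, hx, rfl⟩; exact (extChartAt (𝓡 (n - 1)) x₀).map_source (hsupp hx))
      (G := fun a z => inChart x₀ ρ z * (√(gram h (inChart x₀ F) z).det * Y a z))
      (fun a z hz => ((hρc z hz).mul (hGc a z hz)).of_le (by norm_cast))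
      (fun a z hz hzK => by
        have : inChart x₀ ρ z = 0 := by
          by_contra hne
          exact hzK ⟨(extChartAt (𝓡 (n - 1)) x₀).symm z, subset_tsupport ρ hne,
            (extChartAt (𝓡 (n - 1)) x₀).right_inv hz⟩
        rw [this, zero_mul])
    rw [← hA0]
    refine setIntegral_mono_on (integrableOn_chart hn hh hF hν x₀ hc12 (hi1.add hi2)) hA
      hV.measurableSet fun z hz => ?_
    have hd1 := (hρc z hz).differentiableAt (by simp : (∞ : WithTop ℕ∞) ≠ 0)
    have hd2 := fun a => (hGc a z hz).differentiableAt (by simp : (∞ : WithTop ℕ∞) ≠ 0)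
    have e1 : ∑ a, fderiv ℝ (fun z => inChart x₀ ρ z * (√(gram h (inChart x₀ F) z).det * Y a z)) z
          (EuclideanSpace.single a 1)
        = inChart x₀ ρ z * ∑ a, fderiv ℝ (fun z => √(gram h (inChart x₀ F) z).det * Y a z) z
            (EuclideanSpace.single a 1)
          + √(gram h (inChart x₀ F) z).det * ∑ a, Y a z
            * fderiv ℝ (inChart x₀ ρ) z (EuclideanSpace.single a 1) := by
      rw [Finset.mul_sum, Finset.mul_sum, ← Finset.sum_add_distrib]
      refine Finset.sum_congr rfl fun a _ => ?_
      rw [fderiv_fun_mul hd1 (hd2 a)]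
      simp only [_root_.add_apply, _root_.smul_apply, smul_eq_mul]
      ring
    have e2 := hL.divergence_newton_confTan hh hz q
    have e3 : inChart x₀ (fun x => ρ x * minkowskiIntegrand rbar h F ν q x
        + mvfderiv (𝓡 (n - 1)) ρ x (newtonField rbar h F ν q x)) z
        = inChart x₀ ρ z * ((((n - 1 : ℕ) : ℝ) - q) * (warpD rbar h (inChart x₀ F z).2
            * sigma q (shape rbar h (inChart x₀ F) (inChart x₀ ν) z))
          - (q + 1) * (metric h (inChart x₀ F z) (confField h (inChart x₀ F z)) (inChart x₀ ν z)
            * sigma (q + 1) (shape rbar h (inChart x₀ F) (inChart x₀ ν) z)))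
          + ∑ a, Y a z * fderiv ℝ (inChart x₀ ρ) z (EuclideanSpace.single a 1) := by
      rw [← mvfderiv_newtonField hF hν x₀ hz q hρ, ← sigmaCurv_eq hF hν x₀ hz,
        ← sigmaCurv_eq hF hν x₀ hz]
      rfl
    have e4 : 0 ≤ IsParamHypersurface.newtonDiv rbar h (inChart x₀ F) (inChart x₀ ν) q z := by
      refine hL.newtonDiv_nonneg hh hz ?_ (sff_posSemidef hn hh hF hν hstar hconv x₀ hz) hq
      have := hstar ((extChartAt (𝓡 (n - 1)) x₀).symm z)
      rwa [IsParamHypersurface.metric_radial] at this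
    rw [e1, e2, e3]
    have e5 : 0 ≤ √(gram h (inChart x₀ F) z).det
        * (inChart x₀ ρ z
          * IsParamHypersurface.newtonDiv rbar h (inChart x₀ F) (inChart x₀ ν) q z) :=
      mul_nonneg (Real.sqrt_nonneg _) (mul_nonneg (hρ0 _) e4)
    linarith
  rw [integral_add hi1 hi2] at hle
  linarith

/-- Sum the localized inequalities over a partition of unity; the error terms add up to the
derivative of the constant `∑ ρ_i = 1` along `T_q Xᵀ`. -/
theorem integral_minkowskiIntegrand_nonpos (hn : 3 ≤ n) (hh : IsWarpingFunction n rbar h)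
    (hF : IsHypersurface rbar F) (hν : IsUnitNormal h F ν) (hstar : IsStarShapedWith h F ν)
    (hconv : IsConvexHypersurface rbar h F) {q : ℕ} (hq : q ≤ n - 1) :
    ∫ x, minkowskiIntegrand rbar h F ν q x ∂(surfaceMeasure h F) ≤ 0 := by
  -- The Hausdorff property needed for the partition of unity is inherited from the ambient space
  -- through the injective map `F`.
  have hT2 : T2Space S := T2Space.of_injective_continuous hF.injective hF.smooth.continuous
  obtain ⟨ρ, hρ⟩ := SmoothPartitionOfUnity.exists_isSubordinate (𝓡 (n - 1)) (s := (univ : Set S))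
    isClosed_univ (fun x : S => (extChartAt (𝓡 (n - 1)) x).source)
    (fun x => isOpen_extChartAt_source x)
    (fun x _ => mem_iUnion.2 ⟨x, mem_extChartAt_source x⟩)
  set T := ρ.locallyFinite.finite_nonempty_of_compact.toFinset
  have hsum : ∀ x, ∑ i ∈ T, ρ i x = 1 := by
    intro x
    rw [← ρ.sum_eq_one (mem_univ x)]
    refine (finsum_eq_sum_of_support_subset _ fun i hi => ?_).symm
    simp only [T, Finite.coe_toFinset]
    exact ⟨x, hi⟩
  have hsm : ∀ i, ContMDiff (𝓡 (n - 1)) 𝓘(ℝ, ℝ) ∞ (ρ i) := fun i => (ρ i).contMDiff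
  have hc1 := continuous_minkowskiIntegrand hn hh hF hν q
  have h1 : ∫ x, minkowskiIntegrand rbar h F ν q x ∂(surfaceMeasure h F)
      = ∑ i ∈ T, ∫ x, ρ i x * minkowskiIntegrand rbar h F ν q x ∂(surfaceMeasure h F) := by
    have hi : ∀ i ∈ T, Integrable (fun x => ρ i x * minkowskiIntegrand rbar h F ν q x)
        (surfaceMeasure h F) := fun i _ =>
      integrable_surfaceMeasure hn hh hF hν ((hsm i).continuous.mul hc1)
    rw [← integral_finsetSum _ hi]
    refine integral_congr_ae (Filter.Eventually.of_forall fun x => ?_)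
    simp only
    rw [← Finset.sum_mul, hsum, one_mul]
  have h2 : ∑ i ∈ T, ∫ x, mvfderiv (𝓡 (n - 1)) (ρ i) x (newtonField rbar h F ν q x)
      ∂(surfaceMeasure h F) = 0 := by
    rw [← integral_finsetSum _ fun i _ => integrable_surfaceMeasure hn hh hF hν
      (continuous_mvfderiv_newtonField hn hh hF hν q (hsm i))]
    refine (integral_congr_ae (Filter.Eventually.of_forall fun x => ?_)).trans (integral_zero S ℝ)
    have hz := mem_extChartAt_target (I := 𝓡 (n - 1)) x
    have hx : x = (extChartAt (𝓡 (n - 1)) x).symm (extChartAt (𝓡 (n - 1)) x x) :=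
      (extChartAt_to_inv (I := 𝓡 (n - 1)) x).symm
    have h3 : ∀ i, DifferentiableAt ℝ (inChart x (ρ i)) (extChartAt (𝓡 (n - 1)) x x) := fun i =>
      ((contDiffOn_inChart (hsm i) x).contDiffAt
        ((isOpen_extChartAt_target x).mem_nhds hz)).differentiableAt (by simp)
    have h4 : ∀ v, ∑ i ∈ T, fderiv ℝ (inChart x (ρ i)) (extChartAt (𝓡 (n - 1)) x x) v = 0 := by
      intro v
      have h5 : (fun z => ∑ i ∈ T, inChart (n := n) x (ρ i) z) = fun _ => 1 := funext fun _ => hsum _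
      have h6 := fderiv_fun_sum (𝕜 := ℝ) (u := T) (fun i _ => h3 i)
      rw [h5] at h6
      simpa using (congrArg (fun L => L v) h6).symm
    have h7 : ∀ y, y = (extChartAt (𝓡 (n - 1)) x).symm (extChartAt (𝓡 (n - 1)) x x) →
        ∑ i ∈ T, mvfderiv (𝓡 (n - 1)) (ρ i) y (newtonField rbar h F ν q y) = 0 := by
      rintro y rfl
      simp only [mvfderiv_newtonField hF hν x hz q (hsm _)]
      rw [Finset.sum_comm]
      refine Finset.sum_eq_zero fun a _ => ?_
      rw [← Finset.mul_sum, h4, mul_zero]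
    exact h7 x hx
  rw [h1]
  calc _ ≤ ∑ i ∈ T, -∫ x, mvfderiv (𝓡 (n - 1)) (ρ i) x (newtonField rbar h F ν q x)
        ∂(surfaceMeasure h F) := Finset.sum_le_sum fun i _ =>
          integral_mul_minkowskiIntegrand_le hn hh hF hν hstar hconv hq i (hsm i)
            (ρ.nonneg i) (hρ i)
    _ = 0 := by rw [Finset.sum_neg_distrib, h2, neg_zero]

/-- The Minkowski-type inequality. -/
theorem minkowski_inequality (hn : 3 ≤ n) (hh : IsWarpingFunction n rbar h)
    (hF : IsHypersurface rbar F) (hν : IsUnitNormal h F ν) (hstar : IsStarShapedWith h F ν)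
    (hconv : IsConvexHypersurface rbar h F) {p : ℕ} (hp : 1 ≤ p) (hpn : p ≤ n - 1) :
    ((n : ℝ) - p) * ∫ x, warpD rbar h (F x).2 * sigmaCurv rbar h F ν (p - 1) x
          ∂(surfaceMeasure h F)
      ≤ (p : ℝ) * ∫ x, metric h (F x) (confField h (F x)) (ν x) * sigmaCurv rbar h F ν p x
          ∂(surfaceMeasure h F) := by
  obtain ⟨q, rfl⟩ : ∃ q, p = q + 1 := ⟨p - 1, by omega⟩
  have h1 := integral_minkowskiIntegrand_nonpos hn hh hF hν hstar hconv (q := q) (by omega)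
  have hi1 : Integrable (fun x => warpD rbar h (F x).2 * sigmaCurv rbar h F ν q x)
      (surfaceMeasure h F) := integrable_surfaceMeasure hn hh hF hν
    ((continuous_warpD_comp hh hF).mul (continuous_sigmaCurv hn hh hF hν q))
  have hi2 : Integrable (fun x => metric h (F x) (confField h (F x)) (ν x)
      * sigmaCurv rbar h F ν (q + 1) x) (surfaceMeasure h F) := integrable_surfaceMeasure hn hh hF hν
    ((continuous_metric_confField hh hF hν).mul (continuous_sigmaCurv hn hh hF hν (q + 1)))
  simp only [minkowskiIntegrand] at h1
  rw [integral_sub (hi1.const_mul _) (hi2.const_mul _), integral_const_mul,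
    integral_const_mul] at h1
  -- With `p = q + 1` and dimension `m = n - 1`, the factor `m - q` is `n - p`.
  have h2 : (((n - 1 : ℕ) : ℝ) - q) = (n : ℝ) - (q + 1 : ℕ) := by
    rw [Nat.cast_sub (by omega)]
    push_cast
    ring
  rw [h2] at h1
  simp only [Nat.add_sub_cancel]
  push_cast at h1 ⊢
  linarith

end Minkowski

/-! ### Entrywise derivatives and moving frames in matrix form -/

section MatrixDerivative

open scoped Matrix

variable {m : ℕ} {V : Type*} [NormedAddCommGroup V] [NormedSpace ℝ V]

/-- The entrywise directional derivative of a matrix-valued function. -/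
def matDeriv (M : V → Matrix (Fin m) (Fin m) ℝ) (z v : V) : Matrix (Fin m) (Fin m) ℝ :=
  Matrix.of fun i j => fderiv ℝ (fun y => M y i j) z v

theorem differentiableAt_matrix_mul {M N : V → Matrix (Fin m) (Fin m) ℝ} {z : V}
    (hM : ∀ i j, DifferentiableAt ℝ (fun y => M y i j) z)
    (hN : ∀ i j, DifferentiableAt ℝ (fun y => N y i j) z) (i j : Fin m) :
    DifferentiableAt ℝ (fun y => (M y * N y) i j) z := by
  simp only [Matrix.mul_apply]
  exact DifferentiableAt.fun_sum fun k _ => (hM i k).fun_mul (hN k j)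

theorem matDeriv_mul {M N : V → Matrix (Fin m) (Fin m) ℝ} {z : V}
    (hM : ∀ i j, DifferentiableAt ℝ (fun y => M y i j) z)
    (hN : ∀ i j, DifferentiableAt ℝ (fun y => N y i j) z) (v : V) :
    matDeriv (fun y => M y * N y) z v = matDeriv M z v * N z + M z * matDeriv N z v := by
  ext i j
  simp only [matDeriv, Matrix.of_apply, Matrix.add_apply, Matrix.mul_apply]
  rw [fderiv_fun_sum fun k _ => (hM i k).fun_mul (hN k j), _root_.sum_apply,
    ← Finset.sum_add_distrib]
  refine Finset.sum_congr rfl fun k _ => ?_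
  rw [fderiv_fun_mul (hM i k) (hN k j)]
  simp only [_root_.add_apply, _root_.smul_apply, smul_eq_mul]
  ring

theorem matDeriv_transpose (M : V → Matrix (Fin m) (Fin m) ℝ) (z v : V) :
    matDeriv (fun y => (M y)ᵀ) z v = (matDeriv M z v)ᵀ := rfl

theorem matDeriv_congr {M N : V → Matrix (Fin m) (Fin m) ℝ} {z : V} (hMN : M =ᶠ[nhds z] N)
    (v : V) : matDeriv M z v = matDeriv N z v := by
  ext i j
  have : (fun y => M y i j) =ᶠ[nhds z] fun y => N y i j := hMN.mono fun y hy => by simp only [hy]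
  simp only [matDeriv, Matrix.of_apply, this.fderiv_eq]

theorem matDeriv_const (A : Matrix (Fin m) (Fin m) ℝ) (z v : V) :
    matDeriv (fun _ => A) z v = 0 := by
  ext i j
  simp [matDeriv]

/-- Skew-symmetry of the connection matrices turns the two corrections, one per index of the tensor,
into a single commutator `Ω T - T Ω`. `E` expresses the frame direction `l` through coordinate
directions. -/
theorem sum_mul_sub_sum_conn (E T : Matrix (Fin m) (Fin m) ℝ)
    {Ω : Fin m → Matrix (Fin m) (Fin m) ℝ} (hΩ : ∀ c, (Ω c)ᵀ = -Ω c)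
    (D : Fin m → Matrix (Fin m) (Fin m) ℝ) (l i j : Fin m) :
    ∑ c, E c l * D c j i - ∑ k, (∑ c, E c l * Ω c k i) * T j k
      - ∑ k, (∑ c, E c l * Ω c k j) * T k i
      = ∑ c, E c l * (D c + Ω c * T - T * Ω c) j i := by
  have h1 : ∀ c k, Ω c k j = -Ω c j k := fun c k => congrFun (congrFun (hΩ c) j) k
  have h2 : ∑ k, (∑ c, E c l * Ω c k i) * T j k = ∑ c, E c l * (T * Ω c) j i := by
    simp only [Matrix.mul_apply, Finset.mul_sum, Finset.sum_mul]
    rw [Finset.sum_comm]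
    exact Finset.sum_congr rfl fun _ _ => Finset.sum_congr rfl fun _ _ => by ring
  have h3 : ∑ k, (∑ c, E c l * Ω c k j) * T k i = -∑ c, E c l * (Ω c * T) j i := by
    simp only [h1, Matrix.mul_apply, Finset.mul_sum, Finset.sum_mul, ← Finset.sum_neg_distrib]
    rw [Finset.sum_comm]
    exact Finset.sum_congr rfl fun _ _ => Finset.sum_congr rfl fun _ _ => by ring
  simp only [h2, h3, Matrix.sub_apply, Matrix.add_apply, mul_sub, mul_add, Finset.sum_sub_distrib,
    Finset.sum_add_distrib]
  ring

/-- Contracting the derivative index with a tensor index is independent of the basis: the frame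
matrix `E` and its inverse `B` cancel, leaving only the free index. -/
theorem sum_sum_mul_conj {E B : Matrix (Fin m) (Fin m) ℝ} (hEB : E * B = 1)
    (D : Fin m → Matrix (Fin m) (Fin m) ℝ) (i : Fin m) :
    ∑ j, ∑ c, E c j * (B * D c * E) j i = ∑ b, (∑ c, D c c b) * E b i := by
  have h1 : ∀ c, ∑ j, E c j * (B * D c * E) j i = (D c * E) c i := by
    intro c
    rw [← Matrix.mul_apply (M := E), ← mul_assoc, ← mul_assoc, hEB, one_mul]
  rw [Finset.sum_comm]
  rw [Finset.sum_congr rfl fun c _ => h1 c]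
  simp only [Matrix.mul_apply, Finset.sum_mul]
  rw [Finset.sum_comm]

end MatrixDerivative

/-! ### Connection matrices of orthonormal frames in a parametrization -/

namespace IsParamHypersurface

open scoped Matrix

variable {m n : ℕ} {rbar : EReal} {h : ℝ → ℝ} {V : Set (EuclideanSpace ℝ (Fin m))}
  {P N : EuclideanSpace ℝ (Fin m) → Amb n} {z : EuclideanSpace ℝ (Fin m)}
  {E : EuclideanSpace ℝ (Fin m) → Matrix (Fin m) (Fin m) ℝ}

/-- The connection matrix of the frame `E` in the coordinate direction `c`. -/
def frameConn (rbar : EReal) (h : ℝ → ℝ) (P : EuclideanSpace ℝ (Fin m) → Amb n)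
    (E : EuclideanSpace ℝ (Fin m) → Matrix (Fin m) (Fin m) ℝ) (z : EuclideanSpace ℝ (Fin m))
    (c : Fin m) : Matrix (Fin m) (Fin m) ℝ :=
  (E z)ᵀ * gram h P z * (matDeriv E z (EuclideanSpace.single c 1)
    + christoffel rbar h P z c * E z)

theorem matDeriv_gram (hL : IsParamHypersurface rbar h V P N)
    (hh : IsWarpingFunction n rbar h) (hz : z ∈ V) (c : Fin m) :
    matDeriv (gram h P) z (EuclideanSpace.single c 1)
      = (christoffel rbar h P z c)ᵀ * gram h P z + gram h P z * christoffel rbar h P z c :=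
  hL.fderiv_gram hh hz c

/-- Differentiate the orthonormality relation `Eᵀ g E = 1`. -/
theorem frameConn_transpose (hL : IsParamHypersurface rbar h V P N)
    (hh : IsWarpingFunction n rbar h) (hz : z ∈ V)
    (hE : ∀ a i, DifferentiableAt ℝ (fun y => E y a i) z)
    (hon : ∀ᶠ y in nhds z, (E y)ᵀ * gram h P y * E y = 1) (c : Fin m) :
    (frameConn rbar h P E z c)ᵀ = -frameConn rbar h P E z c := by
  have hg := fun a b => (hL.contDiffAt_gram hh hz a b).differentiableAt
    (by simp : (∞ : WithTop ℕ∞) ≠ 0)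
  have hET : ∀ i a, DifferentiableAt ℝ (fun y => (E y)ᵀ i a) z := fun i a => hE a i
  have h1 := matDeriv_congr (M := fun y => (E y)ᵀ * gram h P y * E y) hon
    (EuclideanSpace.single c 1)
  rw [matDeriv_const, matDeriv_mul (differentiableAt_matrix_mul hET hg) hE,
    matDeriv_mul hET hg, matDeriv_transpose, hL.matDeriv_gram hh hz] at h1
  rw [eq_neg_iff_add_eq_zero, ← h1, frameConn]
  simp only [Matrix.transpose_mul, Matrix.transpose_add, Matrix.transpose_transpose, gram_isSymm]
  noncomm_ring

/-- The covariant derivative of the Newton transformation in an orthonormal frame. -/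
theorem matDeriv_newton_frame (hL : IsParamHypersurface rbar h V P N)
    (hh : IsWarpingFunction n rbar h) (hz : z ∈ V)
    (hE : ∀ a i, DifferentiableAt ℝ (fun y => E y a i) z)
    (hon : ∀ᶠ y in nhds z, (E y)ᵀ * gram h P y * E y = 1) (q : ℕ) (c : Fin m) :
    matDeriv (fun y => newton ((E y)ᵀ * sff rbar h P N y * E y) q) z (EuclideanSpace.single c 1)
      + frameConn rbar h P E z c * newton ((E z)ᵀ * sff rbar h P N z * E z) q
      - newton ((E z)ᵀ * sff rbar h P N z * E z) q * frameConn rbar h P E z c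
      = (E z)ᵀ * gram h P z * dNewton (shape rbar h P N z) (covShape rbar h P N z c) q * E z := by
  have hg := fun a b => (hL.contDiffAt_gram hh hz a b).differentiableAt
    (by simp : (∞ : WithTop ℕ∞) ≠ 0)
  have hW := fun a b => (hL.contDiffAt_shape hh hz a b).differentiableAt
    (by simp : (∞ : WithTop ℕ∞) ≠ 0)
  have hET : ∀ i a, DifferentiableAt ℝ (fun y => (E y)ᵀ i a) z := fun i a => hE a i
  have hF := differentiableAt_matrix_mul hET hg
  have hN := fun i j => (hasFDerivAt_newton q hW i j).1
  -- Orthonormality makes `Eᵀ g` the inverse of `E`, so the second fundamental form in the frame is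
  -- `W` conjugated by `E`, and `newton` follows by equivariance.
  have heq : (fun y => newton ((E y)ᵀ * sff rbar h P N y * E y) q)
      =ᶠ[nhds z] fun y => (E y)ᵀ * gram h P y * newton (shape rbar h P N y) q * E y := by
    filter_upwards [hon, hL.eventually_mem hz] with y hy hyV
    have h1 : (E y)ᵀ * sff rbar h P N y * E y
        = (E y)ᵀ * gram h P y * shape rbar h P N y * E y := by
      rw [shape]
      simp only [mul_assoc]
      rw [← mul_assoc (gram h P y) (gram h P y)⁻¹, hL.gram_mul_inv hh hyV, one_mul]
    rw [h1, newton_conj (mul_eq_one_comm.1 hy)]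
  have hT := heq.self_of_nhds
  have hinv := matDeriv_congr (M := fun y => (E y)ᵀ * gram h P y * E y) hon
    (EuclideanSpace.single c 1)
  rw [matDeriv_const, matDeriv_mul hF hE] at hinv
  have hEF : E z * ((E z)ᵀ * gram h P z) = 1 := mul_eq_one_comm.1 hon.self_of_nhds
  have hN' : matDeriv (fun y => newton (shape rbar h P N y) q) z (EuclideanSpace.single c 1)
      = dNewton (shape rbar h P N z) (matDeriv (shape rbar h P N) z
        (EuclideanSpace.single c 1)) q := by
    ext i j
    exact (hasFDerivAt_newton q hW i j).2 _
  have hcov : covShape rbar h P N z c = matDeriv (shape rbar h P N) z (EuclideanSpace.single c 1)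
      + (christoffel rbar h P z c * shape rbar h P N z
        - shape rbar h P N z * christoffel rbar h P z c) := rfl
  simp only at hT
  rw [hT, matDeriv_congr heq, matDeriv_mul (differentiableAt_matrix_mul hF hN) hE,
    matDeriv_mul hF hN, hN', hcov, dNewton_add, dNewton_commutator, frameConn]
  generalize matDeriv (fun y => (E y)ᵀ * gram h P y) z (EuclideanSpace.single c 1) = F' at *
  generalize (E z)ᵀ * gram h P z = B at *
  generalize matDeriv E z (EuclideanSpace.single c 1) = E' at *
  generalize dNewton _ _ _ = D
  generalize newton _ _ = T
  generalize christoffel rbar h P z c = Γ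
  generalize E z = A at *
  -- The derivative of an inverse matrix: differentiate `B E = 1` and solve using `E B = 1`.
  have hF' : F' = -(B * E' * B) := by
    calc F' = F' * A * B + B * E' * B - B * E' * B := by
          rw [mul_assoc, hEF, mul_one]; abel
      _ = (F' * A + B * E') * B - B * E' * B := by rw [add_mul]
      _ = _ := by rw [hinv]; simp
  have a1 : B * (E' + Γ * A) * (B * T * A) = B * E' * B * T * A + B * Γ * (A * B) * T * A := by
    noncomm_ring
  have a2 : B * T * A * (B * (E' + Γ * A)) = B * T * (A * B) * (E' + Γ * A) := by noncomm_ring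
  rw [hF', a1, a2, hEF]
  noncomm_ring

end IsParamHypersurface

/-! ### The divergence of the Newton tensor in a local orthonormal frame -/

section Frame

open scoped Matrix

variable {n : ℕ} {S : Type*} [TopologicalSpace S]
  [ChartedSpace (EuclideanSpace ℝ (Fin (n - 1))) S] [IsManifold (𝓡 (n - 1)) ∞ S]
  {rbar : EReal} {h : ℝ → ℝ} {F ν : S → Amb n} {U : Set S}
  {e : Fin (n - 1) → ∀ x : S, TangentSpace (𝓡 (n - 1)) x}

theorem mdifferentiableAt_of_inChart {B : Type*} [NormedAddCommGroup B] [NormedSpace ℝ B]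
    {G : S → B} (x₀ : S) {z : EuclideanSpace ℝ (Fin (n - 1))}
    (hz : z ∈ (extChartAt (𝓡 (n - 1)) x₀).target) (hG : DifferentiableAt ℝ (inChart x₀ G) z) :
    MDifferentiableAt (𝓡 (n - 1)) 𝓘(ℝ, B) G ((extChartAt (𝓡 (n - 1)) x₀).symm z) := by
  have hs := (extChartAt (𝓡 (n - 1)) x₀).map_target hz
  have h1 : MDifferentiableAt (𝓡 (n - 1)) 𝓘(ℝ, EuclideanSpace ℝ (Fin (n - 1)))
      (extChartAt (𝓡 (n - 1)) x₀) ((extChartAt (𝓡 (n - 1)) x₀).symm z) :=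
    ((contMDiffOn_extChartAt (n := ∞) (x := x₀)).contMDiffAt
      ((chartAt _ x₀).open_source.mem_nhds (by simpa using hs))).mdifferentiableAt (by simp)
  have h2 : MDifferentiableAt 𝓘(ℝ, EuclideanSpace ℝ (Fin (n - 1))) 𝓘(ℝ, B) (inChart x₀ G)
      (extChartAt (𝓡 (n - 1)) x₀ ((extChartAt (𝓡 (n - 1)) x₀).symm z)) := by
    rw [(extChartAt (𝓡 (n - 1)) x₀).right_inv hz]
    exact hG.mdifferentiableAt
  refine (h2.comp _ h1).congr_of_eventuallyEq ?_
  filter_upwards [(isOpen_extChartAt_source x₀).mem_nhds hs] with y hy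
  simp only [Function.comp_apply, inChart, (extChartAt (𝓡 (n - 1)) x₀).left_inv hy]

/-- The frame vector field `e i` as a vector field along the hypersurface. -/
def frameField (F : S → Amb n) (e : Fin (n - 1) → ∀ x : S, TangentSpace (𝓡 (n - 1)) x)
    (i : Fin (n - 1)) (x : S) : Amb n := mvfderiv (𝓡 (n - 1)) F x (e i x)

/-- The components of the frame in the chart at `x₀`. -/
def frameMatrix (h : ℝ → ℝ) (F : S → Amb n)
    (e : Fin (n - 1) → ∀ x : S, TangentSpace (𝓡 (n - 1)) x) (x₀ : S)
    (z : EuclideanSpace ℝ (Fin (n - 1))) : Matrix (Fin (n - 1)) (Fin (n - 1)) ℝ :=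
  (gram h (inChart x₀ F) z)⁻¹ * Matrix.of fun b i =>
    metric h (inChart x₀ F z) (coordField (inChart x₀ F) b z) (inChart x₀ (frameField F e i) z)

theorem contMDiffOn_frameField (hF : IsHypersurface rbar F) (he : IsOrthonormalFrame h F U e)
    (i : Fin (n - 1)) :
    ContMDiffOn (𝓡 (n - 1)) 𝓘(ℝ, Amb n) ∞ (frameField F e i) U := by
  have h1 := hF.smooth.contMDiff_tangentMap (m := ∞) (by simp)
  exact (contMDiff_snd_tangentBundle_modelSpace (Amb n) 𝓘(ℝ, Amb n)).comp_contMDiffOn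
    (h1.comp_contMDiffOn (he.smooth i))

theorem contDiffAt_frameField (hF : IsHypersurface rbar F) (he : IsOrthonormalFrame h F U e)
    (x₀ : S) {z : EuclideanSpace ℝ (Fin (n - 1))}
    (hz : z ∈ (extChartAt (𝓡 (n - 1)) x₀).target)
    (hU : (extChartAt (𝓡 (n - 1)) x₀).symm z ∈ U) (i : Fin (n - 1)) :
    ContDiffAt ℝ ∞ (inChart x₀ (frameField F e i)) z := by
  have h1 : ContMDiffAt (𝓡 (n - 1)) 𝓘(ℝ, Amb n) ∞ (frameField F e i)
      ((extChartAt (𝓡 (n - 1)) x₀).symm z) :=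
    (contMDiffOn_frameField hF he i).contMDiffAt (he.isOpen.mem_nhds hU)
  have h2 : ContMDiffAt 𝓘(ℝ, EuclideanSpace ℝ (Fin (n - 1))) (𝓡 (n - 1)) ∞
      (extChartAt (𝓡 (n - 1)) x₀).symm z :=
    (contMDiffOn_extChartAt_symm x₀).contMDiffAt ((isOpen_extChartAt_target x₀).mem_nhds hz)
  exact (h1.comp z h2).contDiffAt

theorem contDiffAt_frameMatrix (hn : 3 ≤ n) (hh : IsWarpingFunction n rbar h)
    (hF : IsHypersurface rbar F) (hν : IsUnitNormal h F ν) (he : IsOrthonormalFrame h F U e)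
    (x₀ : S) {z : EuclideanSpace ℝ (Fin (n - 1))}
    (hz : z ∈ (extChartAt (𝓡 (n - 1)) x₀).target)
    (hU : (extChartAt (𝓡 (n - 1)) x₀).symm z ∈ U) (a i : Fin (n - 1)) :
    ContDiffAt ℝ ∞ (fun y => frameMatrix h F e x₀ y a i) z := by
  have hL := isParamHypersurface hn hF hν x₀
  simp only [frameMatrix, Matrix.mul_apply]
  exact ContDiffAt.sum fun b _ => (hL.contDiffAt_gram_inv hh hz a b).mul
    ((hL.near hz).contDiffAt_metric hh (hL.contDiffAt_coordField hz b)
      (contDiffAt_frameField hF he x₀ hz hU i))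

/-- Pairing `e_i` with the coordinate fields and raising the index with `g⁻¹` recovers its chart
components. -/
theorem chartVec_frameMatrix (hn : 3 ≤ n) (hh : IsWarpingFunction n rbar h)
    (hF : IsHypersurface rbar F) (hν : IsUnitNormal h F ν) (x₀ : S)
    {z : EuclideanSpace ℝ (Fin (n - 1))}
    (hz : z ∈ (extChartAt (𝓡 (n - 1)) x₀).target) (i : Fin (n - 1)) :
    e i ((extChartAt (𝓡 (n - 1)) x₀).symm z)
      = chartVec x₀ z (WithLp.toLp 2 fun a => frameMatrix h F e x₀ z a i) := by
  have hL := isParamHypersurface hn hF hν x₀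
  obtain ⟨v, hv⟩ := (chartVec_bijective x₀ hz).2 (e i ((extChartAt (𝓡 (n - 1)) x₀).symm z))
  rw [← hv]
  congr 1
  have h1 : inChart x₀ (frameField F e i) z = ∑ a, v a • coordField (inChart x₀ F) a z := by
    rw [← fderiv_eq_sum_coordField, ← mvfderiv_chartVec x₀ hz (hF.smooth.mdifferentiable (by simp) _),
      hv]
    rfl
  have h2 : (fun a => frameMatrix h F e x₀ z a i) = v.ofLp := by
    have h3 : (fun b => metric h (inChart x₀ F z) (coordField (inChart x₀ F) b z)
        (inChart x₀ (frameField F e i) z)) = gram h (inChart x₀ F) z *ᵥ v.ofLp := by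
      funext b
      rw [h1, IsParamHypersurface.gram_mulVec]
    change (gram h (inChart x₀ F) z)⁻¹ *ᵥ (fun b => metric h (inChart x₀ F z)
      (coordField (inChart x₀ F) b z) (inChart x₀ (frameField F e i) z)) = _
    rw [h3, Matrix.mulVec_mulVec, hL.inv_mul_gram hh hz, Matrix.one_mulVec]
  rw [h2]

theorem frameField_eq_sum (hn : 3 ≤ n) (hh : IsWarpingFunction n rbar h)
    (hF : IsHypersurface rbar F) (hν : IsUnitNormal h F ν) (x₀ : S)
    {z : EuclideanSpace ℝ (Fin (n - 1))}
    (hz : z ∈ (extChartAt (𝓡 (n - 1)) x₀).target) (i : Fin (n - 1)) :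
    inChart x₀ (frameField F e i) z
      = ∑ a, frameMatrix h F e x₀ z a i • coordField (inChart x₀ F) a z := by
  change mvfderiv (𝓡 (n - 1)) F _ (e i ((extChartAt (𝓡 (n - 1)) x₀).symm z)) = _
  rw [chartVec_frameMatrix (e := e) (i := i) hn hh hF hν x₀ hz,
    mvfderiv_chartVec x₀ hz (hF.smooth.mdifferentiable (by simp) _), fderiv_eq_sum_coordField]

theorem frameMatrix_orthonormal (hn : 3 ≤ n) (hh : IsWarpingFunction n rbar h)
    (hF : IsHypersurface rbar F) (hν : IsUnitNormal h F ν) (he : IsOrthonormalFrame h F U e)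
    (x₀ : S) {z : EuclideanSpace ℝ (Fin (n - 1))}
    (hz : z ∈ (extChartAt (𝓡 (n - 1)) x₀).target)
    (hU : (extChartAt (𝓡 (n - 1)) x₀).symm z ∈ U) :
    (frameMatrix h F e x₀ z)ᵀ * gram h (inChart x₀ F) z * frameMatrix h F e x₀ z = 1 := by
  ext i j
  have h1 := he.orthonormal _ hU i j
  rw [chartVec_frameMatrix (e := e) (i := i) hn hh hF hν x₀ hz,
    chartVec_frameMatrix (e := e) (i := j) hn hh hF hν x₀ hz, firstForm_chartVec hF x₀ hz, metric_fderiv_fderiv] at h1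
  rw [Matrix.one_apply, ← h1, mul_assoc]
  rfl

/-- In the frame, `σ_{q+1}` is affine in the perturbed entry, so `∂σ_{q+1}/∂h_{ij}` is its slope, an
entry of the Newton transformation of order `q` with the indices exchanged. -/
theorem newtonTensor_eq (hn : 3 ≤ n) (hh : IsWarpingFunction n rbar h)
    (hF : IsHypersurface rbar F) (hν : IsUnitNormal h F ν) (x₀ : S)
    {z : EuclideanSpace ℝ (Fin (n - 1))}
    (hz : z ∈ (extChartAt (𝓡 (n - 1)) x₀).target) (q : ℕ) (i j : Fin (n - 1)) :
    newtonTensor rbar h F ν e (q + 1) i j ((extChartAt (𝓡 (n - 1)) x₀).symm z)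
      = newton ((frameMatrix h F e x₀ z)ᵀ * sff rbar h (inChart x₀ F) (inChart x₀ ν) z
        * frameMatrix h F e x₀ z) q j i := by
  have h1 : (Matrix.of fun a b => secondForm rbar h F ν ((extChartAt (𝓡 (n - 1)) x₀).symm z)
      (e a ((extChartAt (𝓡 (n - 1)) x₀).symm z)) (e b ((extChartAt (𝓡 (n - 1)) x₀).symm z)))
      = (frameMatrix h F e x₀ z)ᵀ * sff rbar h (inChart x₀ F) (inChart x₀ ν) z
        * frameMatrix h F e x₀ z := by
    ext a b
    rw [Matrix.of_apply, chartVec_frameMatrix (e := e) (i := a) hn hh hF hν x₀ hz,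
      chartVec_frameMatrix (e := e) (i := b) hn hh hF hν x₀ hz, secondForm_chartVec hF hν x₀ hz, metric_cov_fderiv,
      mul_assoc]
    rfl
  rw [newtonTensor, h1]
  simp only [sigma_add_smul_single]
  simp

/-- Pairing with a tangent frame vector discards the normal part in the Gauss formula; what remains
is the frame's connection matrix along the direction `e_l`. -/
theorem connCoeff_eq (hn : 3 ≤ n) (hh : IsWarpingFunction n rbar h)
    (hF : IsHypersurface rbar F) (hν : IsUnitNormal h F ν) (he : IsOrthonormalFrame h F U e)
    (x₀ : S) {z : EuclideanSpace ℝ (Fin (n - 1))}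
    (hz : z ∈ (extChartAt (𝓡 (n - 1)) x₀).target)
    (hU : (extChartAt (𝓡 (n - 1)) x₀).symm z ∈ U) (l i k : Fin (n - 1)) :
    connCoeff rbar h F e l i k ((extChartAt (𝓡 (n - 1)) x₀).symm z)
      = ∑ c, frameMatrix h F e x₀ z c l * IsParamHypersurface.frameConn rbar h (inChart x₀ F)
        (frameMatrix h F e x₀) z c k i := by
  have hL := isParamHypersurface hn hF hν x₀
  have hG := (contDiffAt_frameField hF he x₀ hz hU i).differentiableAt
    (by simp : (∞ : WithTop ℕ∞) ≠ 0)
  have hE := fun a => (contDiffAt_frameMatrix hn hh hF hν he x₀ hz hU a i).differentiableAt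
    (by simp : (∞ : WithTop ℕ∞) ≠ 0)
  have hC := fun a => (hL.contDiffAt_coordField hz a).differentiableAt
    (by simp : (∞ : WithTop ℕ∞) ≠ 0)
  have hF' := hF.smooth.mdifferentiable (by simp) ((extChartAt (𝓡 (n - 1)) x₀).symm z)
  have heq : inChart x₀ (frameField F e i) =ᶠ[nhds z] fun y =>
      ∑ a, frameMatrix h F e x₀ y a i • coordField (inChart x₀ F) a y :=
    (hL.eventually_mem hz).mono fun y hy => frameField_eq_sum hn hh hF hν x₀ hy i
  have h1 : ∀ c, metric h (inChart x₀ F z) (cov rbar h (inChart x₀ F)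
      (inChart x₀ (frameField F e i)) z (EuclideanSpace.single c 1))
      (inChart x₀ (frameField F e k) z)
      = IsParamHypersurface.frameConn rbar h (inChart x₀ F) (frameMatrix h F e x₀) z c k i := by
    intro c
    have h2 : ∀ b, metric h (inChart x₀ F z) (cov rbar h (inChart x₀ F)
        (inChart x₀ (frameField F e i)) z (EuclideanSpace.single c 1))
        (coordField (inChart x₀ F) b z)
        = (gram h (inChart x₀ F) z * (matDeriv (frameMatrix h F e x₀) z (EuclideanSpace.single c 1)
          + christoffel rbar h (inChart x₀ F) z c * frameMatrix h F e x₀ z)) b i := by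
      intro b
      rw [cov_congr rbar h _ heq, cov_sum_smul rbar h _ _ hE hC (hL.coordField_mem_tangent hz),
        metric_sum_left, mul_add, Matrix.add_apply, ← mul_assoc, Matrix.mul_apply, Matrix.mul_apply,
        ← Finset.sum_add_distrib]
      refine Finset.sum_congr rfl fun a _ => ?_
      rw [metric_add_left, metric_smul_left, metric_smul_left, hL.gram_mul_christoffel hh hz,
        metric_comm h _ (coordField (inChart x₀ F) a z)]
      change _ * gram h (inChart x₀ F) z b a + _ = gram h (inChart x₀ F) z b a * _ + _
      change fderiv ℝ (fun y => frameMatrix h F e x₀ y a i) z _ * _ + _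
        = _ * fderiv ℝ (fun y => frameMatrix h F e x₀ y a i) z _ + _
      ring
    rw [frameField_eq_sum hn hh hF hν x₀ hz k, metric_sum_right, IsParamHypersurface.frameConn,
      mul_assoc, Matrix.mul_apply]
    refine Finset.sum_congr rfl fun b _ => ?_
    rw [metric_smul_right, h2, Matrix.transpose_apply]
  simp only [← h1, ← metric_smul_left, ← metric_sum_left]
  rw [connCoeff, chartVec_frameMatrix (e := e) (i := l) hn hh hF hν x₀ hz]
  change metric h _ (covDeriv (𝓡 (n - 1)) rbar h F (frameField F e i) _ _) _ = _
  rw [covDeriv_chartVec x₀ hz hF' (mdifferentiableAt_of_inChart x₀ hz hG), cov_eq_sum]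
  rfl

/-- Skew-symmetry of the connection matrices turns the frame expression into the commutator form of
`matDeriv_newton_frame`: it is the coordinate covariant derivative of `T_q`, conjugated to the
frame. -/
theorem covDerivNewton_eq (hn : 3 ≤ n) (hh : IsWarpingFunction n rbar h)
    (hF : IsHypersurface rbar F) (hν : IsUnitNormal h F ν) (he : IsOrthonormalFrame h F U e)
    (x₀ : S) {z : EuclideanSpace ℝ (Fin (n - 1))}
    (hz : z ∈ (extChartAt (𝓡 (n - 1)) x₀).target)
    (hU : (extChartAt (𝓡 (n - 1)) x₀).symm z ∈ U) (q : ℕ) (l i j : Fin (n - 1)) :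
    covDerivNewton rbar h F ν e (q + 1) l i j ((extChartAt (𝓡 (n - 1)) x₀).symm z)
      = ∑ c, frameMatrix h F e x₀ z c l * ((frameMatrix h F e x₀ z)ᵀ * gram h (inChart x₀ F) z
        * dNewton (shape rbar h (inChart x₀ F) (inChart x₀ ν) z)
          (covShape rbar h (inChart x₀ F) (inChart x₀ ν) z c) q * frameMatrix h F e x₀ z) j i := by
  have hL := isParamHypersurface hn hF hν x₀
  have hE := fun a i => (contDiffAt_frameMatrix hn hh hF hν he x₀ hz hU a i)
  have hE' := fun a i => (hE a i).differentiableAt (by simp : (∞ : WithTop ℕ∞) ≠ 0)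
  have hS := fun a b => (hL.contDiffAt_sff hh hz a b)
  have hUev : ∀ᶠ y in nhds z, (extChartAt (𝓡 (n - 1)) x₀).symm y ∈ U :=
    (continuousAt_extChartAt_symm'' hz).eventually (he.isOpen.mem_nhds hU)
  have hon : ∀ᶠ y in nhds z, (frameMatrix h F e x₀ y)ᵀ * gram h (inChart x₀ F) y
      * frameMatrix h F e x₀ y = 1 := by
    filter_upwards [hUev, hL.eventually_mem hz] with y hy hyV
    exact frameMatrix_orthonormal hn hh hF hν he x₀ hyV hy
  have heq : inChart x₀ (newtonTensor rbar h F ν e (q + 1) i j) =ᶠ[nhds z] fun y =>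
      newton ((frameMatrix h F e x₀ y)ᵀ * sff rbar h (inChart x₀ F) (inChart x₀ ν) y
        * frameMatrix h F e x₀ y) q j i :=
    (hL.eventually_mem hz).mono fun y hy => newtonTensor_eq hn hh hF hν x₀ hy q i j
  have hdH : ∀ a b, DifferentiableAt ℝ (fun y => ((frameMatrix h F e x₀ y)ᵀ
      * sff rbar h (inChart x₀ F) (inChart x₀ ν) y * frameMatrix h F e x₀ y) a b) z :=
    differentiableAt_matrix_mul (differentiableAt_matrix_mul (fun a b => hE' b a) fun a b =>
      (hS a b).differentiableAt (by simp)) hE'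
  have hdT : DifferentiableAt ℝ (inChart x₀ (newtonTensor rbar h F ν e (q + 1) i j)) z :=
    (hasFDerivAt_newton q hdH j i).1.congr_of_eventuallyEq heq
  have hmain := fun c => hL.matDeriv_newton_frame hh hz hE' hon q c
  have hskew := fun c => hL.frameConn_transpose hh hz hE' hon c
  rw [covDerivNewton]
  simp only [connCoeff_eq hn hh hF hν he x₀ hz hU, newtonTensor_eq hn hh hF hν x₀ hz]
  rw [chartVec_frameMatrix (e := e) (i := l) hn hh hF hν x₀ hz,
    mvfderiv_chartVec x₀ hz (mdifferentiableAt_of_inChart x₀ hz hdT), heq.fderiv_eq,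
    euclidean_eq_sum (WithLp.toLp 2 _)]
  simp only [map_sum, map_smul, smul_eq_mul, ← hmain]
  exact sum_mul_sub_sum_conn (frameMatrix h F e x₀ z)
    (newton ((frameMatrix h F e x₀ z)ᵀ * sff rbar h (inChart x₀ F) (inChart x₀ ν) z
      * frameMatrix h F e x₀ z) q) hskew
    (fun c => matDeriv (fun y => newton ((frameMatrix h F e x₀ y)ᵀ
      * sff rbar h (inChart x₀ F) (inChart x₀ ν) y * frameMatrix h F e x₀ y) q) z
      (EuclideanSpace.single c 1)) l i j

/-- The double sum is a contraction of tensors, hence independent of the frame: the frame components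
of `X`, multiplied by the frame matrix, are the coordinate components of `Xᵀ`, because `E Eᵀ = g⁻¹`.
-/
theorem sum_metric_mul_covDerivNewton (hn : 3 ≤ n) (hh : IsWarpingFunction n rbar h)
    (hF : IsHypersurface rbar F) (hν : IsUnitNormal h F ν) (he : IsOrthonormalFrame h F U e)
    (x₀ : S) {z : EuclideanSpace ℝ (Fin (n - 1))}
    (hz : z ∈ (extChartAt (𝓡 (n - 1)) x₀).target)
    (hU : (extChartAt (𝓡 (n - 1)) x₀).symm z ∈ U) (q : ℕ) :
    ∑ i, ∑ j, metric h (F ((extChartAt (𝓡 (n - 1)) x₀).symm z))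
        (confField h (F ((extChartAt (𝓡 (n - 1)) x₀).symm z)))
        (mvfderiv (𝓡 (n - 1)) F ((extChartAt (𝓡 (n - 1)) x₀).symm z)
          (e i ((extChartAt (𝓡 (n - 1)) x₀).symm z)))
      * covDerivNewton rbar h F ν e (q + 1) j i j ((extChartAt (𝓡 (n - 1)) x₀).symm z)
      = IsParamHypersurface.newtonDiv rbar h (inChart x₀ F) (inChart x₀ ν) q z := by
  have hL := isParamHypersurface hn hF hν x₀
  have hon := frameMatrix_orthonormal hn hh hF hν he x₀ hz hU
  have hEF : frameMatrix h F e x₀ z * ((frameMatrix h F e x₀ z)ᵀ * gram h (inChart x₀ F) z) = 1 :=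
    mul_eq_one_comm.1 hon
  have hX : frameMatrix h F e x₀ z *ᵥ (fun i => metric h (inChart x₀ F z)
      (confField h (inChart x₀ F z)) (inChart x₀ (frameField F e i) z))
      = confTan h (inChart x₀ F) z := by
    have h1 : (fun i => metric h (inChart x₀ F z) (confField h (inChart x₀ F z))
        (inChart x₀ (frameField F e i) z)) = (frameMatrix h F e x₀ z)ᵀ *ᵥ
        fun c => h (inChart x₀ F z).2 * (coordField (inChart x₀ F) c z).2 := by
      funext i
      rw [frameField_eq_sum hn hh hF hν x₀ hz, metric_sum_right]
      refine Finset.sum_congr rfl fun a _ => ?_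
      rw [metric_smul_right, IsParamHypersurface.metric_confField]
      rfl
    have h2 : frameMatrix h F e x₀ z * (frameMatrix h F e x₀ z)ᵀ
        = (gram h (inChart x₀ F) z)⁻¹ := by
      rw [← mul_assoc] at hEF
      exact (Matrix.inv_eq_left_inv hEF).symm
    rw [h1, Matrix.mulVec_mulVec, h2]
    rfl
  have hsum : ∀ i, ∑ j, covDerivNewton rbar h F ν e (q + 1) j i j
      ((extChartAt (𝓡 (n - 1)) x₀).symm z)
      = ∑ b, (∑ c, dNewton (shape rbar h (inChart x₀ F) (inChart x₀ ν) z)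
          (covShape rbar h (inChart x₀ F) (inChart x₀ ν) z c) q c b)
        * frameMatrix h F e x₀ z b i := by
    intro i
    simp only [covDerivNewton_eq hn hh hF hν he x₀ hz hU]
    exact sum_sum_mul_conj hEF _ i
  calc _ = ∑ i, inChart x₀ (fun x => metric h (F x) (confField h (F x)) (frameField F e i x)) z
        * ∑ b, (∑ c, dNewton (shape rbar h (inChart x₀ F) (inChart x₀ ν) z)
          (covShape rbar h (inChart x₀ F) (inChart x₀ ν) z c) q c b)
        * frameMatrix h F e x₀ z b i := by
        refine Finset.sum_congr rfl fun i _ => ?_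
        rw [← hsum, Finset.mul_sum]
        rfl
    _ = _ := by
        rw [IsParamHypersurface.newtonDiv, ← hX]
        simp only [Matrix.mulVec, dotProduct, Finset.mul_sum]
        rw [Finset.sum_comm]
        refine Finset.sum_congr rfl fun b _ => Finset.sum_congr rfl fun i _ => ?_
        change metric h (inChart x₀ F z) (confField h (inChart x₀ F z))
          (inChart x₀ (frameField F e i) z) * _ = _
        ring

/-- The divergence of the Newton tensor, paired with the conformal field, is non-negative. -/
theorem sum_metric_mul_covDerivNewton_nonneg [CompactSpace S] (hn : 3 ≤ n)
    (hh : IsWarpingFunction n rbar h) (hF : IsHypersurface rbar F) (hν : IsUnitNormal h F ν)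
    (hstar : IsStarShapedWith h F ν) (hconv : IsConvexHypersurface rbar h F)
    (he : IsOrthonormalFrame h F U e) {p : ℕ} (hp : 1 ≤ p) (hpn : p ≤ n - 1) {x : S}
    (hx : x ∈ U) :
    0 ≤ ∑ i, ∑ j, metric h (F x) (confField h (F x)) (mvfderiv (𝓡 (n - 1)) F x (e i x))
      * covDerivNewton rbar h F ν e p j i j x := by
  obtain ⟨q, rfl⟩ : ∃ q, p = q + 1 := ⟨p - 1, by omega⟩
  have hz := mem_extChartAt_target (I := 𝓡 (n - 1)) x
  have key : ∀ y, y = (extChartAt (𝓡 (n - 1)) x).symm (extChartAt (𝓡 (n - 1)) x x) → y ∈ U →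
      0 ≤ ∑ i, ∑ j, metric h (F y) (confField h (F y)) (mvfderiv (𝓡 (n - 1)) F y (e i y))
        * covDerivNewton rbar h F ν e (q + 1) j i j y := by
    rintro y rfl hy
    rw [sum_metric_mul_covDerivNewton hn hh hF hν he x hz hy]
    refine (isParamHypersurface hn hF hν x).newtonDiv_nonneg hh hz ?_
      (sff_posSemidef hn hh hF hν hstar hconv x hz) (by omega)
    have := hstar ((extChartAt (𝓡 (n - 1)) x).symm (extChartAt (𝓡 (n - 1)) x x))
    rwa [IsParamHypersurface.metric_radial] at this
  exact key x (extChartAt_to_inv (I := 𝓡 (n - 1)) x).symm hx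

end Frame

end WarpedProduct

end

theorem proposition2p3 {n : ℕ} (hn : 3 ≤ n) {rbar : EReal} {h : ℝ → ℝ}
    (hh : WarpedProduct.IsWarpingFunction n rbar h)
    {S : Type*} [TopologicalSpace S] [CompactSpace S]
    [ChartedSpace (EuclideanSpace ℝ (Fin (n - 1))) S] [IsManifold (𝓡 (n - 1)) ∞ S]
    [MeasurableSpace S] [BorelSpace S]
    {F ν : S → WarpedProduct.Amb n}
    (hF : WarpedProduct.IsHypersurface rbar F)
    (hν : WarpedProduct.IsUnitNormal h F ν)
    (hstar : WarpedProduct.IsStarShapedWith h F ν)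
    (hconv : WarpedProduct.IsConvexHypersurface rbar h F)
    {p : ℕ} (hp : 1 ≤ p) (hpn : p ≤ n - 1) :
    (∀ (U : Set S) (e : Fin (n - 1) → ∀ x : S, TangentSpace (𝓡 (n - 1)) x),
      WarpedProduct.IsOrthonormalFrame h F U e → ∀ x ∈ U,
        0 ≤ ∑ i, ∑ j,
          WarpedProduct.metric h (F x) (WarpedProduct.confField h (F x))
              (mvfderiv (𝓡 (n - 1)) F x (e i x))
            * WarpedProduct.covDerivNewton rbar h F ν e p j i j x) ∧
    ((n : ℝ) - p) * ∫ x, WarpedProduct.warpD rbar h (F x).2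
          * WarpedProduct.sigmaCurv rbar h F ν (p - 1) x
          ∂(WarpedProduct.surfaceMeasure h F)
      ≤ (p : ℝ) * ∫ x, WarpedProduct.metric h (F x) (WarpedProduct.confField h (F x)) (ν x)
          * WarpedProduct.sigmaCurv rbar h F ν p x
          ∂(WarpedProduct.surfaceMeasure h F) :=
  ⟨fun _ _ he _ hx => WarpedProduct.sum_metric_mul_covDerivNewton_nonneg hn hh hF hν hstar hconv he
      hp hpn hx,
    WarpedProduct.minkowski_inequality hn hh hF hν hstar hconv hp hpn⟩
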